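/- \textbf{Conventions.} Manifolds are real, finite-dimensional, Hausdorff, second countable and $C^\infty$; maps, forms and vector fields are $C^\infty$. A presymplectic form is a closed 2-form of constant rank, and $\ker\Omega$ is the set of vector fields $Z$ with $i(Z)\Omega=0$, as well as the corresponding distribution. \textbf{Theorem (complete presymplectic reduction).} Let $\Omega$ be a presymplectic form on a manifold $M$ and $H\in C^\infty(M)$ such that $i(X)\Omega=dH$ has a solution $X\in\mathcal X(M)$ (a compatible presymplectic system). Let a connected Lie group $G$ with Lie algebra $\mathfrak g$ act smoothly, freely and properly on $M$ by maps $\Phi_g$ with $\Phi_g^*\Omega=\Omega$ and $\Phi_g^*H=H$ for all $g\in G$. For $\xi\in\mathfrak g$ let $\tilde\xi$ be its fundamental vector field, $\tilde\xi(x)=\frac{d}{dt}\big|_{t=0}\Phi_{\exp t\xi}(x)$. Suppose that every $Z\in\ker\Omega$ is a finite sum $Z=\sum_i f^i\tilde\xi_i$ with $f^i\in C^\infty(M)$, $\xi_i\in\mathfrak g$ (that is, $\ker\Omega\subset C^\infty(M)\otimes\tilde{\mathfrak g}$). Suppose that the action is Poissonian with momentum map $J\colon M\to\mathfrak g^*$: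 the functions $f_\xi=J(\cdot)(\xi)$ satisfy $i(\tilde\xi)\Omega=df_\xi$ and $f_{[\xi,\eta]}=\{f_\xi,f_\eta\}=\Omega(\tilde\xi,\tilde\eta)$. Let $\mu\in\mathfrak g^*$ be a weakly regular value of $J$: $J^{-1}(\mu)$ is an embedded submanifold of $M$ and $T_x(J^{-1}(\mu))=\ker T_xJ$ for every $x\in J^{-1}(\mu)$. Let $j_\mu\colon J^{-1}(\mu)\hookrightarrow M$ be the inclusion, $\Omega_\mu=j_\mu^*\Omega$, $H_\mu=j_\mu^*H$, and let $G_\mu$ be the isotropy group of $\mu$ for the coadjoint action. Suppose that the space $J^{-1}(\mu)/\ker\Omega_\mu$ of leaves of $\ker\Omega_\mu$, with the quotient topology, carries a manifold structure for which the canonical projection $\pi_\mu$ is a submersion. Then: 1. $\Omega_\mu$ is a presymplectic form, and $J^{-1}(\mu)$ is invariant under $G_\mu$. 2. The leaves of $\ker\Omega_\mu$ are the orbits in $J^{-1}(\mu)$ of the identity component of $G_\mu$. In particular, if $G_\mu$ is connected, then $J^{-1}(\mu)/\ker\Omega_\mu=J^{-1}(\mu)/G_\mu$. 3. There are a symplectic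 form $\hat\Omega$, a function $\hat H$ and a vector field $\hat X$ on $J^{-1}(\mu)/\ker\Omega_\mu$ such that $$\pi_\mu^*\hat\Omega=\Omega_\mu,\qquad \pi_\mu^*\hat H=H_\mu,\qquad i(\hat X)\hat\Omega=d\hat H .$$ 4. Every solution $X\in\mathcal X(M)$ of $i(X)\Omega=dH$ restricts to $J^{-1}(\mu)$: there is a unique $X_\mu\in\mathcal X(J^{-1}(\mu))$ that satisfies $i(X_\mu)\Omega_\mu=dH_\mu$ and $j_{\mu*}X_\mu=X|_{J^{-1}(\mu)}$. Every $X_\mu\in\mathcal X(J^{-1}(\mu))$ with $i(X_\mu)\Omega_\mu=dH_\mu$, in particular each of these restrictions, is $\pi_\mu$-projectable, with $\pi_{\mu*}X_\mu=\hat X$. -/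

import Mathlib

open scoped Manifold ContDiff

noncomputable section

namespace Presymplectic

/-! ### Two-forms on a manifold (modelled on a normed space, without boundary) -/

/-- A (not necessarily smooth) field of alternating bilinear forms on the tangent spaces of `M`. -/
abbrev TwoForm (E : Type*) [NormedAddCommGroup E] [NormedSpace ℝ E]
    (M : Type*) [TopologicalSpace M] [ChartedSpace E M] : Type _ :=
  ∀ x : M, TangentSpace 𝓘(ℝ, E) x [⋀^Fin 2]→L[ℝ] ℝ

/-- A (not necessarily smooth) vector field on `M`. -/
abbrev VField (E : Type*) [NormedAddCommGroup E] [NormedSpace ℝ E]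
    (M : Type*) [TopologicalSpace M] [ChartedSpace E M] : Type _ :=
  ∀ x : M, TangentSpace 𝓘(ℝ, E) x

/-- A field of tangent subspaces on `M`. -/
abbrev Distribution (E : Type*) [NormedAddCommGroup E] [NormedSpace ℝ E]
    (M : Type*) [TopologicalSpace M] [ChartedSpace E M] : Type _ :=
  ∀ x : M, Submodule ℝ (TangentSpace 𝓘(ℝ, E) x)

section Manifold

variable {E : Type*} [NormedAddCommGroup E] [NormedSpace ℝ E]
  {M : Type*} [TopologicalSpace M] [ChartedSpace E M]
  {E' : Type*} [NormedAddCommGroup E'] [NormedSpace ℝ E']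
  {M' : Type*} [TopologicalSpace M'] [ChartedSpace E' M']

/-- Smoothness of a vector field. -/
def IsSmoothField [IsManifold 𝓘(ℝ, E) ∞ M] (X : VField E M) : Prop :=
  ContMDiff 𝓘(ℝ, E) 𝓘(ℝ, E).tangent ∞ (fun x ↦ (⟨x, X x⟩ : TangentBundle 𝓘(ℝ, E) M))

/-- The pull-back `f^* Ω`. -/
def pullback (f : M → M') (Ω : TwoForm E' M') : TwoForm E M :=
  fun x ↦ (Ω (f x)).compContinuousLinearMap (mfderiv 𝓘(ℝ, E) 𝓘(ℝ, E') f x)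

/-- The expression of a two-form in the preferred chart at `c`, that is, its pull-back by the
inverse of this chart; it is meaningful on the target of the chart. -/
def inChart (Ω : TwoForm E M) (c : M) : E → E [⋀^Fin 2]→L[ℝ] ℝ :=
  fun y ↦ (Ω ((chartAt E c).symm y)).compContinuousLinearMap
    (mfderiv 𝓘(ℝ, E) 𝓘(ℝ, E) (chartAt E c).symm y)

/-- A two-form is smooth when all its chart expressions are. -/
def IsSmoothForm (Ω : TwoForm E M) : Prop :=
  ∀ c : M, ContDiffOn ℝ ∞ (inChart Ω c) (chartAt E c).target

/-- `dΩ = 0`, the exterior derivative being computed in charts. -/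
def IsClosedForm (Ω : TwoForm E M) : Prop :=
  ∀ c : M, ∀ y ∈ (chartAt E c).target, extDeriv (inChart Ω c) y = 0

/-- The kernel `ker Ω`, as a field of tangent subspaces. -/
def ker (Ω : TwoForm E M) : Distribution E M := fun x ↦
  { carrier := {v | ∀ w : TangentSpace 𝓘(ℝ, E) x, Ω x ![v, w] = 0}
    add_mem' := by
      intro a b ha hb w
      have h := (Ω x).toMultilinearMap.cons_add ![w] a b
      have h' : Ω x ![a + b, w] = Ω x ![a, w] + Ω x ![b, w] := h
      rw [h', ha w, hb w, add_zero]
    zero_mem' := by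
      intro w
      exact (Ω x).map_coord_zero 0 rfl
    smul_mem' := by
      intro c a ha w
      have h := (Ω x).toMultilinearMap.cons_smul ![w] c a
      have h' : Ω x ![c • a, w] = c • Ω x ![a, w] := h
      rw [h', ha w, smul_zero] }

/-- A presymplectic form: a smooth closed two-form of constant rank. (It may be degenerate;
nondegenerate forms are not excluded.) -/
structure IsPresymplectic (Ω : TwoForm E M) : Prop where
  smooth : IsSmoothForm Ω
  closed : IsClosedForm Ω
  constant_rank : ∃ r : ℕ, ∀ x : M, Module.finrank ℝ (ker Ω x) = r

/-- A symplectic form: a smooth closed nondegenerate two-form. -/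
structure IsSymplectic (Ω : TwoForm E M) : Prop where
  smooth : IsSmoothForm Ω
  closed : IsClosedForm Ω
  nondegenerate : ∀ x : M, ker Ω x = ⊥

/-- `X` is a smooth vector field with `i(X)Ω = dH`. -/
structure IsDynamics [IsManifold 𝓘(ℝ, E) ∞ M] (Ω : TwoForm E M) (H : M → ℝ) (X : VField E M) : Prop where
  smooth : IsSmoothField X
  equation : ∀ (x : M) (v : TangentSpace 𝓘(ℝ, E) x),
    Ω x ![X x, v] = mfderiv 𝓘(ℝ, E) 𝓘(ℝ, ℝ) H x v

/-- `f_* X = Y`: the vector field `X` on `M` is `f`-related to the vector field `Y` on `M'`. -/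
def IsRelated (f : M → M') (X : VField E M) (Y : VField E' M') : Prop :=
  ∀ x : M, mfderiv 𝓘(ℝ, E) 𝓘(ℝ, E') f x (X x) = Y (f x)

/-- Two points lie on the same leaf of the distribution `D` when they are joined by finitely many
smooth curves that are everywhere tangent to `D`. -/
def leafSetoid (D : Distribution E M) : Setoid M :=
  Relation.EqvGen.setoid fun x y ↦ ∃ γ : ℝ → M, ContMDiff 𝓘(ℝ, ℝ) 𝓘(ℝ, E) ∞ γ ∧
    (∀ t : ℝ, mfderiv 𝓘(ℝ, ℝ) 𝓘(ℝ, E) γ t (1 : ℝ) ∈ D (γ t)) ∧ γ 0 = x ∧ γ 1 = y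

/-- The space `M / D` of leaves, with the quotient topology. -/
abbrev LeafSpace (D : Distribution E M) : Type _ := Quotient (leafSetoid D)

/-- The canonical projection `M → M / D`. -/
def leafProj (D : Distribution E M) : M → LeafSpace D := Quotient.mk (leafSetoid D)

end Manifold

/-! ### Lie group actions and momentum maps -/

section Group

variable {E : Type*} [NormedAddCommGroup E] [NormedSpace ℝ E]
  {M : Type*} [TopologicalSpace M] [ChartedSpace E M]
  {V : Type*} [NormedAddCommGroup V] [NormedSpace ℝ V]
  {G : Type*} [TopologicalSpace G] [ChartedSpace V G] [Group G]

/-- The fundamental vector field of `ξ`: its value at `x` is the derivative at `g = 1` of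
`g ↦ g • x` in the direction `ξ`. -/
def fundamentalField [MulAction G M] (ξ : GroupLieAlgebra 𝓘(ℝ, V) G) : VField E M :=
  fun x ↦ (mfderiv 𝓘(ℝ, V) 𝓘(ℝ, E) (fun g : G ↦ g • x) 1 ξ : TangentSpace 𝓘(ℝ, E) ((1 : G) • x))

variable (V) in
/-- The dual `𝔤^*` of the Lie algebra `𝔤 = T_1 G` of `G`, whose underlying vector space is the
model space `V` of `G`. -/
abbrev LieDual : Type _ := V →L[ℝ] ℝ

variable (G) in
/-- `J` is the momentum map of a Poissonian action: the functions `f_ξ = J(·)(ξ)` are smooth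
and satisfy `i(ξ̃)Ω = d f_ξ`, and `ξ ↦ f_ξ` is a homomorphism of Lie algebras, where
`{f_ξ, f_η} = Ω(ξ̃, η̃)`. -/
structure IsPoissonianMomentumMap [MulAction G M] (Ω : TwoForm E M) (J : M → LieDual V) :
    Prop where
  smooth : ContMDiff 𝓘(ℝ, E) 𝓘(ℝ, LieDual V) ∞ J
  hamiltonian : ∀ (ξ : GroupLieAlgebra 𝓘(ℝ, V) G) (x : M) (v : TangentSpace 𝓘(ℝ, E) x),
    Ω x ![fundamentalField ξ x, v] = mfderiv 𝓘(ℝ, E) 𝓘(ℝ, ℝ) (fun y ↦ J y ξ) x v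
  bracket : ∀ (ξ η : GroupLieAlgebra 𝓘(ℝ, V) G) (x : M),
    J x (⁅ξ, η⁆ : GroupLieAlgebra 𝓘(ℝ, V) G) = Ω x ![fundamentalField ξ x, fundamentalField η x]

variable (V G) in
/-- `ker Ω ⊂ C^∞(M) ⊗ 𝔤̃`: every smooth vector field with values in `ker Ω` is a
`C^∞(M)`-linear combination of fundamental vector fields. -/
def KerGeneratedByAction [IsManifold 𝓘(ℝ, E) ∞ M] [MulAction G M] (Ω : TwoForm E M) : Prop :=
  ∀ Z : VField E M, IsSmoothField Z → (∀ x, Z x ∈ ker Ω x) →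
    ∃ (n : ℕ) (f : Fin n → M → ℝ) (ξ : Fin n → GroupLieAlgebra 𝓘(ℝ, V) G),
      (∀ i, ContMDiff 𝓘(ℝ, E) 𝓘(ℝ, ℝ) ∞ (f i)) ∧
      ∀ x, Z x = ∑ i, f i x • fundamentalField (ξ i) x

/-- The level set `J⁻¹(μ)`, with the subspace topology. -/
abbrev LevelSet (J : M → LieDual V) (μ : LieDual V) : Type _ := ↥(J ⁻¹' {μ})

/-- The inclusion `j_μ : J⁻¹(μ) → M`. -/
def levelIncl (J : M → LieDual V) (μ : LieDual V) : LevelSet J μ → M := Subtype.val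

/-- `μ` is a weakly regular value of `J`: with the given manifold structure, `J⁻¹(μ)` is an
embedded submanifold of `M`, and its tangent space at every point `x` is `ker T_x J`. -/
structure IsWeaklyRegularValue (J : M → LieDual V) (μ : LieDual V)
    {F : Type*} [NormedAddCommGroup F] [NormedSpace ℝ F] [ChartedSpace F (LevelSet J μ)]
    [IsManifold 𝓘(ℝ, F) ∞ (LevelSet J μ)] : Prop where
  embedding : Manifold.IsSmoothEmbedding 𝓘(ℝ, F) 𝓘(ℝ, E) ∞ (levelIncl J μ)
  tangent : ∀ (x : LevelSet J μ) (v : TangentSpace 𝓘(ℝ, E) (levelIncl J μ x)),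
    (∃ u : TangentSpace 𝓘(ℝ, F) x, mfderiv 𝓘(ℝ, F) 𝓘(ℝ, E) (levelIncl J μ) x u = v) ↔
      mfderiv 𝓘(ℝ, E) 𝓘(ℝ, LieDual V) J (levelIncl J μ x) v = 0

/-- The adjoint representation: `Ad g` is the derivative at `1` of `h ↦ g h g⁻¹`. -/
def Ad (g : G) : V →L[ℝ] V :=
  mfderiv 𝓘(ℝ, V) 𝓘(ℝ, V) (fun h : G ↦ g * h * g⁻¹) 1

theorem Ad_one : Ad (1 : G) = ContinuousLinearMap.id ℝ V := by
  have h : (fun h : G ↦ (1 : G) * h * (1 : G)⁻¹) = id := by ext; simp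
  unfold Ad
  rw [h]
  exact mfderiv_id

theorem Ad_mul [LieGroup 𝓘(ℝ, V) ∞ G] (g k : G) : Ad (g * k) = (Ad g).comp (Ad k : V →L[ℝ] V) := by
  have hd : ∀ (a x : G), MDifferentiableAt 𝓘(ℝ, V) 𝓘(ℝ, V) (fun h : G ↦ a * h * a⁻¹) x := by
    intro a x
    have : ContMDiff 𝓘(ℝ, V) 𝓘(ℝ, V) ∞ (fun h : G ↦ a * h * a⁻¹) :=
      (contMDiff_mul_right (a := a⁻¹)).comp (contMDiff_mul_left (a := a))
    exact this.mdifferentiable (by simp) x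
  have hf : (fun h : G ↦ (g * k) * h * (g * k)⁻¹)
      = (fun h : G ↦ g * h * g⁻¹) ∘ (fun h : G ↦ k * h * k⁻¹) := by
    ext h; simp [mul_assoc]
  have key := mfderiv_comp (I' := 𝓘(ℝ, V)) (1 : G)
    (hd g ((fun h : G ↦ k * h * k⁻¹) 1)) (hd k 1)
  have h1 : (fun h : G ↦ k * h * k⁻¹) 1 = 1 := by simp
  unfold Ad
  rw [hf]
  refine key.trans ?_
  have h2 : ∀ x : G, x = 1 →
      ((mfderiv 𝓘(ℝ, V) 𝓘(ℝ, V) (fun h : G ↦ g * h * g⁻¹) x : V →L[ℝ] V))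
        = mfderiv 𝓘(ℝ, V) 𝓘(ℝ, V) (fun h : G ↦ g * h * g⁻¹) 1 := by
    rintro x rfl
    rfl
  exact congrArg (fun T : V →L[ℝ] V ↦
    T.comp (mfderiv 𝓘(ℝ, V) 𝓘(ℝ, V) (fun h : G ↦ k * h * k⁻¹) 1 : V →L[ℝ] V)) (h2 _ h1)

variable (G) in
/-- The isotropy group `G_μ` of `μ` for the coadjoint action `Ad*_g μ = μ ∘ Ad g⁻¹`. -/
def isotropy [LieGroup 𝓘(ℝ, V) ∞ G] (μ : LieDual V) : Subgroup G where
  carrier := {g | ∀ ξ : GroupLieAlgebra 𝓘(ℝ, V) G, μ (Ad g⁻¹ ξ : V) = μ ξ}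
  one_mem' := by
    intro ξ
    rw [inv_one, Ad_one]
    rfl
  mul_mem' := by
    intro a b ha hb ξ
    rw [mul_inv_rev, Ad_mul]
    exact (hb _).trans (ha ξ)
  inv_mem' := by
    intro a ha ξ
    rw [inv_inv]
    refine (ha _).symm.trans ?_
    have h : (Ad a⁻¹).comp (Ad a : V →L[ℝ] V) = ContinuousLinearMap.id ℝ V := by
      rw [← Ad_mul, inv_mul_cancel, Ad_one]
    exact congrArg μ (DFunLike.congr_fun h ξ)

end Group

end Presymplectic

end

/-! Write O_x for the tangent space at x of the G-orbit. Since i(ξ̃)Ω = df_ξ, the kernel of T_xJ is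
the Ω-orthogonal of O_x. A vector u tangent to J⁻¹(μ) therefore lies in ker Ω_μ iff i(u)Ω vanishes
on the orthogonal of O_x. By finite-dimensional duality this means i(u)Ω = i(ξ̃)Ω for some ξ. Then u
− ξ̃ ∈ ker Ω, which lies in O_x by hypothesis, so u ∈ O_x. Hence ker Ω_μ = T J⁻¹(μ) ∩ O
(`mem_ker_pullback_levelIncl_iff`). The hypothesis concerns global fields, so this also needs every
kernel vector to extend to a global section of ker Ω (`exists_smooth_section_ker`).

The action is free, so ξ ↦ ξ̃(x) is injective. Thus ker Ω_μ at x corresponds to {ξ : μ([η, ξ]) = 0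
for all η}, which does not depend on x: the rank is constant. The derivative of g ↦ Ad_g ξ at 1 is
the bracket (`hasD_Ad_apply`). With the Poisson condition, this makes J equivariant on the connected
group G, so G_μ preserves J⁻¹(μ) and is cut out there by J(g x) = μ.

A curve tangent to ker Ω_μ stays in a G-orbit and lifts to a continuous curve of G_μ starting at 1:
slice charts for the free action give the first claim, and properness gives the second. Conversely,
near 1 the group G_μ is a fibre of g ↦ J(g x), a map of constant rank. The constant rank theorem
joins its elements to 1 by smooth curves, and their action on x is tangent to ker Ω_μ. So the leaves
are the orbits of the identity component (`leafProj_eq_iff`), and ker Tπ_μ = ker Ω_μ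
(`D_leafProj_eq_zero_iff`).

The form descends pointwise because ker Tπ_μ = ker Ω_μ. The result is independent of the point of
the leaf because any two such points are exchanged by an element of G_μ, which preserves Ω_μ and the
leaves. Local sections of π_μ give smoothness and closedness. Finally TJ(X)(ξ) = −dH(ξ̃) = 0, so X
is tangent to J⁻¹(μ), and nondegeneracy of the reduced form forces all solutions to project to the
same field. -/

namespace Presymplectic

open Set Filter Topology

/-! ### Derivatives on manifolds and the inverse function theorem -/

section Calculus

variable {E : Type*} [NormedAddCommGroup E] [NormedSpace ℝ E]
  {M : Type*} [TopologicalSpace M] [ChartedSpace E M]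
  {E' : Type*} [NormedAddCommGroup E'] [NormedSpace ℝ E']
  {M' : Type*} [TopologicalSpace M'] [ChartedSpace E' M']
  {E'' : Type*} [NormedAddCommGroup E''] [NormedSpace ℝ E'']
  {M'' : Type*} [TopologicalSpace M''] [ChartedSpace E'' M'']

/-- `f` has derivative `L` at `x`, the tangent spaces being identified with the model spaces. -/
abbrev HasD (f : M → M') (x : M) (L : E →L[ℝ] E') : Prop :=
  HasMFDerivAt 𝓘(ℝ, E) 𝓘(ℝ, E') f x L

variable (E E') in
/-- The derivative of `f`, the tangent spaces being identified with the model spaces. -/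
noncomputable abbrev D (f : M → M') (x : M) : E →L[ℝ] E' := mfderiv 𝓘(ℝ, E) 𝓘(ℝ, E') f x

/-- The intermediate point is tied to `f x` by an equation, so that compositions through points such
as `(1 : G) • x` or `e.symm (e x)` need no transport between tangent spaces. -/
theorem HasD.comp {f : M → M'} {g : M' → M''} {x : M} {y : M'} {L : E →L[ℝ] E'}
    {L' : E' →L[ℝ] E''} (hg : HasD g y L') (hf : HasD f x L) (h : f x = y) :
    HasD (g ∘ f) x (L'.comp L) := by
  subst h
  exact HasMFDerivAt.comp x hg hf

theorem HasD.unique {f : M → M'} {x : M} {L L' : E →L[ℝ] E'} (h : HasD f x L) (h' : HasD f x L') :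
    L = L' := hasMFDerivAt_unique h h'

theorem HasD.eq {f : M → M'} {x : M} {L : E →L[ℝ] E'} (h : HasD f x L) : D E E' f x = L :=
  h.mfderiv

theorem HasD.congr {f g : M → M'} {x : M} {L : E →L[ℝ] E'} (h : HasD f x L) (hg : g =ᶠ[𝓝 x] f) :
    HasD g x L := HasMFDerivAt.congr_of_eventuallyEq h hg

theorem hasD_id (x : M) : HasD (id : M → M) x (ContinuousLinearMap.id ℝ E) := hasMFDerivAt_id x

theorem hasD_const (c : M') (x : M) : HasD (fun _ : M ↦ c) x (0 : E →L[ℝ] E') :=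
  hasMFDerivAt_const c x

theorem hasD_iff_hasFDerivAt {f : E → E'} {x : E} {L : E →L[ℝ] E'} :
    HasD f x L ↔ HasFDerivAt f L x := hasMFDerivAt_iff_hasFDerivAt

theorem hasD_of_contMDiffAt {f : M → M'} {x : M} (h : ContMDiffAt 𝓘(ℝ, E) 𝓘(ℝ, E') ∞ f x) :
    HasD f x (D E E' f x) := (h.mdifferentiableAt (by simp)).hasMFDerivAt

theorem hasD_of_contMDiffOn {f : M → M'} {x : M} {U : Set M}
    (h : ContMDiffOn 𝓘(ℝ, E) 𝓘(ℝ, E') ∞ f U) (hU : IsOpen U) (hx : x ∈ U) :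
    HasD f x (D E E' f x) := hasD_of_contMDiffAt (h.contMDiffAt (hU.mem_nhds hx))

/-- The derivative of a local diffeomorphism. -/
theorem exists_equiv_hasD (e : OpenPartialHomeomorph M M')
    (he : ContMDiffOn 𝓘(ℝ, E) 𝓘(ℝ, E') ∞ e e.source)
    (he' : ContMDiffOn 𝓘(ℝ, E') 𝓘(ℝ, E) ∞ e.symm e.target) {x : M} (hx : x ∈ e.source) :
    ∃ L : E ≃L[ℝ] E', HasD e x (L : E →L[ℝ] E') ∧ HasD e.symm (e x) (L.symm : E' →L[ℝ] E) := by
  have h1 := hasD_of_contMDiffOn he e.open_source hx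
  have h2 := hasD_of_contMDiffOn he' e.open_target (e.map_source hx)
  have h3 := (h2.comp h1 rfl).unique ((hasD_id x).congr (by
    filter_upwards [e.open_source.mem_nhds hx] with y hy
    simp [e.left_inv hy]))
  have h4 := (h1.comp h2 (e.left_inv hx)).unique ((hasD_id (e x)).congr (by
    filter_upwards [e.open_target.mem_nhds (e.map_source hx)] with y hy
    simp [e.right_inv hy]))
  refine ⟨ContinuousLinearEquiv.equivOfInverse _ _ (fun v ↦ ?_) (fun v ↦ ?_), h1, h2⟩
  · exact DFunLike.congr_fun h3 v
  · exact DFunLike.congr_fun h4 v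

theorem chart_contMDiffOn [IsManifold 𝓘(ℝ, E) ∞ M] {e : OpenPartialHomeomorph M E}
    (he : e ∈ IsManifold.maximalAtlas 𝓘(ℝ, E) ∞ M) : ContMDiffOn 𝓘(ℝ, E) 𝓘(ℝ, E) ∞ e e.source :=
  contMDiffOn_of_mem_maximalAtlas he

theorem chart_symm_contMDiffOn [IsManifold 𝓘(ℝ, E) ∞ M] {e : OpenPartialHomeomorph M E}
    (he : e ∈ IsManifold.maximalAtlas 𝓘(ℝ, E) ∞ M) :
    ContMDiffOn 𝓘(ℝ, E) 𝓘(ℝ, E) ∞ e.symm e.target :=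
  contMDiffOn_symm_of_mem_maximalAtlas he

theorem chartAt_contMDiffOn [IsManifold 𝓘(ℝ, E) ∞ M] (c : M) :
    ContMDiffOn 𝓘(ℝ, E) 𝓘(ℝ, E) ∞ (chartAt E c) (chartAt E c).source := contMDiffOn_chart

theorem chartAt_symm_contMDiffOn [IsManifold 𝓘(ℝ, E) ∞ M] (c : M) :
    ContMDiffOn 𝓘(ℝ, E) 𝓘(ℝ, E) ∞ (chartAt E c).symm (chartAt E c).target := contMDiffOn_chart_symm

/-- The preferred chart at a point has the identity as derivative there. -/
theorem hasD_chartAt_self [IsManifold 𝓘(ℝ, E) ∞ M] (c : M) :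
    HasD (chartAt E c) c (ContinuousLinearMap.id ℝ E) := by
  have h1 := hasD_of_contMDiffOn (chartAt_contMDiffOn (E := E) c) (chartAt E c).open_source
    (mem_chart_source E c)
  have h2 : D E E (chartAt E c) c = ContinuousLinearMap.id ℝ E := by
    have := mfderiv_extChartAt_self (I := 𝓘(ℝ, E)) (x := c)
    simp only [extChartAt, OpenPartialHomeomorph.extend, modelWithCornersSelf_partialEquiv] at this
    exact this
  rw [h2] at h1
  exact h1

theorem hasD_chartAt_symm_self [IsManifold 𝓘(ℝ, E) ∞ M] (c : M) :
    HasD (chartAt E c).symm (chartAt E c c) (ContinuousLinearMap.id ℝ E) := by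
  obtain ⟨L, h1, h2⟩ := exists_equiv_hasD (chartAt E c) (chartAt_contMDiffOn c)
    (chartAt_symm_contMDiffOn c) (mem_chart_source E c)
  have h3 : L = ContinuousLinearEquiv.refl ℝ E := by
    ext v
    exact DFunLike.congr_fun (h1.unique (hasD_chartAt_self c)) v
  subst h3
  exact h2

/-- The inverse function theorem on open sets. -/
theorem exists_localDiffeo_of_contDiffOn [CompleteSpace E] {f : E → E'} {U : Set E}
    (hU : IsOpen U) (hf : ContDiffOn ℝ ∞ f U) {b : E} (hb : b ∈ U) {L : E ≃L[ℝ] E'}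
    (hL : HasFDerivAt f (L : E →L[ℝ] E') b) :
    ∃ e : OpenPartialHomeomorph E E', b ∈ e.source ∧ e.source ⊆ U ∧ (∀ v ∈ e.source, e v = f v) ∧
      ContDiffOn ℝ ∞ e e.source ∧ ContDiffOn ℝ ∞ e.symm e.target := by
  have hfb : ContDiffAt ℝ ∞ f b := hf.contDiffAt (hU.mem_nhds hb)
  have hne : (∞ : WithTop ℕ∞) ≠ 0 := by simp
  set e0 := hfb.toOpenPartialHomeomorph f hL hne with he0
  have hcoe : ∀ v, e0 v = f v := fun v ↦ rfl
  have hcont : ContinuousOn (fderiv ℝ f) U := hf.continuousOn_fderiv_of_isOpen hU (by simp)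
  -- Invertibility of the derivative is an open condition. Restricting to it makes the inverse
  -- smooth on the whole target and not only at `f b`.
  set s : Set E := U ∩ fderiv ℝ f ⁻¹' range ((↑) : (E ≃L[ℝ] E') → E →L[ℝ] E') with hs
  have hso : IsOpen s := hcont.isOpen_inter_preimage hU ContinuousLinearEquiv.isOpen
  refine ⟨e0.restrOpen s hso, ?_, ?_, fun v _ ↦ rfl, ?_, ?_⟩
  · exact ⟨hfb.mem_toOpenPartialHomeomorph_source hL hne, hb, L, hL.fderiv.symm⟩
  · exact fun v hv ↦ hv.2.1
  · exact hf.mono fun v hv ↦ hv.2.1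
  · intro y hy
    set e1 := e0.restrOpen s hso
    have hx : e1.symm y ∈ e1.source := e1.map_target hy
    obtain ⟨L', hL'⟩ := hx.2.2
    have hd : ContDiffAt ℝ ∞ f (e1.symm y) := hf.contDiffAt (hU.mem_nhds hx.2.1)
    refine (e1.contDiffAt_symm (f₀' := L') hy ?_ hd).contDiffWithinAt
    rw [hL']
    exact (hd.differentiableAt (by simp)).hasFDerivAt

/-- The inverse function theorem for maps from a normed space to a manifold. -/
theorem exists_localDiffeo [CompleteSpace E'] [IsManifold 𝓘(ℝ, E) ∞ M] {f : E' → M} {U : Set E'}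
    (hU : IsOpen U) (hf : ContMDiffOn 𝓘(ℝ, E') 𝓘(ℝ, E) ∞ f U) {b : E'} (hb : b ∈ U)
    {L : E' ≃L[ℝ] E} (hL : HasD f b (L : E' →L[ℝ] E)) :
    ∃ e : OpenPartialHomeomorph E' M, b ∈ e.source ∧ e.source ⊆ U ∧ (∀ v ∈ e.source, e v = f v) ∧
      ContMDiffOn 𝓘(ℝ, E') 𝓘(ℝ, E) ∞ e e.source ∧
      ContMDiffOn 𝓘(ℝ, E) 𝓘(ℝ, E') ∞ e.symm e.target := by
  set φ := chartAt E (f b)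
  have hV : IsOpen (U ∩ f ⁻¹' φ.source) := hf.continuousOn.isOpen_inter_preimage hU φ.open_source
  have h1 : ContDiffOn ℝ ∞ (φ ∘ f) (U ∩ f ⁻¹' φ.source) := by
    rw [← contMDiffOn_iff_contDiffOn]
    exact (chartAt_contMDiffOn (f b)).comp (hf.mono inter_subset_left) inter_subset_right
  obtain ⟨e, he1, he2, he3, he4, he5⟩ := exists_localDiffeo_of_contDiffOn (L := L) hV h1
    ⟨hb, mem_chart_source E (f b)⟩ (by
      rw [← hasD_iff_hasFDerivAt]
      simpa using (hasD_chartAt_self (f b)).comp hL rfl)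
  have hmap : ∀ v ∈ e.source, e v ∈ φ.target := fun v hv ↦ by
    rw [he3 v hv]
    exact φ.map_source (he2 hv).2
  have hsrc : (e.trans φ.symm).source = e.source := by
    ext v
    simp only [OpenPartialHomeomorph.trans_source, OpenPartialHomeomorph.symm_source, mem_inter_iff,
      mem_preimage, and_iff_left_iff_imp]
    exact hmap v
  refine ⟨e.trans φ.symm, hsrc ▸ he1, ?_, ?_, ?_, ?_⟩
  · rw [hsrc]
    exact fun v hv ↦ (he2 hv).1
  · rw [hsrc]
    intro v hv
    simp only [OpenPartialHomeomorph.coe_trans, Function.comp_apply]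
    rw [he3 v hv]
    exact φ.left_inv (he2 hv).2
  · rw [hsrc]
    exact (chartAt_symm_contMDiffOn (f b)).comp (contMDiffOn_iff_contDiffOn.2 he4) hmap
  · refine (contMDiffOn_iff_contDiffOn.2 he5).comp ((chartAt_contMDiffOn (f b)).mono ?_) ?_
    · intro y hy
      exact hy.1
    · intro y hy
      exact hy.2

end Calculus


/-! ### Submersions and immersions in adapted charts -/

section Submersion

variable {E : Type*} [NormedAddCommGroup E] [NormedSpace ℝ E]
  {M : Type*} [TopologicalSpace M] [ChartedSpace E M] [IsManifold 𝓘(ℝ, E) ∞ M]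
  {E' : Type*} [NormedAddCommGroup E'] [NormedSpace ℝ E']
  {M' : Type*} [TopologicalSpace M'] [ChartedSpace E' M'] [IsManifold 𝓘(ℝ, E') ∞ M']

/-- A submersion has smooth local sections through every point. -/
theorem exists_local_section {f : M → M'} {x : M}
    (hf : Manifold.IsSubmersionAt 𝓘(ℝ, E) 𝓘(ℝ, E') ∞ f x) :
    ∃ (U : Set M') (σ : M' → M), IsOpen U ∧ f x ∈ U ∧ ContMDiffOn 𝓘(ℝ, E') 𝓘(ℝ, E) ∞ σ U ∧
      σ (f x) = x ∧ (∀ z ∈ U, f (σ z) = z) := by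
  set d := hf.domChart
  set c := hf.codChart
  set e := hf.equiv
  have hw : ∀ y ∈ d.target, c (f (d.symm y)) = (e y).1 := fun y hy ↦ by
    have h : y ∈ (hf.domChart.extend 𝓘(ℝ, E)).target := by simpa using hy
    exact hf.writtenInCharts h
  have hxd : x ∈ d.source := hf.mem_domChart_source
  have hmaps : ∀ y ∈ d.source, f y ∈ c.source := fun y hy ↦ hf.source_subset_preimage_source hy
  have hcs := chart_contMDiffOn hf.codChart_mem_maximalAtlas
  -- Vary the base coordinate and freeze the fibre coordinate at that of `x`.
  set τ : E' → E := fun q ↦ e.symm (q, (e (d x)).2)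
  have hτ : ContDiff ℝ ∞ τ := e.symm.contDiff.comp (contDiff_id.prodMk contDiff_const)
  refine ⟨c.source ∩ c ⁻¹' (τ ⁻¹' d.target), fun z ↦ d.symm (τ (c z)), ?_, ?_, ?_, ?_, ?_⟩
  · exact c.continuousOn.isOpen_inter_preimage c.open_source
      (d.open_target.preimage hτ.continuous)
  · refine ⟨hf.mem_codChart_source, ?_⟩
    have h := hw (d x) (d.map_source hxd)
    rw [d.left_inv hxd] at h
    simp only [mem_preimage, τ, h, Prod.mk.eta, ContinuousLinearEquiv.symm_apply_apply]
    exact d.map_source hxd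
  · exact (chart_symm_contMDiffOn hf.domChart_mem_maximalAtlas).comp
      ((hτ.contMDiff.contMDiffOn (s := univ)).comp (hcs.mono inter_subset_left)
        (fun _ _ ↦ mem_univ _)) (fun z hz ↦ hz.2)
  · have h := hw (d x) (d.map_source hxd)
    rw [d.left_inv hxd] at h
    simp only [τ, h, Prod.mk.eta, ContinuousLinearEquiv.symm_apply_apply]
    exact d.left_inv hxd
  · rintro z ⟨hz1, hz2⟩
    have h := hw (τ (c z)) hz2
    simp only [τ, ContinuousLinearEquiv.apply_symm_apply] at h
    exact c.injOn (hmaps _ (d.map_target hz2)) hz1 h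

/-- A tangent vector killed by a submersion is the velocity of a curve in the fibre. -/
theorem exists_curve_in_fibre {f : M → M'} {x : M}
    (hf : Manifold.IsSubmersionAt 𝓘(ℝ, E) 𝓘(ℝ, E') ∞ f x) {v : E} (hv : D E E' f x v = 0) :
    ∃ γ : ℝ → M, γ 0 = x ∧ HasD γ 0 (ContinuousLinearMap.toSpanSingleton ℝ v) ∧
      ∀ᶠ t in 𝓝 0, f (γ t) = f x := by
  set d := hf.domChart
  set c := hf.codChart
  set e := hf.equiv
  have hw : ∀ y ∈ d.target, c (f (d.symm y)) = (e y).1 := fun y hy ↦ by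
    have h : y ∈ (hf.domChart.extend 𝓘(ℝ, E)).target := by simpa using hy
    exact hf.writtenInCharts h
  have hxd : x ∈ d.source := hf.mem_domChart_source
  have hmaps : ∀ y ∈ d.source, f y ∈ c.source := fun y hy ↦ hf.source_subset_preimage_source hy
  have hcs := chart_contMDiffOn hf.codChart_mem_maximalAtlas
  obtain ⟨L, h1, h2⟩ := exists_equiv_hasD d (chart_contMDiffOn hf.domChart_mem_maximalAtlas)
    (chart_symm_contMDiffOn hf.domChart_mem_maximalAtlas) hxd
  have hdf := hasD_of_contMDiffAt hf.contMDiffAt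
  have hdc := hasD_of_contMDiffOn hcs c.open_source hf.mem_codChart_source
  have h3 : (e (L v)).1 = 0 := by
    have hA := hdc.comp (hdf.comp h2 (d.left_inv hxd)) (by simp [d.left_inv hxd])
    have hB : HasD (fun y ↦ (e y).1) (d x)
        ((ContinuousLinearMap.fst ℝ E' hf.complement).comp (e : E →L[ℝ] E' × hf.complement)) :=
      hasD_iff_hasFDerivAt.2 ((ContinuousLinearMap.fst ℝ E' hf.complement).comp
        (e : E →L[ℝ] E' × hf.complement)).hasFDerivAt
    have hC := hB.unique (hA.congr (by
      filter_upwards [d.open_target.mem_nhds (d.map_source hxd)] with y hy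
      exact (hw y hy).symm))
    have hD := DFunLike.congr_fun hC (L v)
    simp only [ContinuousLinearMap.comp_apply, ContinuousLinearEquiv.coe_coe,
      ContinuousLinearEquiv.symm_apply_apply] at hD
    have hv' : (D E E' f x) v = 0 := hv
    rw [hv', map_zero] at hD
    exact hD
  -- By `h3` the base coordinate does not move along this line, so it runs inside a fibre.
  set γ0 : ℝ → E := fun t ↦ d x + t • L v
  have hγ0 : HasFDerivAt γ0 (ContinuousLinearMap.toSpanSingleton ℝ (L v)) 0 := by
    have := ((hasDerivAt_id (0 : ℝ)).smul_const (L v)).const_add (d x)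
    rw [one_smul] at this
    exact this.hasFDerivAt
  have hγ00 : γ0 0 = d x := by simp [γ0]
  refine ⟨d.symm ∘ γ0, ?_, ?_, ?_⟩
  · simp [hγ00, d.left_inv hxd]
  · have := h2.comp (hasD_iff_hasFDerivAt.2 hγ0) hγ00
    convert this using 1
    ext
    simp
  · have hcont : ContinuousAt γ0 0 := hγ0.continuousAt
    have hmem : ∀ᶠ t in 𝓝 0, γ0 t ∈ d.target := hcont.eventually (by
      rw [hγ00]
      exact d.open_target.mem_nhds (d.map_source hxd))
    filter_upwards [hmem] with t ht
    refine c.injOn (hmaps _ (d.map_target ht)) hf.mem_codChart_source ?_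
    have ha := hw (γ0 t) ht
    have hb := hw (d x) (d.map_source hxd)
    rw [d.left_inv hxd] at hb
    refine ha.trans (Eq.trans ?_ hb.symm)
    simp [γ0, h3]

/-- An immersion has smooth local left inverses. -/
theorem exists_local_leftInverse {f : M → M'} {x : M}
    (hf : Manifold.IsImmersionAt 𝓘(ℝ, E) 𝓘(ℝ, E') ∞ f x) :
    ∃ (U : Set M') (r : M' → M), IsOpen U ∧ f x ∈ U ∧ ContMDiffOn 𝓘(ℝ, E') 𝓘(ℝ, E) ∞ r U ∧
      ∀ᶠ y in 𝓝 x, r (f y) = y := by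
  set d := hf.domChart
  set c := hf.codChart
  set e := hf.equiv
  have hw : ∀ y ∈ d.target, c (f (d.symm y)) = e (y, 0) := fun y hy ↦ by
    have h : y ∈ (hf.domChart.extend 𝓘(ℝ, E)).target := by simpa using hy
    exact hf.writtenInCharts h
  have hxd : x ∈ d.source := hf.mem_domChart_source
  have hmaps : ∀ y ∈ d.source, f y ∈ c.source := fun y hy ↦ hf.source_subset_preimage_source hy
  have hcs := chart_contMDiffOn hf.codChart_mem_maximalAtlas
  -- In the charts the immersion is `y ↦ e (y, 0)`; a left inverse forgets the second coordinate.
  set τ : E' → E := fun q ↦ (e.symm q).1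
  have hτ : ContDiff ℝ ∞ τ := contDiff_fst.comp e.symm.contDiff
  have hinv : ∀ y ∈ d.source, τ (c (f y)) = d y := fun y hy ↦ by
    have h := hw (d y) (d.map_source hy)
    rw [d.left_inv hy] at h
    simp [τ, h]
  refine ⟨c.source ∩ c ⁻¹' (τ ⁻¹' d.target), fun z ↦ d.symm (τ (c z)), ?_, ?_, ?_, ?_⟩
  · exact c.continuousOn.isOpen_inter_preimage c.open_source
      (d.open_target.preimage hτ.continuous)
  · refine ⟨hf.mem_codChart_source, ?_⟩
    simp only [mem_preimage]
    rw [hinv x hxd]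
    exact d.map_source hxd
  · exact (chart_symm_contMDiffOn hf.domChart_mem_maximalAtlas).comp
      ((hτ.contMDiff.contMDiffOn (s := univ)).comp (hcs.mono inter_subset_left)
        (fun _ _ ↦ mem_univ _)) (fun z hz ↦ hz.2)
  · filter_upwards [d.open_source.mem_nhds hxd] with y hy
    rw [hinv y hy, d.left_inv hy]

theorem injective_of_isImmersionAt {f : M → M'} {x : M}
    (hf : Manifold.IsImmersionAt 𝓘(ℝ, E) 𝓘(ℝ, E') ∞ f x) : Function.Injective (D E E' f x) := by
  obtain ⟨U, r, hU, hxU, hr, hrf⟩ := exists_local_leftInverse hf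
  have h1 := hasD_of_contMDiffOn hr hU hxU
  have h2 := hasD_of_contMDiffAt hf.contMDiffAt
  have hrx : r (f x) = x := hrf.self_of_nhds
  have h3 := (h1.comp h2 rfl).unique ((hasD_id x).congr hrf)
  exact Function.LeftInverse.injective (g := D E' E r (f x)) (fun v ↦ DFunLike.congr_fun h3 v)

/-- Smoothness descends along surjective submersions. -/
theorem contMDiff_of_comp_submersion {f : M → M'} (hf : Manifold.IsSubmersion 𝓘(ℝ, E) 𝓘(ℝ, E') ∞ f)
    (hs : Function.Surjective f) {h : M' → ℝ} (hh : ContMDiff 𝓘(ℝ, E) 𝓘(ℝ, ℝ) ∞ (h ∘ f)) :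
    ContMDiff 𝓘(ℝ, E') 𝓘(ℝ, ℝ) ∞ h := by
  intro q
  obtain ⟨x, rfl⟩ := hs q
  obtain ⟨U, σ, hU, hxU, hσ, -, hfσ⟩ := exists_local_section (hf.isSubmersionAt x)
  have h1 : ContMDiffAt 𝓘(ℝ, E') 𝓘(ℝ, ℝ) ∞ ((h ∘ f) ∘ σ) (f x) :=
    hh.contMDiffAt.comp _ (hσ.contMDiffAt (hU.mem_nhds hxU))
  refine h1.congr_of_eventuallyEq ?_
  filter_upwards [hU.mem_nhds hxU] with z hz
  simp [hfσ z hz]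

end Submersion


/-! ### Two-forms: smoothness, closedness and pull-back -/

section Forms

theorem two_le_infty : minSmoothness ℝ 2 ≤ ∞ := by
  rw [minSmoothness_of_isRCLikeNormedField]
  exact WithTop.coe_le_coe.2 le_top

variable {E : Type*} [NormedAddCommGroup E] [NormedSpace ℝ E]
  {E' : Type*} [NormedAddCommGroup E'] [NormedSpace ℝ E']

/-- The bilinear form of an alternating form of degree two. -/
def bil (α : E [⋀^Fin 2]→L[ℝ] ℝ) : E →ₗ[ℝ] E →ₗ[ℝ] ℝ :=
  LinearMap.mk₂ ℝ (fun u w ↦ α ![u, w])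
    (fun a b w ↦ α.toMultilinearMap.cons_add ![w] a b)
    (fun c a w ↦ α.toMultilinearMap.cons_smul ![w] c a)
    (fun w a b ↦ by
      have h : ∀ z, Function.update ![w, 0] 1 z = ![w, z] := fun z ↦ by
        ext i; fin_cases i <;> simp
      have := α.toMultilinearMap.map_update_add ![w, 0] 1 a b
      rwa [h, h, h] at this)
    (fun c w a ↦ by
      have h : ∀ z, Function.update ![w, 0] 1 z = ![w, z] := fun z ↦ by
        ext i; fin_cases i <;> simp
      have := α.toMultilinearMap.map_update_smul ![w, 0] 1 c a
      rwa [h, h] at this)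

theorem bil_apply (α : E [⋀^Fin 2]→L[ℝ] ℝ) (u w : E) : bil α u w = α ![u, w] := rfl

theorem bil_self (α : E [⋀^Fin 2]→L[ℝ] ℝ) (u : E) : bil α u u = 0 :=
  α.map_eq_zero_of_eq ![u, u] (i := 0) (j := 1) (by simp) (by simp)

theorem bil_swap (α : E [⋀^Fin 2]→L[ℝ] ℝ) (u w : E) : bil α u w = -bil α w u := by
  have h := bil_self α (u + w)
  simp only [map_add, LinearMap.add_apply, bil_self] at h
  linarith

theorem compContinuousLinearMap_pair (α : E' [⋀^Fin 2]→L[ℝ] ℝ) (L : E →L[ℝ] E') (u w : E) :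
    α.compContinuousLinearMap L ![u, w] = α ![L u, L w] := by
  rw [ContinuousAlternatingMap.compContinuousLinearMap_apply]
  congr 1
  ext i
  fin_cases i <;> rfl

theorem form_ext {α α' : E [⋀^Fin 2]→L[ℝ] ℝ} (h : ∀ u w, α ![u, w] = α' ![u, w]) : α = α' := by
  ext v
  have : v = ![v 0, v 1] := by ext i; fin_cases i <;> rfl
  rw [this]
  exact h _ _

/-- Evaluation of a form on two vectors, as a continuous linear map. -/
noncomputable def evalPair (u w : E) : (E [⋀^Fin 2]→L[ℝ] ℝ) →L[ℝ] ℝ :=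
  (ContinuousMultilinearMap.apply ℝ (fun _ : Fin 2 ↦ E) ℝ ![u, w]).comp
    (ContinuousAlternatingMap.toContinuousMultilinearMapCLM ℝ)

/-- A family of forms is smooth when its values on constant vectors are. -/
theorem contDiffAt_form_iff [FiniteDimensional ℝ E] {α : E' → E [⋀^Fin 2]→L[ℝ] ℝ} {y : E'} :
    ContDiffAt ℝ ∞ α y ↔ ∀ u w, ContDiffAt ℝ ∞ (fun z ↦ α z ![u, w]) y := by
  refine ⟨fun h u w ↦ (evalPair u w).contDiff.contDiffAt.comp y h, fun h ↦ ?_⟩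
  set b := Module.finBasis ℝ E
  set ev : (E [⋀^Fin 2]→L[ℝ] ℝ) →ₗ[ℝ]
      (Fin (Module.finrank ℝ E) × Fin (Module.finrank ℝ E) → ℝ) :=
    LinearMap.pi fun p ↦ (evalPair (b p.1) (b p.2)).toLinearMap
  have hinj : LinearMap.ker ev = ⊥ := by
    rw [LinearMap.ker_eq_bot]
    intro α₁ α₂ h12
    have h3 : bil α₁ = bil α₂ := b.ext fun i ↦ b.ext fun j ↦ congrFun h12 (i, j)
    exact form_ext fun u w ↦ by rw [← bil_apply, ← bil_apply, h3]
  -- A form is recovered linearly from its values on pairs of basis vectors. The recovery map `g` is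
  -- continuous because its source is finite-dimensional.
  obtain ⟨g, hg⟩ := ev.exists_leftInverse_of_injective hinj
  have h4 : α = fun z ↦ g.toContinuousLinearMap (ev (α z)) := by
    ext1 z
    exact (DFunLike.congr_fun hg (α z)).symm
  rw [h4]
  refine g.toContinuousLinearMap.contDiff.contDiffAt.comp y ?_
  exact contDiffAt_pi.2 fun p ↦ h _ _

/-- The pull-back of a smooth family of forms is smooth. -/
theorem contDiffAt_form_pullback [FiniteDimensional ℝ E] [FiniteDimensional ℝ E']
    {α : E' → E' [⋀^Fin 2]→L[ℝ] ℝ} {f : E → E'} {y : E} (hα : ContDiffAt ℝ ∞ α (f y))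
    (hf : ContDiffAt ℝ ∞ f y) :
    ContDiffAt ℝ ∞ (fun z ↦ (α (f z)).compContinuousLinearMap (fderiv ℝ f z)) y := by
  rw [contDiffAt_form_iff]
  intro u w
  set b := Module.finBasis ℝ E'
  have hd : ∀ v, ContDiffAt ℝ ∞ (fun z ↦ fderiv ℝ f z v) y := fun v ↦
    (hf.fderiv_right (m := ∞) (by simp)).clm_apply contDiffAt_const
  have hc : ∀ v i, ContDiffAt ℝ ∞ (fun z ↦ b.repr (fderiv ℝ f z v) i) y := fun v i ↦
    ((b.coord i).toContinuousLinearMap.contDiff.contDiffAt).comp y (hd v)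
  have hexp : ∀ z, (α (f z)).compContinuousLinearMap (fderiv ℝ f z) ![u, w] =
      ∑ i, ∑ j, b.repr (fderiv ℝ f z u) i * (b.repr (fderiv ℝ f z w) j * α (f z) ![b i, b j]) := by
    intro z
    rw [compContinuousLinearMap_pair, ← bil_apply]
    conv_lhs => rw [← b.sum_repr (fderiv ℝ f z u), ← b.sum_repr (fderiv ℝ f z w)]
    simp only [map_sum, map_smul, LinearMap.sum_apply, LinearMap.smul_apply, smul_eq_mul, bil_apply,
      Finset.mul_sum]
    rw [Finset.sum_comm]
    exact Finset.sum_congr rfl fun i _ ↦ Finset.sum_congr rfl fun j _ ↦ by ring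
  simp only [hexp]
  refine ContDiffAt.sum fun i _ ↦ ContDiffAt.sum fun j _ ↦ ?_
  exact (hc u i).mul ((hc w j).mul
    (((contDiffAt_form_iff.1 hα) (b i) (b j)).comp y hf))

variable {M : Type*} [TopologicalSpace M] [ChartedSpace E M]
  {M' : Type*} [TopologicalSpace M'] [ChartedSpace E' M']

theorem pullback_apply (f : M → M') (Ω : TwoForm E' M') (x : M) (u w : E) :
    (pullback f Ω x : E [⋀^Fin 2]→L[ℝ] ℝ) ![u, w] =
      (Ω (f x) : E' [⋀^Fin 2]→L[ℝ] ℝ) ![D E E' f x u, D E E' f x w] :=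
  compContinuousLinearMap_pair (E := E) (E' := E') (Ω (f x)) (D E E' f x) u w

variable [IsManifold 𝓘(ℝ, E) ∞ M] [IsManifold 𝓘(ℝ, E') ∞ M']

/-- Chain rule: in charts a pull-back between manifolds is a pull-back between open sets of normed
spaces, where `extDeriv_pullback` is available. The equality holds on a neighbourhood of `y`, as is
needed to differentiate it. -/
theorem inChart_eq_of_pullback {f : M → M'} {Ω : TwoForm E' M'} {Θ : TwoForm E M} {U : Set M}
    (hU : IsOpen U) (hf : ContMDiffOn 𝓘(ℝ, E) 𝓘(ℝ, E') ∞ f U)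
    (hΘ : ∀ x ∈ U, Θ x = pullback f Ω x) {c : M} {c' : M'} {y : E} (hy : y ∈ (chartAt E c).target)
    (hyU : (chartAt E c).symm y ∈ U) (hyc : f ((chartAt E c).symm y) ∈ (chartAt E' c').source) :
    ContDiffAt ℝ ∞ (chartAt E' c' ∘ f ∘ (chartAt E c).symm) y ∧
    inChart Θ c =ᶠ[𝓝 y] fun z ↦
      (inChart Ω c' ((chartAt E' c' ∘ f ∘ (chartAt E c).symm) z)).compContinuousLinearMap
        (fderiv ℝ (chartAt E' c' ∘ f ∘ (chartAt E c).symm) z) := by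
  set φ := chartAt E c
  set ψ := chartAt E' c'
  set V : Set E := φ.target ∩ φ.symm ⁻¹' (U ∩ f ⁻¹' ψ.source)
  have hV : IsOpen V := φ.symm.continuousOn.isOpen_inter_preimage φ.open_target
    (hf.continuousOn.isOpen_inter_preimage hU ψ.open_source)
  have hg : ContMDiffOn 𝓘(ℝ, E) 𝓘(ℝ, E') ∞ (f ∘ φ.symm) V :=
    hf.comp ((chartAt_symm_contMDiffOn c).mono inter_subset_left) fun z hz ↦ hz.2.1
  have hh : ContDiffOn ℝ ∞ (ψ ∘ f ∘ φ.symm) V := by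
    rw [← contMDiffOn_iff_contDiffOn]
    exact (chartAt_contMDiffOn c').comp hg fun z hz ↦ hz.2.2
  have hyV : y ∈ V := ⟨hy, hyU, hyc⟩
  refine ⟨hh.contDiffAt (hV.mem_nhds hyV), ?_⟩
  filter_upwards [hV.mem_nhds hyV] with z hz
  set h := ψ ∘ f ∘ φ.symm
  have hhz : h z ∈ ψ.target := ψ.map_source hz.2.2
  have hinv : ψ.symm (h z) = f (φ.symm z) := ψ.left_inv hz.2.2
  have h1 : HasD φ.symm z (D E E φ.symm z) :=
    hasD_of_contMDiffOn (chartAt_symm_contMDiffOn c) φ.open_target hz.1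
  have h2 := hasD_of_contMDiffOn hf hU hz.2.1
  have h3 : HasD ψ.symm (h z) (D E' E' ψ.symm (h z)) :=
    hasD_of_contMDiffOn (chartAt_symm_contMDiffOn c') ψ.open_target hhz
  have h4 : HasD h z (fderiv ℝ h z) := hasD_iff_hasFDerivAt.2
    ((hh.contDiffAt (hV.mem_nhds hz)).differentiableAt (by simp)).hasFDerivAt
  have h5 := (h2.comp h1 rfl).unique ((h3.comp h4 rfl).congr (by
    filter_upwards [hV.mem_nhds hz] with w hw
    exact (ψ.left_inv hw.2.2).symm))
  refine form_ext fun u w ↦ ?_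
  -- The two base points are equal only through `hinv`. Generalizing points and derivatives together
  -- avoids rewriting inside the dependent type of `Ω`.
  have key : ∀ (p q : M') (L₁ L₂ : E →L[ℝ] E'), p = q → L₁ = L₂ →
      (Ω p : E' [⋀^Fin 2]→L[ℝ] ℝ) ![L₁ u, L₁ w] = (Ω q : E' [⋀^Fin 2]→L[ℝ] ℝ) ![L₂ u, L₂ w] := by
    rintro p _ L₁ _ rfl rfl
    rfl
  have lhs : inChart Θ c z ![u, w] = (Ω (f (φ.symm z)) : E' [⋀^Fin 2]→L[ℝ] ℝ)
      ![((D E E' f (φ.symm z)).comp (D E E φ.symm z)) u,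
        ((D E E' f (φ.symm z)).comp (D E E φ.symm z)) w] := by
    refine (compContinuousLinearMap_pair (E := E) (E' := E) (Θ (φ.symm z)) (D E E φ.symm z) u w).trans ?_
    rw [hΘ _ hz.2.1]
    exact pullback_apply f Ω _ _ _
  have rhs : (inChart Ω c' (h z)).compContinuousLinearMap (fderiv ℝ h z) ![u, w] =
      (Ω (ψ.symm (h z)) : E' [⋀^Fin 2]→L[ℝ] ℝ)
      ![((D E' E' ψ.symm (h z)).comp (fderiv ℝ h z)) u,
        ((D E' E' ψ.symm (h z)).comp (fderiv ℝ h z)) w] :=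
    (compContinuousLinearMap_pair (inChart Ω c' (h z)) _ u w).trans
      (compContinuousLinearMap_pair (E := E') (E' := E') (Ω (ψ.symm (h z))) (D E' E' ψ.symm (h z))
        _ _)
  rw [lhs, rhs]
  exact key _ _ _ _ hinv.symm h5

/-- A form which is locally a pull-back of smooth closed forms is smooth and closed. -/
theorem smooth_closed_of_locally_pullback [FiniteDimensional ℝ E] [FiniteDimensional ℝ E']
    {Ω : TwoForm E' M'} (hs : IsSmoothForm Ω) (hc : IsClosedForm Ω) {Θ : TwoForm E M}
    (hΘ : ∀ x : M, ∃ (U : Set M) (f : M → M'), IsOpen U ∧ x ∈ U ∧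
      ContMDiffOn 𝓘(ℝ, E) 𝓘(ℝ, E') ∞ f U ∧ ∀ z ∈ U, Θ z = pullback f Ω z) :
    IsSmoothForm Θ ∧ IsClosedForm Θ := by
  have key : ∀ (c : M) (y : E), y ∈ (chartAt E c).target →
      ContDiffAt ℝ ∞ (inChart Θ c) y ∧ extDeriv (inChart Θ c) y = 0 := by
    intro c y hy
    obtain ⟨U, f, hU, hyU, hf, hfΘ⟩ := hΘ ((chartAt E c).symm y)
    set c' := f ((chartAt E c).symm y)
    obtain ⟨h1, h2⟩ := inChart_eq_of_pullback hU hf hfΘ (c' := c') hy hyU (mem_chart_source E' c')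
    have hmem : (chartAt E' c' ∘ f ∘ (chartAt E c).symm) y ∈ (chartAt E' c').target :=
      (chartAt E' c').map_source (mem_chart_source E' c')
    have hα := (hs c').contDiffAt ((chartAt E' c').open_target.mem_nhds hmem)
    refine ⟨(contDiffAt_form_pullback hα h1).congr_of_eventuallyEq h2, ?_⟩
    rw [h2.extDeriv_eq, extDeriv_pullback (r := ∞) (hα.differentiableAt (by simp)) h1 two_le_infty,
      hc c' _ hmem]
    ext v
    rfl
  exact ⟨fun c y hy ↦ (key c y hy).1.contDiffWithinAt, fun c y hy ↦ (key c y hy).2⟩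

end Forms


/-! ### Smooth sections of the kernel of a form of constant rank -/

section KernelSections

variable {E : Type*} [NormedAddCommGroup E] [NormedSpace ℝ E]

/-- A smooth family of alternating forms of constant rank has smooth local sections of its kernel
through every kernel vector. -/
theorem exists_contDiffOn_ker [FiniteDimensional ℝ E] {α : E → E [⋀^Fin 2]→L[ℝ] ℝ} {U : Set E} (hU : IsOpen U)
    (hα : ContDiffOn ℝ ∞ α U) {y₀ : E} (hy₀ : y₀ ∈ U)
    (hr : ∀ y ∈ U, Module.finrank ℝ (LinearMap.ker (bil (α y))) =
      Module.finrank ℝ (LinearMap.ker (bil (α y₀)))) {v : E} (hv : bil (α y₀) v = 0) :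
    ∃ (W : Set E) (z : E → E), IsOpen W ∧ y₀ ∈ W ∧ W ⊆ U ∧ ContDiffOn ℝ ∞ z W ∧
      (∀ y ∈ W, bil (α y) (z y) = 0) ∧ z y₀ = v := by
  have : CompleteSpace E := FiniteDimensional.complete ℝ E
  set K := LinearMap.ker (bil (α y₀)) with hK
  obtain ⟨P, hP⟩ := K.subtype.exists_leftInverse_of_injective K.ker_subtype
  have hPK : ∀ k : K, P k = k := fun k ↦ DFunLike.congr_fun hP k
  set b := Module.finBasis ℝ K
  set e := Module.finBasis ℝ E
  -- a positive form on `K`, extended through the projection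
  set q : K →ₗ[ℝ] E →ₗ[ℝ] ℝ := ∑ i, (b.coord i).smulRight ((b.coord i).comp P) with hq
  have hqa : ∀ k w, q k w = ∑ i, b.coord i k * b.coord i (P w) := fun k w ↦ by
    simp [hq, LinearMap.sum_apply]
  have hqpos : ∀ u, q (P u) u = 0 → P u = 0 := fun u hu ↦ by
    rw [hqa, Finset.sum_eq_zero_iff_of_nonneg (fun i _ ↦ mul_self_nonneg _)] at hu
    exact b.ext_elem fun i ↦ by simpa using hu i (Finset.mem_univ i)
  set ι : (E →ₗ[ℝ] ℝ) →ₗ[ℝ] E := ∑ j, (LinearMap.applyₗ (e j)).smulRight (e j) with hι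
  have hιa : ∀ l : E →ₗ[ℝ] ℝ, ι l = ∑ j, l (e j) • e j := fun l ↦ by
    simp [hι, LinearMap.sum_apply]
  have hιinj : ∀ l, ι l = 0 → l = 0 := fun l hl ↦ by
    rw [hιa] at hl
    exact e.ext fun j ↦ (Fintype.linearIndependent_iff.1 e.linearIndependent _ hl j)
  -- Adding to the form at `y₀` a form positive on its kernel makes it injective: pairing `u` with
  -- itself kills the alternating part and leaves a sum of squares. The map `ι` only identifies the
  -- dual of `E` with `E`.
  set T : E → E →L[ℝ] E := fun y ↦
    LinearMap.toContinuousLinearMap (ι.comp (bil (α y) + q.comp P)) with hT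
  have hTa : ∀ y u, T y u = ι (bil (α y) u + q (P u)) := fun y u ↦ rfl
  have hTs : ContDiffOn ℝ ∞ T U := by
    rw [contDiffOn_clm_apply]
    intro u y hy
    have : (fun y ↦ T y u) = fun y ↦ ∑ j, (α y ![u, e j] + q (P u) (e j)) • e j := by
      ext1 y
      rw [hTa, hιa]
      rfl
    rw [this]
    refine ContDiffWithinAt.sum fun j _ ↦ (ContDiffWithinAt.add ?_ contDiffWithinAt_const).smul
      contDiffWithinAt_const
    exact (contDiffAt_form_iff.1 (hα.contDiffAt (hU.mem_nhds hy)) u (e j)).contDiffWithinAt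
  have hTinj : Function.Injective (T y₀) := by
    rw [injective_iff_map_eq_zero]
    intro u hu
    have h1 : bil (α y₀) u + q (P u) = 0 := hιinj _ hu
    have h2 : q (P u) u = 0 := by
      have := DFunLike.congr_fun h1 u
      simpa [bil_self] using this
    have h3 := hqpos u h2
    have h4 : u ∈ K := by
      rw [h3, map_zero, add_zero] at h1
      exact h1
    have h5 := hPK ⟨u, h4⟩
    simp only [h3] at h5
    exact (Subtype.ext_iff.1 h5).symm
  set T₀ : E ≃L[ℝ] E :=
    (LinearEquiv.ofInjectiveEndo (T y₀ : E →ₗ[ℝ] E) hTinj).toContinuousLinearEquiv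
  have hT₀ : (T₀ : E →L[ℝ] E) = T y₀ := by ext; rfl
  set W : Set E := U ∩ T ⁻¹' range ((↑) : (E ≃L[ℝ] E) → E →L[ℝ] E)
  refine ⟨W, fun y ↦ (T y).inverse (T y₀ v),
    hTs.continuousOn.isOpen_inter_preimage hU ContinuousLinearEquiv.isOpen,
    ⟨hy₀, T₀, hT₀⟩, inter_subset_left, ?_, ?_, ?_⟩
  · rintro y ⟨hyU, L, hL⟩
    have h1 : ContDiffAt ℝ ∞ T y := hTs.contDiffAt (hU.mem_nhds hyU)
    have h2 : ContDiffAt ℝ ∞ ContinuousLinearMap.inverse (T y) := hL ▸ contDiffAt_map_inverse L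
    exact ((h2.comp y h1).clm_apply contDiffAt_const).contDiffWithinAt
  · rintro y ⟨hyU, L, hL⟩
    set R := LinearMap.range (ι.comp q)
    have hRr : Module.finrank ℝ R ≤ Module.finrank ℝ K := LinearMap.finrank_range_le _
    set S := R.comap (L : E →ₗ[ℝ] E)
    have hSr : Module.finrank ℝ S = Module.finrank ℝ R := by
      have : S = R.map (L.symm : E →ₗ[ℝ] E) :=
        (R.map_equiv_eq_comap_symm L.toLinearEquiv.symm).symm
      rw [this]
      exact LinearEquiv.finrank_map_eq L.symm.toLinearEquiv R
    have hLa : ∀ u, L u = ι (bil (α y) u + q (P u)) := fun u ↦ by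
      rw [← hTa, ← hL]; rfl
    -- On the kernel of `bil (α y)` the map `T y` reduces to `ι ∘ q ∘ P`, so this kernel lies in
    -- `S`; by constant rank it fills `S`. The section is in `S` because `T y₀ v = ι (q (P v))` for
    -- `v` in the kernel at `y₀`.
    have hle : LinearMap.ker (bil (α y)) ≤ S := fun u hu ↦ by
      refine ⟨P u, ?_⟩
      rw [LinearMap.mem_ker] at hu
      simp [hLa, hu]
    have heq := Submodule.eq_of_le_of_finrank_le hle (by rw [hSr, hr y hyU]; exact hRr)
    have hmem : (T y).inverse (T y₀ v) ∈ S := by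
      refine ⟨P v, ?_⟩
      rw [← hL]
      simp [hTa, hv]
    rw [← heq] at hmem
    exact hmem
  · simp only [← hT₀]
    simp

variable {M : Type*} [TopologicalSpace M] [ChartedSpace E M]

theorem mem_ker_iff {Ω : TwoForm E M} {x : M} {v : E} :
    v ∈ ker Ω x ↔ bil (E := E) (Ω x) v = 0 :=
  ⟨fun h ↦ LinearMap.ext fun w ↦ h w, fun h w ↦ DFunLike.congr_fun h w⟩

theorem inChart_apply (Ω : TwoForm E M) (c : M) (y u w : E) :
    inChart Ω c y ![u, w] = (Ω ((chartAt E c).symm y) : E [⋀^Fin 2]→L[ℝ] ℝ)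
      ![D E E (chartAt E c).symm y u, D E E (chartAt E c).symm y w] :=
  compContinuousLinearMap_pair (E := E) (E' := E) (Ω ((chartAt E c).symm y))
    (D E E (chartAt E c).symm y) u w

variable [IsManifold 𝓘(ℝ, E) ∞ M]

theorem exists_equiv_hasD_chartAt_symm (c : M) {y : E} (hy : y ∈ (chartAt E c).target) :
    ∃ L : E ≃L[ℝ] E, HasD (chartAt E c).symm y (L : E →L[ℝ] E) ∧
      HasD (chartAt E c) ((chartAt E c).symm y) (L.symm : E →L[ℝ] E) :=
  exists_equiv_hasD (chartAt E c).symm (chartAt_symm_contMDiffOn c) (chartAt_contMDiffOn c) hy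

theorem exists_equiv_hasD_chartAt (c : M) {x : M} (hx : x ∈ (chartAt E c).source) :
    ∃ L : E ≃L[ℝ] E, HasD (chartAt E c) x (L : E →L[ℝ] E) ∧
      HasD (chartAt E c).symm (chartAt E c x) (L.symm : E →L[ℝ] E) :=
  exists_equiv_hasD (chartAt E c) (chartAt_contMDiffOn c) (chartAt_symm_contMDiffOn c) hx

theorem bil_inChart_eq_zero_iff (Ω : TwoForm E M) (c : M) {y : E} (hy : y ∈ (chartAt E c).target)
    (u : E) : bil (inChart Ω c y) u = 0 ↔
      D E E (chartAt E c).symm y u ∈ ker Ω ((chartAt E c).symm y) := by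
  obtain ⟨L, hL, -⟩ := exists_equiv_hasD_chartAt_symm c hy
  constructor
  · intro h w
    have h1 := DFunLike.congr_fun h (L.symm w)
    rw [bil_apply, inChart_apply] at h1
    have h2 : D E E (chartAt E c).symm y (L.symm w) = w := by
      rw [hL.eq]
      exact L.apply_symm_apply w
    rw [h2] at h1
    exact h1
  · intro h
    ext w
    rw [bil_apply, inChart_apply]
    exact h _

/-- The bundled derivative of a map which is smooth on an open set. -/
theorem contMDiffOn_tangentMap_comp {E' : Type*} [NormedAddCommGroup E'] [NormedSpace ℝ E']
    {M' : Type*} [TopologicalSpace M'] [ChartedSpace E' M'] [IsManifold 𝓘(ℝ, E') ∞ M']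
    {E'' : Type*} [NormedAddCommGroup E''] [NormedSpace ℝ E'']
    {P : Type*} [TopologicalSpace P] [ChartedSpace E'' P]
    {f : M → M'} {U : Set M} (hU : IsOpen U) (hf : ContMDiffOn 𝓘(ℝ, E) 𝓘(ℝ, E') ∞ f U)
    {g : P → TangentBundle 𝓘(ℝ, E) M} {S : Set P}
    (hg : ContMDiffOn 𝓘(ℝ, E'') 𝓘(ℝ, E).tangent ∞ g S) (hm : ∀ p ∈ S, (g p).1 ∈ U) :
    ContMDiffOn 𝓘(ℝ, E'') 𝓘(ℝ, E').tangent ∞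
      (fun p ↦ tangentMap 𝓘(ℝ, E) 𝓘(ℝ, E') f (g p)) S := by
  have h1 := (hf.contMDiffOn_tangentMapWithin (m := ∞) (by simp) hU.uniqueMDiffOn).comp hg hm
  refine h1.congr fun p hp ↦ ?_
  exact (tangentMapWithin_eq_tangentMap (hU.uniqueMDiffOn _ (hm p hp))
    ((hf.contMDiffAt (hU.mem_nhds (hm p hp))).mdifferentiableAt (by simp))).symm

/-- Every vector in the kernel of a presymplectic form is the value of a smooth section. -/
theorem exists_smooth_section_ker [FiniteDimensional ℝ E] [T2Space M] {Ω : TwoForm E M} (hΩ : IsPresymplectic Ω) (x : M)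
    {v : E} (hv : v ∈ ker Ω x) :
    ∃ Z : VField E M, IsSmoothField Z ∧ (∀ y, Z y ∈ ker Ω y) ∧ Z x = v := by
  obtain ⟨r, hr⟩ := hΩ.constant_rank
  set φ := chartAt E x
  have hx : x ∈ φ.source := mem_chart_source E x
  have hrank : ∀ y ∈ φ.target, Module.finrank ℝ (LinearMap.ker (bil (inChart Ω x y))) = r := by
    intro y hy
    obtain ⟨L, hL, -⟩ := exists_equiv_hasD_chartAt_symm x hy
    have h1 : LinearMap.ker (bil (inChart Ω x y)) =
        (ker Ω (φ.symm y) : Submodule ℝ E).comap (L : E →ₗ[ℝ] E) := by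
      ext u
      rw [LinearMap.mem_ker, bil_inChart_eq_zero_iff Ω x hy, hL.eq]
      rfl
    have h2 : LinearMap.ker (bil (inChart Ω x y)) =
        (ker Ω (φ.symm y) : Submodule ℝ E).map (L.symm : E →ₗ[ℝ] E) :=
      h1.trans ((ker Ω (φ.symm y) : Submodule ℝ E).map_equiv_eq_comap_symm
        L.toLinearEquiv.symm).symm
    rw [h2, ← hr (φ.symm y)]
    exact LinearEquiv.finrank_map_eq L.symm.toLinearEquiv _
  have hx' : φ x ∈ φ.target := φ.map_source hx
  have hv0 : bil (inChart Ω x (φ x)) v = 0 := by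
    rw [bil_inChart_eq_zero_iff Ω x hx', (hasD_chartAt_symm_self x).eq]
    have : ∀ p, p = x → v ∈ ker Ω p := by rintro p rfl; exact hv
    exact this _ (φ.left_inv hx)
  obtain ⟨W, z, hW, hxW, hWU, hz, hzk, hzv⟩ := exists_contDiffOn_ker φ.open_target (hΩ.smooth x)
    hx' (fun y hy ↦ by rw [hrank y hy, hrank _ hx']) hv0
  set S : Set M := φ.source ∩ φ ⁻¹' W
  have hS : IsOpen S := φ.continuousOn.isOpen_inter_preimage φ.open_source hW
  set g : M → TangentBundle 𝓘(ℝ, E) E := fun p ↦ ⟨φ p, z (φ p)⟩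
  have hg : ContMDiffOn 𝓘(ℝ, E) 𝓘(ℝ, E).tangent ∞ g S := by
    have h1 := contMDiffOn_vectorSpace_iff_contDiffOn.2 hz
    exact h1.comp ((chartAt_contMDiffOn x).mono inter_subset_left) fun p hp ↦ hp.2
  have hpush := contMDiffOn_tangentMap_comp φ.open_target (chartAt_symm_contMDiffOn x) hg
    fun p hp ↦ φ.map_source hp.1
  set Y : VField E M := fun p ↦ D E E φ.symm (φ p) (z (φ p))
  have hY : ContMDiffOn 𝓘(ℝ, E) 𝓘(ℝ, E).tangent ∞
      (fun p ↦ (⟨p, Y p⟩ : TangentBundle 𝓘(ℝ, E) M)) S := by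
    refine hpush.congr fun p hp ↦ ?_
    have : ∀ p', p' = p → (⟨p, Y p⟩ : TangentBundle 𝓘(ℝ, E) M) = ⟨p', Y p⟩ := by
      rintro _ rfl; rfl
    exact this _ (φ.left_inv hp.1)
  -- A bump function supported where `Y` is smooth extends the local section by zero. Its value 1 at
  -- `x` keeps the vector `v`.
  obtain ⟨ψ, -, hψ⟩ := (SmoothBumpFunction.nhds_basis_tsupport (I := 𝓘(ℝ, E)) x).mem_iff.1
    (hS.mem_nhds ⟨hx, hxW⟩)
  refine ⟨fun p ↦ ψ p • Y p, ?_, ?_, ?_⟩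
  · exact ContMDiffOn.smul_section_of_tsupport (ψ.contMDiff.contMDiffOn) hS hψ hY
  · intro p
    by_cases hp : p ∈ S
    · refine Submodule.smul_mem _ _ ?_
      have h1 := (bil_inChart_eq_zero_iff Ω x (φ.map_source hp.1) _).1 (hzk _ hp.2)
      have : ∀ p', p' = p → (Y p : E) ∈ ker Ω p' → (Y p : E) ∈ ker Ω p := by
        rintro _ rfl h; exact h
      exact this _ (φ.left_inv hp.1) h1
    · have : ψ p = 0 := by
        by_contra h
        exact hp (hψ (subset_tsupport _ h))
      simp only [this, zero_smul]
      exact Submodule.zero_mem _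
  · have h1 : ψ x = 1 := ψ.eq_one
    have h2 : Y x = v := by
      simp only [Y, hzv]
      rw [(hasD_chartAt_symm_self x).eq]
      rfl
    simp only [h1, h2]
    exact one_smul ℝ v

end KernelSections


/-! ### The constant rank theorem for fibres -/

section ConstantRank

variable {V : Type*} [NormedAddCommGroup V] [NormedSpace ℝ V] [FiniteDimensional ℝ V]
  {W : Type*} [NormedAddCommGroup W] [NormedSpace ℝ W] [FiniteDimensional ℝ W]

theorem exists_continuousLinear_projection (K : Submodule ℝ V) :
    ∃ P : V →L[ℝ] K, ∀ k : K, P k = k := by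
  obtain ⟨P, hP⟩ := K.subtype.exists_leftInverse_of_injective K.ker_subtype
  exact ⟨LinearMap.toContinuousLinearMap P, fun k ↦ DFunLike.congr_fun hP k⟩

/-- The fibres of a map of constant rank are parametrized by the kernel of its derivative. -/
theorem exists_fibre_parametrization_of_contDiffOn {f : V → W} {U : Set V} (hU : IsOpen U)
    (hf : ContDiffOn ℝ ∞ f U) {v₀ : V} (hv₀ : v₀ ∈ U) {K : Submodule ℝ V}
    (hK : K = LinearMap.ker (fderiv ℝ f v₀ : V →ₗ[ℝ] W))
    (hr : ∀ v ∈ U, Module.finrank ℝ (LinearMap.ker (fderiv ℝ f v : V →ₗ[ℝ] W)) =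
      Module.finrank ℝ K) :
    ∃ (r : ℝ) (ψ : K → V), 0 < r ∧ ContDiffOn ℝ ∞ ψ (Metric.ball 0 r) ∧ ψ 0 = v₀ ∧
      HasFDerivAt ψ K.subtypeL 0 ∧ (∀ k ∈ Metric.ball 0 r, ψ k ∈ U ∧ f (ψ k) = f v₀) ∧
      ∀ᶠ v in 𝓝 v₀, f v = f v₀ → ∃ k ∈ Metric.ball 0 r, ψ k = v := by
  have : CompleteSpace V := FiniteDimensional.complete ℝ V
  have hd : ∀ v ∈ U, HasFDerivAt f (fderiv ℝ f v) v := fun v hv ↦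
    ((hf.contDiffAt (hU.mem_nhds hv)).differentiableAt (by simp)).hasFDerivAt
  set A := fderiv ℝ f v₀ with hA
  set R := LinearMap.range (A : V →ₗ[ℝ] W)
  obtain ⟨pr, hpr⟩ := exists_continuousLinear_projection K
  obtain ⟨Q, hQ⟩ := exists_continuousLinear_projection R
  -- The first component records `f` along the range of its derivative at `v₀`, the second the
  -- position along the kernel. By rank–nullity the derivative at `v₀` is an isomorphism, and `ψ` is
  -- the inverse of `Θ` with the first component frozen.
  set Θ : V → R × K := fun v ↦ (Q (f v), pr (v - v₀)) with hΘ
  have hΘs : ContDiffOn ℝ ∞ Θ U := (Q.contDiff.comp_contDiffOn hf).prodMk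
    (pr.contDiff.comp (contDiff_id.sub contDiff_const)).contDiffOn
  have hΘd : ∀ v ∈ U, HasFDerivAt Θ ((Q.comp (fderiv ℝ f v)).prod pr) v := fun v hv ↦
    (Q.hasFDerivAt.comp v (hd v hv)).prodMk
      (pr.hasFDerivAt.comp v ((hasFDerivAt_id v).sub_const v₀))
  have hinj : Function.Injective ((Q.comp A).prod pr) := by
    rw [injective_iff_map_eq_zero]
    intro u hu
    obtain ⟨h1, h2⟩ := Prod.ext_iff.1 hu
    have h3 : A u = 0 := by
      have h := hQ ⟨A u, u, rfl⟩
      have h4 : Q (A u) = 0 := h1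
      simp only [h4] at h
      exact (Subtype.ext_iff.1 h).symm
    have h5 : u ∈ K := by rw [hK]; exact h3
    have h6 := hpr ⟨u, h5⟩
    have h7 : pr u = 0 := h2
    simp only [h7] at h6
    exact (Subtype.ext_iff.1 h6).symm
  have hdim : Module.finrank ℝ V = Module.finrank ℝ (R × K) := by
    rw [Module.finrank_prod, hK, LinearMap.finrank_range_add_finrank_ker]
  set L : V ≃L[ℝ] R × K := (LinearMap.linearEquivOfInjective
    (((Q.comp A).prod pr : V →L[ℝ] R × K) : V →ₗ[ℝ] R × K) hinj hdim).toContinuousLinearEquiv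
  have hL : (L : V →L[ℝ] R × K) = (Q.comp A).prod pr := by ext <;> rfl
  obtain ⟨e, he1, he2, he3, he4, he5⟩ := exists_localDiffeo_of_contDiffOn (L := L) hU hΘs hv₀
    (hL ▸ hΘd v₀ hv₀)
  have hev₀ : e v₀ = (Q (f v₀), 0) := by rw [he3 v₀ he1]; simp [Θ]
  -- This is where constant rank enters. The kernel of `Q ∘ Df_v` contains that of `Df_v`, and `pr`
  -- embeds it in `K`, so the dimensions force equality.
  have hker : ∀ v ∈ e.source, ∀ u, Q (fderiv ℝ f v u) = 0 → fderiv ℝ f v u = 0 := by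
    intro v hv
    obtain ⟨Lv, hLv, -⟩ := exists_equiv_hasD e (contMDiffOn_iff_contDiffOn.2 he4)
      (contMDiffOn_iff_contDiffOn.2 he5) hv
    have h1 : (Lv : V →L[ℝ] R × K) = (Q.comp (fderiv ℝ f v)).prod pr :=
      hLv.unique ((hasD_iff_hasFDerivAt.2 (hΘd v (he2 hv))).congr (by
        filter_upwards [e.open_source.mem_nhds hv] with w hw using he3 w hw))
    set K' := LinearMap.ker (Q.comp (fderiv ℝ f v) : V →ₗ[ℝ] R)
    have h2 : Module.finrank ℝ K' ≤ Module.finrank ℝ K := by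
      refine LinearMap.finrank_le_finrank_of_injective
        (f := (pr : V →ₗ[ℝ] K).comp K'.subtype) ?_
      rw [injective_iff_map_eq_zero]
      intro u hu
      have h3 : Lv (u : V) = 0 := by
        have : Lv (u : V) = (Q.comp (fderiv ℝ f v)).prod pr (u : V) := DFunLike.congr_fun h1 _
        rw [this]
        exact Prod.ext u.2 hu
      exact Subtype.ext (by simpa using h3)
    have h4 : LinearMap.ker (fderiv ℝ f v : V →ₗ[ℝ] W) ≤ K' := fun u hu ↦ by
      have : fderiv ℝ f v u = 0 := hu
      change Q (fderiv ℝ f v u) = 0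
      rw [this, map_zero]
    have h5 := Submodule.eq_of_le_of_finrank_le h4 (by rw [hr v (he2 hv)]; exact h2)
    intro u hu
    have : u ∈ K' := hu
    rw [← h5] at this
    exact this
  have hcont : Continuous fun k : K ↦ (Q (f v₀), k) := by fun_prop
  have h0 : ((fun k : K ↦ (Q (f v₀), k)) ⁻¹' e.target) ∈ 𝓝 (0 : K) :=
    (e.open_target.preimage hcont).mem_nhds (by
      simp only [mem_preimage, ← hev₀]; exact e.map_source he1)
  obtain ⟨r, hrpos, hball⟩ := Metric.mem_nhds_iff.1 h0
  set ψ : K → V := fun k ↦ e.symm (Q (f v₀), k)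
  have hψs : ContDiffOn ℝ ∞ ψ (Metric.ball 0 r) :=
    he5.comp (contDiff_const.prodMk contDiff_id).contDiffOn hball
  have hψ0 : ψ 0 = v₀ := by simp only [ψ, ← hev₀]; exact e.left_inv he1
  have hψmem : ∀ k ∈ Metric.ball 0 r, ψ k ∈ e.source := fun k hk ↦ e.map_target (hball hk)
  have hΘψ : ∀ k ∈ Metric.ball 0 r, Θ (ψ k) = (Q (f v₀), k) := fun k hk ↦ by
    rw [← he3 _ (hψmem k hk)]
    exact e.right_inv (hball hk)
  have hψd : ∀ k ∈ Metric.ball 0 r, HasFDerivAt ψ (fderiv ℝ ψ k) k := fun k hk ↦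
    ((hψs.contDiffAt (Metric.isOpen_ball.mem_nhds hk)).differentiableAt (by simp)).hasFDerivAt
  have hmem0 : (0 : K) ∈ Metric.ball 0 r := Metric.mem_ball_self hrpos
  have hconst : ∀ k ∈ Metric.ball 0 r, f (ψ k) = f v₀ := by
    intro k hk
    -- The first component of `Θ` is constant along `ψ`, so `Q` kills the derivative of `f ∘ ψ`; by
    -- `hker` that derivative is itself zero.
    have hz : EqOn (fderiv ℝ (f ∘ ψ)) 0 (Metric.ball 0 r) := by
      intro k' hk'
      have h1 := (hd _ (he2 (hψmem k' hk'))).comp k' (hψd k' hk')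
      rw [h1.fderiv]
      ext u
      refine hker _ (hψmem k' hk') _ ?_
      have h2 : HasFDerivAt (fun k ↦ Q ((f ∘ ψ) k)) (0 : K →L[ℝ] R) k' := by
        refine (hasFDerivAt_const (Q (f v₀)) k').congr_of_eventuallyEq ?_
        filter_upwards [Metric.isOpen_ball.mem_nhds hk'] with k'' hk''
        exact congrArg Prod.fst (hΘψ k'' hk'')
      exact DFunLike.congr_fun ((Q.hasFDerivAt.comp k' h1).unique h2) u
    have h3 : DifferentiableOn ℝ (f ∘ ψ) (Metric.ball 0 r) := fun k' hk' ↦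
      ((hd _ (he2 (hψmem k' hk'))).comp k' (hψd k' hk')).differentiableAt.differentiableWithinAt
    have h4 := Metric.isOpen_ball.is_const_of_fderiv_eq_zero
      (convex_ball (0 : K) r).isPreconnected h3 hz hk hmem0
    simpa [hψ0] using h4
  refine ⟨r, ψ, hrpos, hψs, hψ0, ?_, fun k hk ↦ ⟨he2 (hψmem k hk), hconst k hk⟩, ?_⟩
  · have h1 := (hΘd v₀ hv₀)
    rw [← hψ0] at h1
    have h2 := h1.comp 0 (hψd 0 hmem0)
    have h3 : HasFDerivAt (Θ ∘ ψ) (ContinuousLinearMap.inr ℝ R K) 0 := by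
      have : HasFDerivAt (fun k : K ↦ (Q (f v₀), k)) (ContinuousLinearMap.inr ℝ R K) 0 :=
        (hasFDerivAt_const (Q (f v₀)) (0 : K)).prodMk (hasFDerivAt_id 0)
      refine this.congr_of_eventuallyEq ?_
      filter_upwards [Metric.isOpen_ball.mem_nhds hmem0] with k hk using hΘψ k hk
    have h4 := h2.unique h3
    have h5 : fderiv ℝ ψ 0 = K.subtypeL := by
      ext u
      refine hinj ?_
      have h6 := DFunLike.congr_fun h4 u
      rw [hψ0] at h6
      refine h6.trans (Prod.ext ?_ (hpr u).symm)
      have h7 : A (u : V) = 0 := hK.le u.2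
      change (0 : R) = Q (A (u : V))
      rw [h7, map_zero]
    rw [← h5]
    exact hψd 0 hmem0
  · have h1 : ContinuousAt (fun v ↦ pr (v - v₀)) v₀ := by fun_prop
    have h2 : ∀ᶠ v in 𝓝 v₀, pr (v - v₀) ∈ Metric.ball (0 : K) r := h1.eventually (by
      simp only [sub_self, map_zero]
      exact Metric.ball_mem_nhds (0 : K) hrpos)
    filter_upwards [h2, e.open_source.mem_nhds he1] with v hv hvs hfv
    refine ⟨_, hv, ?_⟩
    have h3 : e v = (Q (f v₀), pr (v - v₀)) := by rw [he3 v hvs]; simp [Θ, hfv]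
    simp only [ψ, ← h3]
    exact e.left_inv hvs

variable {P : Type*} [TopologicalSpace P] [ChartedSpace V P] [IsManifold 𝓘(ℝ, V) ∞ P]
  {M' : Type*} [TopologicalSpace M'] [ChartedSpace W M'] [IsManifold 𝓘(ℝ, W) ∞ M']

/-- The fibres of a map of constant rank between manifolds are parametrized by the kernel of its
derivative. -/
theorem exists_fibre_parametrization {f : P → M'} (hf : ContMDiff 𝓘(ℝ, V) 𝓘(ℝ, W) ∞ f) (p : P)
    (hr : ∀ q, Module.finrank ℝ (LinearMap.ker (D V W f q : V →ₗ[ℝ] W)) =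
      Module.finrank ℝ (LinearMap.ker (D V W f p : V →ₗ[ℝ] W)))
    {K : Submodule ℝ V} (hK : K = LinearMap.ker (D V W f p : V →ₗ[ℝ] W)) :
    ∃ (r : ℝ) (ψ : K → P), 0 < r ∧ ContMDiffOn 𝓘(ℝ, K) 𝓘(ℝ, V) ∞ ψ (Metric.ball 0 r) ∧
      ψ 0 = p ∧ HasD ψ 0 K.subtypeL ∧ (∀ k ∈ Metric.ball 0 r, f (ψ k) = f p) ∧
      ∀ᶠ q in 𝓝 p, f q = f p → ∃ k ∈ Metric.ball 0 r, ψ k = q := by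
  set c := chartAt V p
  set φ := chartAt W (f p)
  have hpc : p ∈ c.source := mem_chart_source V p
  have hpφ : f p ∈ φ.source := mem_chart_source W (f p)
  set U : Set V := c.target ∩ c.symm ⁻¹' (f ⁻¹' φ.source)
  have hU : IsOpen U := c.symm.continuousOn.isOpen_inter_preimage c.open_target
    (φ.open_source.preimage hf.continuous)
  have hfs : ContDiffOn ℝ ∞ (φ ∘ f ∘ c.symm) U := by
    rw [← contMDiffOn_iff_contDiffOn]
    exact (chartAt_contMDiffOn (f p)).comp (hf.comp_contMDiffOn
      ((chartAt_symm_contMDiffOn p).mono inter_subset_left)) fun v hv ↦ hv.2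
  have hd : ∀ v ∈ U, ∃ (L₁ : V ≃L[ℝ] V) (L₂ : W ≃L[ℝ] W), fderiv ℝ (φ ∘ f ∘ c.symm) v =
      (L₂ : W →L[ℝ] W).comp ((D V W f (c.symm v)).comp (L₁ : V →L[ℝ] V)) := by
    intro v hv
    obtain ⟨L₁, h1, -⟩ := exists_equiv_hasD_chartAt_symm p hv.1
    obtain ⟨L₂, h2, -⟩ := exists_equiv_hasD_chartAt (f p) hv.2
    refine ⟨L₁, L₂, ?_⟩
    exact (hasD_iff_hasFDerivAt.1
      (h2.comp ((hasD_of_contMDiffAt hf.contMDiffAt).comp h1 rfl) rfl)).fderiv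
  have hpU : c p ∈ U := ⟨c.map_source hpc, by simp only [mem_preimage, c.left_inv hpc]; exact hpφ⟩
  have hKc : K = LinearMap.ker (fderiv ℝ (φ ∘ f ∘ c.symm) (c p) : V →ₗ[ℝ] W) := by
    have h1 := ((hasD_chartAt_self (f p)).comp ((hasD_of_contMDiffAt (hf.contMDiffAt (x := p))).comp
      (hasD_chartAt_symm_self p) (c.left_inv hpc)) (by simp))
    rw [(hasD_iff_hasFDerivAt.1 h1).fderiv, hK]
    rfl
  have hrc : ∀ v ∈ U, Module.finrank ℝ (LinearMap.ker
      (fderiv ℝ (φ ∘ f ∘ c.symm) v : V →ₗ[ℝ] W)) = Module.finrank ℝ K := by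
    intro v hv
    obtain ⟨L₁, L₂, h⟩ := hd v hv
    have h1 : LinearMap.ker (fderiv ℝ (φ ∘ f ∘ c.symm) v : V →ₗ[ℝ] W) =
        (LinearMap.ker (D V W f (c.symm v) : V →ₗ[ℝ] W)).comap (L₁ : V →ₗ[ℝ] V) := by
      ext u
      rw [h]
      change L₂ (D V W f (c.symm v) (L₁ u)) = 0 ↔ D V W f (c.symm v) (L₁ u) = 0
      exact L₂.map_eq_zero_iff
    have h2 := h1.trans (Submodule.map_equiv_eq_comap_symm L₁.toLinearEquiv.symm _).symm
    rw [h2, hK, ← hr (c.symm v)]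
    exact LinearEquiv.finrank_map_eq L₁.symm.toLinearEquiv _
  obtain ⟨r, ψ, hr0, hψ, hψ0, hψd, hψf, hev⟩ :=
    exists_fibre_parametrization_of_contDiffOn hU hfs hpU hKc hrc
  refine ⟨r, c.symm ∘ ψ, hr0, ?_, ?_, ?_, ?_, ?_⟩
  · exact (chartAt_symm_contMDiffOn p).comp (contMDiffOn_iff_contDiffOn.2 hψ)
      fun k hk ↦ (hψf k hk).1.1
  · simp [hψ0, c.left_inv hpc]
  · exact (hasD_chartAt_symm_self p).comp (hasD_iff_hasFDerivAt.2 hψd) hψ0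
  · intro k hk
    obtain ⟨h1, h2⟩ := hψf k hk
    have h3 : f (c.symm (c p)) = f p := by rw [c.left_inv hpc]
    refine φ.injOn h1.2 hpφ ?_
    simpa [h3] using h2
  · have h1 := (c.continuousAt hpc).eventually hev
    filter_upwards [h1, c.open_source.mem_nhds hpc] with q hq hqc hfq
    obtain ⟨k, hk, hkq⟩ := hq (by simp [c.left_inv hqc, c.left_inv hpc, hfq])
    exact ⟨k, hk, by simp [hkq, c.left_inv hqc]⟩

end ConstantRank


/-! ### Diffeomorphisms, translations and equivariant maps -/

theorem exists_equiv_hasD_of_inverse {E : Type*} [NormedAddCommGroup E] [NormedSpace ℝ E]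
    {M : Type*} [TopologicalSpace M] [ChartedSpace E M]
    {E' : Type*} [NormedAddCommGroup E'] [NormedSpace ℝ E']
    {M' : Type*} [TopologicalSpace M'] [ChartedSpace E' M'] {f : M → M'} {f' : M' → M}
    (hf : ContMDiff 𝓘(ℝ, E) 𝓘(ℝ, E') ∞ f) (hf' : ContMDiff 𝓘(ℝ, E') 𝓘(ℝ, E) ∞ f')
    (h : ∀ x, f' (f x) = x) (h' : ∀ x, f (f' x) = x) (x : M) :
    ∃ L : E ≃L[ℝ] E', HasD f x (L : E →L[ℝ] E') := by
  have h1 := hasD_of_contMDiffAt (hf.contMDiffAt (x := x))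
  have h2 := hasD_of_contMDiffAt (hf'.contMDiffAt (x := f x))
  have h3 := (h2.comp h1 rfl).unique
    ((hasD_id x).congr (Eventually.of_forall fun y ↦ by simp [h y]))
  have h4 := (h1.comp h2 (h x)).unique
    ((hasD_id (f x)).congr (Eventually.of_forall fun y ↦ by simp [h' y]))
  exact ⟨ContinuousLinearEquiv.equivOfInverse _ _ (fun v ↦ DFunLike.congr_fun h3 v)
    (fun v ↦ DFunLike.congr_fun h4 v), h1⟩

section Translations

variable {E : Type*} [NormedAddCommGroup E] [NormedSpace ℝ E]
  {M : Type*} [TopologicalSpace M] [ChartedSpace E M]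
  {V : Type*} [NormedAddCommGroup V] [NormedSpace ℝ V]
  {G : Type*} [TopologicalSpace G] [ChartedSpace V G] [Group G] [LieGroup 𝓘(ℝ, V) ∞ G]

theorem exists_equiv_hasD_mul_left (g h : G) :
    ∃ L : V ≃L[ℝ] V, HasD (fun h : G ↦ g * h) h (L : V →L[ℝ] V) :=
  exists_equiv_hasD_of_inverse (contMDiff_mul_left (a := g)) (contMDiff_mul_left (a := g⁻¹))
    (fun x ↦ inv_mul_cancel_left g x) (fun x ↦ mul_inv_cancel_left g x) h

theorem exists_equiv_hasD_mul_right (g h : G) :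
    ∃ L : V ≃L[ℝ] V, HasD (fun h : G ↦ h * g) h (L : V →L[ℝ] V) :=
  exists_equiv_hasD_of_inverse (contMDiff_mul_right (a := g)) (contMDiff_mul_right (a := g⁻¹))
    (fun x ↦ mul_inv_cancel_right x g) (fun x ↦ inv_mul_cancel_right x g) h

/-- An equivariant map on a Lie group has constant rank. -/
theorem finrank_ker_eq_of_equivariant {f : G → M} (hf : ContMDiff 𝓘(ℝ, V) 𝓘(ℝ, E) ∞ f) (g : G)
    {τ : M → M} {L : E ≃L[ℝ] E} (hτ : HasD τ (f 1) (L : E →L[ℝ] E)) (h : ∀ h, f (g * h) = τ (f h)) :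
    Module.finrank ℝ (LinearMap.ker (D V E f g : V →ₗ[ℝ] E)) =
      Module.finrank ℝ (LinearMap.ker (D V E f 1 : V →ₗ[ℝ] E)) := by
  obtain ⟨R, hR⟩ := exists_equiv_hasD_mul_left (V := V) g 1
  -- Differentiate `f (g * h) = τ (f h)` at `h = 1`. The derivatives of left translation and of `τ`
  -- are invertible, so the kernels at `g` and at `1` are isomorphic.
  have h1 := (hasD_of_contMDiffAt (hf.contMDiffAt (x := g))).comp hR (mul_one g)
  have h2 := hτ.comp (hasD_of_contMDiffAt (hf.contMDiffAt (x := 1))) rfl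
  have h3 := h1.unique (h2.congr (Eventually.of_forall h))
  have h4 : LinearMap.ker (D V E f 1 : V →ₗ[ℝ] E) =
      (LinearMap.ker (D V E f g : V →ₗ[ℝ] E)).comap (R : V →ₗ[ℝ] V) := by
    ext u
    have h5 : D V E f g (R u) = L (D V E f 1 u) := DFunLike.congr_fun h3 u
    change D V E f 1 u = 0 ↔ D V E f g (R u) = 0
    rw [h5]
    exact L.map_eq_zero_iff.symm
  have h6 := h4.trans (Submodule.map_equiv_eq_comap_symm R.toLinearEquiv.symm _).symm
  rw [h6]
  exact (LinearEquiv.finrank_map_eq R.symm.toLinearEquiv _).symm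

end Translations

/-! ### Free and proper actions: orbit maps and slice charts -/

section Action

variable {E : Type*} [NormedAddCommGroup E] [NormedSpace ℝ E]
  {M : Type*} [TopologicalSpace M] [ChartedSpace E M]
  {V : Type*} [NormedAddCommGroup V] [NormedSpace ℝ V]
  {G : Type*} [TopologicalSpace G] [ChartedSpace V G] [Group G]

variable (V E G) in
/-- The linear map `ξ ↦ ξ̃(x)`. -/
noncomputable def orbitD [MulAction G M] (x : M) : V →L[ℝ] E := D V E (fun g : G ↦ g • x) 1

/-- The map `g ↦ (g • x, x)` is a closed embedding followed by the proper map `(g, y) ↦ (g • y, y)`,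
hence proper. It is injective by freeness, so it is a closed embedding. This is what lets continuity
of a curve in an orbit pass to the group elements. -/
theorem isInducing_orbit [T2Space M] [MulAction G M] [ProperSMul G M]
    (hfree : ∀ (g : G) (x : M), g • x = x → g = 1) (x : M) :
    IsInducing (fun g : G ↦ g • x) := by
  have h1 : IsClosedEmbedding (fun g : G ↦ (g, x)) := by
    refine ⟨isEmbedding_prodMkLeft x, ?_⟩
    have : range (fun g : G ↦ (g, x)) = Prod.snd ⁻¹' {x} := by
      ext ⟨g, y⟩
      simp [eq_comm]
    rw [this]
    exact isClosed_singleton.preimage continuous_snd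
  have h2 : IsProperMap ((fun p : G × M ↦ (p.1 • p.2, p.2)) ∘ fun g : G ↦ (g, x)) :=
    ProperSMul.isProperMap_smul_pair.comp h1.isProperMap
  have h3 : Function.Injective ((fun p : G × M ↦ (p.1 • p.2, p.2)) ∘ fun g : G ↦ (g, x)) := by
    intro g h hgh
    have h4 : g • x = h • x := (Prod.ext_iff.1 hgh).1
    have h5 := hfree (h⁻¹ * g) x (by rw [mul_smul, h4, inv_smul_smul])
    exact (inv_mul_eq_one.1 h5).symm
  have h4 : IsClosedEmbedding ((fun p : G × M ↦ (p.1 • p.2, p.2)) ∘ fun g : G ↦ (g, x)) :=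
    IsClosedEmbedding.of_continuous_injective_isClosedMap h2.continuous h3 h2.isClosedMap
  exact IsInducing.of_comp (f := fun g : G ↦ g • x) (g := fun y : M ↦ (y, x))
    (by fun_prop) (by fun_prop) h4.isInducing

variable (E V) in
theorem contMDiff_smul_left [MulAction G M]
    [ContMDiffSMul 𝓘(ℝ, V) 𝓘(ℝ, E) ∞ G M] (g : G) : ContMDiff 𝓘(ℝ, E) 𝓘(ℝ, E) ∞ (fun x : M ↦ g • x) :=
  (ContMDiffSMul.contMDiff_smul (I := 𝓘(ℝ, V)) (I' := 𝓘(ℝ, E)) (n := ∞) (G := G) (M := M)).comp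
    (contMDiff_const.prodMk contMDiff_id)

variable (V) in
theorem exists_equiv_hasD_smul_left [MulAction G M]
    [ContMDiffSMul 𝓘(ℝ, V) 𝓘(ℝ, E) ∞ G M] (g : G) (x : M) :
    ∃ L : E ≃L[ℝ] E, HasD (fun x : M ↦ g • x) x (L : E →L[ℝ] E) :=
  exists_equiv_hasD_of_inverse (contMDiff_smul_left E V g) (contMDiff_smul_left E V g⁻¹)
    (fun x ↦ inv_smul_smul g x) (fun x ↦ smul_inv_smul g x) x

variable [MulAction G M] [ContMDiffSMul 𝓘(ℝ, V) 𝓘(ℝ, E) ∞ G M]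

variable (E V) in
theorem contMDiff_orbit (x : M) : ContMDiff 𝓘(ℝ, V) 𝓘(ℝ, E) ∞ (fun g : G ↦ g • x) :=
  (ContMDiffSMul.contMDiff_smul (I := 𝓘(ℝ, V)) (I' := 𝓘(ℝ, E)) (n := ∞) (G := G) (M := M)).comp
    (contMDiff_id.prodMk contMDiff_const)

variable (E V) in
theorem hasD_orbit (x : M) (g : G) : HasD (fun g : G ↦ g • x) g (D V E (fun g : G ↦ g • x) g) :=
  hasD_of_contMDiffAt (contMDiff_orbit E V x).contMDiffAt

variable [LieGroup 𝓘(ℝ, V) ∞ G]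

/-- The derivatives of an orbit map at two points agree up to right translation. -/
theorem exists_orbitD_smul_eq (g : G) (x : M) : ∃ L : V ≃L[ℝ] V,
    orbitD E V G (g • x) = (D V E (fun g : G ↦ g • x) g).comp (L : V →L[ℝ] V) := by
  obtain ⟨L, hL⟩ := exists_equiv_hasD_mul_right (V := V) g 1
  refine ⟨L, ?_⟩
  have h1 := (hasD_orbit E V x g).comp hL (one_mul g)
  have h2 : (fun h : G ↦ h • (g • x)) = (fun g : G ↦ g • x) ∘ fun h ↦ h * g := by
    ext h; simp [mul_smul]
  have h3 := hasD_orbit E V (g • x) (1 : G)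
  rw [h2] at h3
  have h4 := h3.unique h1
  rw [← h2] at h4
  exact h4

/-- Right translation by `g` turns the orbit map of `x` into that of `g • x` and has an invertible
derivative, so one orbit map computes the tangent spaces at all points of its orbit. -/
theorem range_orbitD_smul (g : G) (x : M) : LinearMap.range (orbitD E V G (g • x) : V →ₗ[ℝ] E) =
    LinearMap.range (D V E (fun g : G ↦ g • x) g : V →ₗ[ℝ] E) := by
  obtain ⟨L, hL⟩ := exists_orbitD_smul_eq (E := E) (V := V) g x
  rw [hL]
  exact LinearMap.range_comp_of_range_eq_top _ (LinearMap.range_eq_top.2 L.surjective)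

variable [FiniteDimensional ℝ E] [IsManifold 𝓘(ℝ, E) ∞ M] [FiniteDimensional ℝ V]

/-- For a free action, `ξ ↦ ξ̃(x)` is injective. -/
theorem injective_orbitD (hfree : ∀ (g : G) (x : M), g • x = x → g = 1) (x : M) :
    Function.Injective (orbitD E V G x) := by
  have hr : ∀ g : G, Module.finrank ℝ (LinearMap.ker (D V E (fun g : G ↦ g • x) g : V →ₗ[ℝ] E)) =
      Module.finrank ℝ (LinearMap.ker (D V E (fun g : G ↦ g • x) 1 : V →ₗ[ℝ] E)) := by
    intro g
    obtain ⟨L, hL⟩ := exists_equiv_hasD_smul_left (E := E) V g ((1 : G) • x)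
    exact finrank_ker_eq_of_equivariant (contMDiff_orbit E V x) g hL fun h ↦ mul_smul g h x
  obtain ⟨r, ψ, hr0, -, hψ0, hψd, hψf, -⟩ :=
    exists_fibre_parametrization (contMDiff_orbit E V x) (1 : G) hr rfl
  -- By freeness the fibre through `1` is a point, so its parametrization is constant near 0. Its
  -- derivative is then both zero and the inclusion of the kernel.
  have h1 := hψd.unique ((hasD_const (1 : G) 0).congr (by
    filter_upwards [Metric.ball_mem_nhds 0 hr0] with k hk
    exact hfree _ x ((hψf k hk).trans (one_smul G x))))
  rw [injective_iff_map_eq_zero]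
  intro u hu
  exact DFunLike.congr_fun h1 ⟨u, hu⟩

/-- Local coordinates in which the orbits are the slices `s = const`. -/
theorem exists_slice_chart (hfree : ∀ (g : G) (x : M), g • x = x → g = 1) (p : M) :
    ∃ (S : Submodule ℝ E) (e : OpenPartialHomeomorph (V × S) M),
      (chartAt V (1 : G) 1, 0) ∈ e.source ∧
      (∀ w ∈ e.source, w.1 ∈ (chartAt V (1 : G)).target ∧ e w = (chartAt V (1 : G)).symm w.1 •
        (chartAt E p).symm (chartAt E p p + w.2)) ∧
      ContMDiffOn 𝓘(ℝ, V × S) 𝓘(ℝ, E) ∞ e e.source ∧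
      ContMDiffOn 𝓘(ℝ, E) 𝓘(ℝ, V × S) ∞ e.symm e.target := by
  set c := chartAt V (1 : G)
  set φ := chartAt E p
  have h1c : (1 : G) ∈ c.source := mem_chart_source V 1
  have hpφ : p ∈ φ.source := mem_chart_source E p
  have hinj := injective_orbitD (V := V) (E := E) hfree p
  set R := LinearMap.range (orbitD E V G p : V →ₗ[ℝ] E)
  -- A linear complement to the tangent space of the orbit at `p` is a transversal. Moving it by the
  -- group gives a map with invertible derivative at `(c 1, 0)`.
  obtain ⟨S, hS⟩ := R.exists_isCompl
  have : CompleteSpace (V × S) := FiniteDimensional.complete ℝ _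
  set τ : V × S → E := fun w ↦ φ p + w.2
  have hτ : ContDiff ℝ ∞ τ := contDiff_const.add (S.subtypeL.contDiff.comp contDiff_snd)
  set U : Set (V × S) := Prod.fst ⁻¹' c.target ∩ τ ⁻¹' φ.target
  have hU : IsOpen U := (c.open_target.preimage continuous_fst).inter
    (φ.open_target.preimage hτ.continuous)
  set f : V × S → M := fun w ↦ c.symm w.1 • φ.symm (τ w)
  have hf : ContMDiffOn 𝓘(ℝ, V × S) 𝓘(ℝ, E) ∞ f U :=
    (ContMDiffSMul.contMDiff_smul (I := 𝓘(ℝ, V)) (I' := 𝓘(ℝ, E)) (n := ∞)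
      (G := G) (M := M)).comp_contMDiffOn
      (((chartAt_symm_contMDiffOn (1 : G)).comp (contDiff_fst.contMDiff.contMDiffOn)
        (fun w hw ↦ hw.1)).prodMk
      ((chartAt_symm_contMDiffOn p).comp hτ.contMDiff.contMDiffOn fun w hw ↦ hw.2))
  have hb : ((c 1, 0) : V × S) ∈ U := ⟨c.map_source h1c, by
    simp only [mem_preimage, τ, ZeroMemClass.coe_zero, add_zero]
    exact φ.map_source hpφ⟩
  have hfd := hasD_of_contMDiffOn hf hU hb
  have hinl : (D (V × S) E f (c 1, 0)).comp (ContinuousLinearMap.inl ℝ V S) = orbitD E V G p := by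
    have h1 := hfd.comp (hasD_iff_hasFDerivAt.2 (hasFDerivAt_prodMk_left (c 1) (0 : S))) rfl
    have h2 := (hasD_orbit E V p (1 : G)).comp (hasD_chartAt_symm_self (1 : G)) (c.left_inv h1c)
    refine h1.unique (h2.congr (Eventually.of_forall fun v ↦ ?_))
    simp [f, τ, φ.left_inv hpφ, c]
  have hinr : (D (V × S) E f (c 1, 0)).comp (ContinuousLinearMap.inr ℝ V S) = S.subtypeL := by
    have h1 := hfd.comp (hasD_iff_hasFDerivAt.2 (hasFDerivAt_prodMk_right (c 1) (0 : S))) rfl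
    have h3 : HasD (fun s : S ↦ φ p + (s : E)) (0 : S) S.subtypeL :=
      hasD_iff_hasFDerivAt.2 (S.subtypeL.hasFDerivAt.const_add (φ p))
    have h2 := (hasD_chartAt_symm_self p).comp h3 (by simp [φ])
    refine h1.unique (h2.congr (Eventually.of_forall fun s ↦ ?_))
    simp [f, τ, c.left_inv h1c, φ]
  have hDf : ∀ w : V × S, D (V × S) E f (c 1, 0) w = orbitD E V G p w.1 + w.2 := by
    intro w
    have h1 : w = ContinuousLinearMap.inl ℝ V S w.1 + ContinuousLinearMap.inr ℝ V S w.2 := by simp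
    rw [h1, map_add, ← ContinuousLinearMap.comp_apply, ← ContinuousLinearMap.comp_apply, hinl, hinr]
    simp
  have hbij : Function.Bijective (D (V × S) E f (c 1, 0)) := by
    constructor
    · rw [injective_iff_map_eq_zero]
      intro w hw
      rw [hDf] at hw
      have h1 : (w.2 : E) ∈ R := ⟨-w.1, by
        rw [map_neg]
        exact (neg_eq_of_add_eq_zero_right hw)⟩
      have h2 : (w.2 : E) = 0 := (Submodule.disjoint_def.1 hS.disjoint) _ h1 w.2.2
      rw [h2, add_zero] at hw
      exact Prod.ext (hinj (hw.trans (map_zero (orbitD E V G p)).symm)) (Subtype.ext h2)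
    · intro u
      obtain ⟨a, ⟨ξ, rfl⟩, b, hb, rfl⟩ := Submodule.mem_sup.1
        (hS.sup_eq_top ▸ Submodule.mem_top : u ∈ R ⊔ S)
      exact ⟨(ξ, ⟨b, hb⟩), hDf _⟩
  set L : (V × S) ≃L[ℝ] E := (LinearEquiv.ofBijective
    (D (V × S) E f (c 1, 0) : V × S →ₗ[ℝ] E) hbij).toContinuousLinearEquiv
  have hL : (L : V × S →L[ℝ] E) = D (V × S) E f (c 1, 0) := by ext <;> rfl
  obtain ⟨e, he1, he2, he3, he4, he5⟩ := exists_localDiffeo hU hf hb (L := L) (hL ▸ hfd)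
  exact ⟨S, e, he1, fun w hw ↦ ⟨(he2 hw).1, he3 w hw⟩, he4, he5⟩

end Action


/-! ### Curves tangent to orbits and curves in orbits -/

section OrbitCurves

variable {E : Type*} [NormedAddCommGroup E] [NormedSpace ℝ E] [FiniteDimensional ℝ E]
  {M : Type*} [TopologicalSpace M] [ChartedSpace E M] [IsManifold 𝓘(ℝ, E) ∞ M]
  {V : Type*} [NormedAddCommGroup V] [NormedSpace ℝ V] [FiniteDimensional ℝ V]
  {G : Type*} [TopologicalSpace G] [ChartedSpace V G] [Group G] [LieGroup 𝓘(ℝ, V) ∞ G]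
  [MulAction G M] [ContMDiffSMul 𝓘(ℝ, V) 𝓘(ℝ, E) ∞ G M]

/-- In a slice chart, the tangent spaces of the orbits are the first factor. -/
theorem exists_slice_chart_tangent (hfree : ∀ (g : G) (x : M), g • x = x → g = 1) (p : M) :
    ∃ (S : Submodule ℝ E) (e : OpenPartialHomeomorph (V × S) M),
      (chartAt V (1 : G) 1, 0) ∈ e.source ∧ e (chartAt V (1 : G) 1, 0) = p ∧
      (∀ w ∈ e.source, w.1 ∈ (chartAt V (1 : G)).target ∧
        (w.2 = 0 → e w = (chartAt V (1 : G)).symm w.1 • p)) ∧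
      ∀ w ∈ e.source, ∃ L : (V × S) ≃L[ℝ] E, HasD e.symm (e w) (L.symm : E →L[ℝ] V × S) ∧
        LinearMap.range (orbitD E V G (e w) : V →ₗ[ℝ] E) =
          LinearMap.range ((L : V × S →L[ℝ] E).comp (ContinuousLinearMap.inl ℝ V S) :
            V →ₗ[ℝ] E) := by
  obtain ⟨S, e, he1, he2, he3, he4⟩ := exists_slice_chart (V := V) (E := E) hfree p
  set c := chartAt V (1 : G)
  set φ := chartAt E p
  have hφ : φ.symm (φ p) = p := φ.left_inv (mem_chart_source E p)
  have h1c : c.symm (c 1) = 1 := c.left_inv (mem_chart_source V 1)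
  refine ⟨S, e, he1, ?_, fun w hw ↦ ⟨(he2 w hw).1, fun h ↦ ?_⟩, ?_⟩
  · rw [(he2 _ he1).2]
    simp [hφ, h1c]
  · rw [(he2 w hw).2, h]
    simp [hφ]
  · intro w hw
    obtain ⟨L, hL1, hL2⟩ := exists_equiv_hasD e he3 he4 hw
    refine ⟨L, hL2, ?_⟩
    obtain ⟨hw1, hw2⟩ := he2 w hw
    set q := φ.symm (φ p + w.2)
    set g := c.symm w.1
    obtain ⟨L₁, hc1, -⟩ := exists_equiv_hasD_chartAt_symm (1 : G) hw1
    -- With the second coordinate fixed, the first one moves the point along the orbit of `q`, so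
    -- the first factor maps onto the tangent space of this orbit.
    have h1 := hL1.comp (hasD_iff_hasFDerivAt.2 (hasFDerivAt_prodMk_left w.1 w.2)) rfl
    have h2 := (hasD_orbit E V q g).comp hc1 rfl
    have hmem : ∀ᶠ v in 𝓝 w.1, (v, w.2) ∈ e.source :=
      (Continuous.prodMk_left w.2).continuousAt.eventually (e.open_source.mem_nhds hw)
    have h3 := h1.unique (h2.congr (by
      filter_upwards [hmem] with v hv
      exact (he2 _ hv).2))
    rw [h3, hw2, range_orbitD_smul]
    exact (LinearMap.range_comp_of_range_eq_top _ (LinearMap.range_eq_top.2 L₁.surjective)).symm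

/-- A curve tangent to the orbits stays in one orbit. -/
theorem exists_smul_eq_of_tangent_orbits (hfree : ∀ (g : G) (x : M), g • x = x → g = 1)
    {γ : ℝ → M} (hγ : ContMDiff 𝓘(ℝ, ℝ) 𝓘(ℝ, E) ∞ γ)
    (ht : ∀ t, D ℝ E γ t 1 ∈ LinearMap.range (orbitD E V G (γ t) : V →ₗ[ℝ] E)) (t₀ t : ℝ) :
    ∃ g : G, γ t = g • γ t₀ := by
  have key : ∀ t₁, ∀ᶠ t in 𝓝 t₁, ∃ g : G, γ t = g • γ t₁ := by
    intro t₁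
    obtain ⟨S, e, he1, he2, he3, he4⟩ := exists_slice_chart_tangent (V := V) (E := E) hfree (γ t₁)
    have hmem : γ ⁻¹' e.target ∈ 𝓝 t₁ := (e.open_target.preimage hγ.continuous).mem_nhds (by
      simp only [mem_preimage, ← he2]
      exact e.map_source he1)
    obtain ⟨δ, hδ, hball⟩ := Metric.mem_nhds_iff.1 hmem
    -- The velocity lies in the image of the first factor, so the slice coordinate is stationary.
    have hd : ∀ t ∈ Metric.ball t₁ δ, HasFDerivAt (fun t ↦ (e.symm (γ t)).2) (0 : ℝ →L[ℝ] S) t := by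
      intro t htb
      have hγt : γ t ∈ e.target := hball htb
      obtain ⟨L, hL, hR⟩ := he4 (e.symm (γ t)) (e.map_target hγt)
      rw [e.right_inv hγt] at hL hR
      have h1 := hL.comp (hasD_of_contMDiffAt (hγ.contMDiffAt (x := t))) rfl
      have h2 := (ContinuousLinearMap.snd ℝ V S).hasFDerivAt.comp t (hasD_iff_hasFDerivAt.1 h1)
      refine h2.congr_fderiv (ContinuousLinearMap.ext_ring ?_)
      obtain ⟨η, hη⟩ := hR.le (ht t)
      have h4 : L (η, 0) = D ℝ E γ t 1 := hη
      change (L.symm (D ℝ E γ t 1)).2 = 0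
      rw [← h4, L.symm_apply_apply]
    have hconst : ∀ t ∈ Metric.ball t₁ δ, (e.symm (γ t)).2 = 0 := by
      intro t htb
      have h1 := Metric.isOpen_ball.is_const_of_fderiv_eq_zero (convex_ball t₁ δ).isPreconnected
        (fun t ht ↦ (hd t ht).differentiableAt.differentiableWithinAt)
        (fun t ht ↦ (hd t ht).fderiv) htb (Metric.mem_ball_self hδ)
      rw [h1]
      conv_lhs => rw [← he2]
      rw [e.left_inv he1]
    filter_upwards [Metric.ball_mem_nhds t₁ hδ] with t htb
    refine ⟨(chartAt V (1 : G)).symm (e.symm (γ t)).1, ?_⟩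
    have h1 := (he3 _ (e.map_target (hball htb))).2 (hconst t htb)
    rwa [e.right_inv (hball htb)] at h1
  set T : Set ℝ := {t | ∃ g : G, γ t = g • γ t₀}
  -- By `key`, nearby parameters give points of one orbit, so membership in the orbit of `γ t₀` is
  -- locally constant in `t`.
  have hT : IsClopen T := by
    constructor
    · rw [← isOpen_compl_iff, isOpen_iff_mem_nhds]
      intro t₁ ht₁
      filter_upwards [key t₁] with t ⟨g, hg⟩ ⟨h, hh⟩
      exact ht₁ ⟨g⁻¹ * h, by rw [mul_smul, ← hh, hg, inv_smul_smul]⟩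
    · rw [isOpen_iff_mem_nhds]
      rintro t₁ ⟨h, hh⟩
      filter_upwards [key t₁] with t ⟨g, hg⟩
      exact ⟨g * h, by rw [hg, hh, mul_smul]⟩
  have huniv : T = univ := hT.eq_univ ⟨t₀, 1, (one_smul G _).symm⟩
  have : t ∈ T := huniv ▸ mem_univ t
  exact this

/-- The velocity of a curve in an orbit is tangent to the orbit. -/
theorem mem_range_orbitD_of_curve_in_orbit [T2Space M] [ProperSMul G M]
    (hfree : ∀ (g : G) (x : M), g • x = x → g = 1) {γ : ℝ → M} {v : E}
    (hγ : HasD γ 0 (ContinuousLinearMap.toSpanSingleton ℝ v)) {x : M} (hx : γ 0 = x)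
    (hg : ∀ᶠ t in 𝓝 0, ∃ g : G, γ t = g • x) :
    v ∈ LinearMap.range (orbitD E V G x : V →ₗ[ℝ] E) := by
  obtain ⟨S, e, he1, he2, he3, he4⟩ := exists_slice_chart_tangent (V := V) (E := E) hfree x
  set c := chartAt V (1 : G)
  have hc1 : (1 : G) ∈ c.source := mem_chart_source V 1
  obtain ⟨L, hL, hR⟩ := he4 _ he1
  rw [he2] at hL hR
  have h1 := hL.comp hγ hx
  -- As the orbit map is inducing, points of the orbit close to `x` come from group elements close
  -- to `1`. Without this the orbit could return to the chart in other slices, and the slice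
  -- coordinate need not vanish.
  have hnear : ∀ᶠ g in 𝓝 (1 : G), g ∈ c.source ∧ ((c g, 0) : V × S) ∈ e.source := by
    have hcont : ContinuousAt (fun g ↦ ((c g, 0) : V × S)) 1 :=
      (c.continuousAt hc1).prodMk continuousAt_const
    exact Filter.Eventually.and (c.open_source.mem_nhds hc1) (hcont.eventually (e.open_source.mem_nhds he1))
  rw [(isInducing_orbit hfree x).nhds_eq_comap, one_smul] at hnear
  obtain ⟨N, hN, hNsub⟩ := mem_comap.1 hnear
  have hγc : ContinuousAt γ 0 := hγ.continuousAt
  have hγN : ∀ᶠ t in 𝓝 0, γ t ∈ N := hγc.eventually (by rw [hx]; exact hN)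
  have hz : (fun t ↦ (e.symm (γ t)).2) =ᶠ[𝓝 0] fun _ ↦ (0 : S) := by
    filter_upwards [hγN, hg] with t ht ⟨g, hgt⟩
    obtain ⟨hgc, hge⟩ := hNsub (show g ∈ (fun g : G ↦ g • x) ⁻¹' N by
      simp only [mem_preimage, ← hgt]; exact ht)
    have h2 := (he3 _ hge).2 rfl
    rw [c.left_inv hgc, ← hgt] at h2
    rw [← h2, e.left_inv hge]
  have h2 := (ContinuousLinearMap.snd ℝ V S).hasFDerivAt.comp 0 (hasD_iff_hasFDerivAt.1 h1)
  have h3 := h2.unique ((hasFDerivAt_const (0 : S) (0 : ℝ)).congr_of_eventuallyEq hz)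
  have h4 : (L.symm v).2 = 0 := by
    have := DFunLike.congr_fun h3 1
    simpa using this
  rw [hR]
  refine ⟨(L.symm v).1, ?_⟩
  have h5 : ((L.symm v).1, (0 : S)) = L.symm v := Prod.ext rfl h4.symm
  change L ((L.symm v).1, 0) = v
  rw [h5]
  exact L.apply_symm_apply v

end OrbitCurves


/-! ### The derivative of the adjoint representation -/

section LieBracket

variable {V : Type*} [NormedAddCommGroup V]
  {G : Type*} [TopologicalSpace G] [ChartedSpace V G] [Group G]

variable (V G) in
/-- The multiplication of a Lie group in the preferred chart at the identity. -/
noncomputable def chartMul (p : V × V) : V :=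
  chartAt V (1 : G) ((chartAt V (1 : G)).symm p.1 * (chartAt V (1 : G)).symm p.2)

variable (V G) in
/-- The identity in the preferred chart. -/
noncomputable def chartOne : V := chartAt V (1 : G) 1

theorem chartOne_mem : chartOne V G ∈ (chartAt V (1 : G)).target :=
  (chartAt V (1 : G)).map_source (mem_chart_source V 1)

theorem chartAt_symm_chartOne : (chartAt V (1 : G)).symm (chartOne V G) = 1 :=
  (chartAt V (1 : G)).left_inv (mem_chart_source V 1)

variable [NormedSpace ℝ V] [LieGroup 𝓘(ℝ, V) ∞ G]

theorem chartMul_contDiffAt {p : V × V} (h1 : p.1 ∈ (chartAt V (1 : G)).target)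
    (h2 : p.2 ∈ (chartAt V (1 : G)).target)
    (h3 : (chartAt V (1 : G)).symm p.1 * (chartAt V (1 : G)).symm p.2 ∈
      (chartAt V (1 : G)).source) : ContDiffAt ℝ ∞ (chartMul V G) p := by
  have : IsManifold 𝓘(ℝ, V) ∞ G := inferInstance
  have hc : ∀ v ∈ (chartAt V (1 : G)).target,
      ContMDiffAt 𝓘(ℝ, V) 𝓘(ℝ, V) ∞ (chartAt V (1 : G)).symm v := fun v hv ↦
    (chartAt_symm_contMDiffOn (1 : G)).contMDiffAt ((chartAt V (1 : G)).open_target.mem_nhds hv)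
  rw [← contMDiffAt_iff_contDiffAt]
  have h4 : ContMDiffAt 𝓘(ℝ, V × V) 𝓘(ℝ, V) ∞
      (fun p : V × V ↦ (chartAt V (1 : G)).symm p.1 * (chartAt V (1 : G)).symm p.2) p :=
    ((hc _ h1).comp p contDiff_fst.contMDiff.contMDiffAt).mul
      ((hc _ h2).comp p contDiff_snd.contMDiff.contMDiffAt)
  exact ((chartAt_contMDiffOn (1 : G)).contMDiffAt
    ((chartAt V (1 : G)).open_source.mem_nhds h3)).comp p h4

variable (V) in
theorem hasD_mul_left (g h : G) : HasD (fun h : G ↦ g * h) h (D V V (fun h : G ↦ g * h) h) :=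
  hasD_of_contMDiffAt (contMDiff_mul_left (a := g)).contMDiffAt

variable (V) in
theorem hasD_mul_right (g h : G) : HasD (fun h : G ↦ h * g) h (D V V (fun h : G ↦ h * g) h) :=
  hasD_of_contMDiffAt (contMDiff_mul_right (a := g)).contMDiffAt

theorem hasD_Ad (g : G) : HasD (fun h : G ↦ g * h * g⁻¹) 1 (Ad g : V →L[ℝ] V) := by
  have h : ContMDiff 𝓘(ℝ, V) 𝓘(ℝ, V) ∞ (fun h : G ↦ g * h * g⁻¹) :=
    (contMDiff_mul_right (a := g⁻¹)).comp (contMDiff_mul_left (a := g))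
  exact hasD_of_contMDiffAt h.contMDiffAt

/-- Left translation in the preferred chart. -/
theorem fderiv_chartMul_inr {g : G} (hg : g ∈ (chartAt V (1 : G)).source) :
    (fderiv ℝ (chartMul V G) (chartAt V (1 : G) g, chartOne V G)).comp
      (ContinuousLinearMap.inr ℝ V V) =
    (D V V (chartAt V (1 : G)) g).comp (D V V (fun h : G ↦ g * h) 1) := by
  set c := chartAt V (1 : G)
  have h0 : c.symm (c g) = g := c.left_inv hg
  have h1 := (chartMul_contDiffAt (p := (c g, chartOne V G)) (c.map_source hg) chartOne_mem (by
    simpa [c, chartAt_symm_chartOne, c.left_inv hg] using hg)).differentiableAt (by simp)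
  have h2 := h1.hasFDerivAt.comp (chartOne V G) (hasFDerivAt_prodMk_right (c g) (chartOne V G))
  have h3 := ((hasD_of_contMDiffOn (chartAt_contMDiffOn (1 : G)) c.open_source hg).comp
    (hasD_mul_left V g 1) (mul_one g)).comp (hasD_chartAt_symm_self (1 : G)) chartAt_symm_chartOne
  refine (hasD_iff_hasFDerivAt.2 h2).unique (h3.congr (Eventually.of_forall fun v ↦ ?_))
  simp [chartMul, c, h0]

/-- Right translation in the preferred chart. -/
theorem fderiv_chartMul_inl {g : G} (hg : g ∈ (chartAt V (1 : G)).source) :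
    (fderiv ℝ (chartMul V G) (chartOne V G, chartAt V (1 : G) g)).comp
      (ContinuousLinearMap.inl ℝ V V) =
    (D V V (chartAt V (1 : G)) g).comp (D V V (fun h : G ↦ h * g) 1) := by
  set c := chartAt V (1 : G)
  have h0 : c.symm (c g) = g := c.left_inv hg
  have h1 := (chartMul_contDiffAt (p := (chartOne V G, c g)) chartOne_mem (c.map_source hg) (by
    simpa [c, chartAt_symm_chartOne, c.left_inv hg] using hg)).differentiableAt (by simp)
  have h2 := h1.hasFDerivAt.comp (f := fun e : V ↦ (e, c g)) (chartOne V G)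
    (hasFDerivAt_prodMk_left (𝕜 := ℝ) (chartOne V G) (c g))
  have h3 := ((hasD_of_contMDiffOn (chartAt_contMDiffOn (1 : G)) c.open_source hg).comp
    (hasD_mul_right V g 1) (one_mul g)).comp (hasD_chartAt_symm_self (1 : G)) chartAt_symm_chartOne
  refine (hasD_iff_hasFDerivAt.2 h2).unique (h3.congr (Eventually.of_forall fun v ↦ ?_))
  simp [chartMul, c, h0]

theorem mul_right_comp_Ad (g : G) :
    (D V V (fun h : G ↦ h * g) 1).comp (Ad g : V →L[ℝ] V) = D V V (fun h : G ↦ g * h) 1 := by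
  have h1 := (hasD_mul_right V g 1).comp (hasD_Ad g) (by simp)
  exact h1.unique ((hasD_mul_left V g 1).congr (Eventually.of_forall fun h ↦ by simp))

variable (V G) in
/-- The derivative of `chartMul` in the first variable at the identity. -/
noncomputable def chartRight (a : V) : V →L[ℝ] V :=
  (fderiv ℝ (chartMul V G) (chartOne V G, a)).comp (ContinuousLinearMap.inl ℝ V V)

variable (V G) in
/-- The derivative of `chartMul` in the second variable at the identity. -/
noncomputable def chartLeft (a : V) : V →L[ℝ] V :=
  (fderiv ℝ (chartMul V G) (a, chartOne V G)).comp (ContinuousLinearMap.inr ℝ V V)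

/-- Conjugation by `g` followed by right translation by `g` is left translation by `g`. This
expresses `Ad g` through the first derivatives of the multiplication, which depend smoothly on the
chart coordinate of `g`. -/
theorem chartRight_Ad {g : G} (hg : g ∈ (chartAt V (1 : G)).source) (ξ : V) :
    chartRight V G (chartAt V (1 : G) g) (Ad g ξ) = chartLeft V G (chartAt V (1 : G) g) ξ := by
  have h1 := mul_right_comp_Ad (V := V) g
  unfold chartRight chartLeft
  rw [fderiv_chartMul_inl hg, fderiv_chartMul_inr hg, ← h1]
  rfl

theorem chartRight_one : chartRight V G (chartOne V G) = ContinuousLinearMap.id ℝ V := by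
  unfold chartRight chartOne
  have h := fderiv_chartMul_inl (mem_chart_source V (1 : G))
  unfold chartOne at h
  rw [h, (hasD_chartAt_self (1 : G)).eq]
  have : HasD (fun h : G ↦ h * 1) 1 (ContinuousLinearMap.id ℝ V) :=
    (hasD_id (1 : G)).congr (Eventually.of_forall fun h ↦ mul_one h)
  rw [this.eq]
  rfl

theorem chartLeft_one : chartLeft V G (chartOne V G) = ContinuousLinearMap.id ℝ V := by
  unfold chartLeft chartOne
  have h := fderiv_chartMul_inr (mem_chart_source V (1 : G))
  unfold chartOne at h
  rw [h, (hasD_chartAt_self (1 : G)).eq]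
  have : HasD (fun h : G ↦ 1 * h) 1 (ContinuousLinearMap.id ℝ V) :=
    (hasD_id (1 : G)).congr (Eventually.of_forall fun h ↦ one_mul h)
  rw [this.eq]
  rfl

theorem chartMul_contDiffAt_one : ContDiffAt ℝ ∞ (chartMul V G) (chartOne V G, chartOne V G) :=
  chartMul_contDiffAt chartOne_mem chartOne_mem (by
    simp only [chartAt_symm_chartOne, mul_one]
    exact mem_chart_source V 1)

variable (V G) in
/-- The second derivative of `chartMul` at the identity. -/
noncomputable def chartMul₂ : V × V →L[ℝ] V × V →L[ℝ] V :=
  fderiv ℝ (fderiv ℝ (chartMul V G)) (chartOne V G, chartOne V G)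

theorem hasFDerivAt_fderiv_chartMul : HasFDerivAt (fderiv ℝ (chartMul V G)) (chartMul₂ V G)
    (chartOne V G, chartOne V G) :=
  ((chartMul_contDiffAt_one.fderiv_right (m := 1)
    (by exact WithTop.coe_le_coe.2 le_top)).differentiableAt (by simp)).hasFDerivAt

theorem chartMul₂_symm (u w : V × V) : chartMul₂ V G u w = chartMul₂ V G w u :=
  chartMul_contDiffAt_one.isSymmSndFDerivAt two_le_infty u w

theorem hasFDerivAt_chartLeft (ξ : V) : HasFDerivAt (fun a ↦ chartLeft V G a ξ)
    (((chartMul₂ V G).flip (0, ξ)).comp (ContinuousLinearMap.inl ℝ V V)) (chartOne V G) := by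
  have h := hasFDerivAt_fderiv_chartMul.comp (f := fun e : V ↦ (e, chartOne V G)) (chartOne V G)
    (hasFDerivAt_prodMk_left (𝕜 := ℝ) (chartOne V G) (chartOne V G))
  exact (h.clm_apply (hasFDerivAt_const ((0, ξ) : V × V) _)).congr_fderiv (by ext; simp)

theorem hasFDerivAt_chartRight : HasFDerivAt (chartRight V G)
    (((ContinuousLinearMap.compL ℝ V (V × V) V).flip (ContinuousLinearMap.inl ℝ V V)).comp
      ((chartMul₂ V G).comp (ContinuousLinearMap.inr ℝ V V))) (chartOne V G) := by
  have h := hasFDerivAt_fderiv_chartMul.comp (f := fun e : V ↦ (chartOne V G, e)) (chartOne V G)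
    (hasFDerivAt_prodMk_right (𝕜 := ℝ) (chartOne V G) (chartOne V G))
  exact (((ContinuousLinearMap.compL ℝ V (V × V) V).flip
    (ContinuousLinearMap.inl ℝ V V)).hasFDerivAt).comp (chartOne V G) h

variable (G) in
/-- A left-invariant vector field in the preferred chart at the identity. -/
noncomputable def chartInvariantField (ζ : V) : V → V :=
  VectorField.mpullbackWithin 𝓘(ℝ, V) 𝓘(ℝ, V) (extChartAt 𝓘(ℝ, V) (1 : G)).symm
    (mulInvariantVectorField (ζ : GroupLieAlgebra 𝓘(ℝ, V) G)) univ

/-- A left-invariant field is the derivative of left translation, which in the chart is the partial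
derivative of the multiplication in its second variable at the identity. -/
theorem chartInvariantField_eventuallyEq (ζ : V) :
    chartInvariantField G ζ =ᶠ[𝓝 (chartOne V G)] fun a ↦ chartLeft V G a ζ := by
  set c := chartAt V (1 : G) with hc
  filter_upwards [c.open_target.mem_nhds chartOne_mem] with a ha
  obtain ⟨L, hL1, hL2⟩ := exists_equiv_hasD_chartAt_symm (1 : G) ha
  have h1 : chartInvariantField G ζ a = ContinuousLinearMap.inverse (D V V c.symm a)
      (D V V (fun h : G ↦ c.symm a * h) 1 ζ) := by
    simp only [chartInvariantField, VectorField.mpullbackWithin_apply, mfderivWithin_univ,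
      extChartAt, OpenPartialHomeomorph.extend, modelWithCornersSelf_partialEquiv]
    rfl
  have h2 := DFunLike.congr_fun (fderiv_chartMul_inr (c.map_target ha)) ζ
  rw [c.right_inv ha, hL2.eq] at h2
  rw [h1, hL1.eq, ContinuousLinearMap.inverse_equiv]
  exact h2.symm

/-- The bracket of invariant fields is computed in the preferred chart at `1`. The derivative of
this chart at `1` is the identity, so no correction factor remains. -/
theorem bracket_eq_lieBracket (η ξ : GroupLieAlgebra 𝓘(ℝ, V) G) :
    (⁅η, ξ⁆ : GroupLieAlgebra 𝓘(ℝ, V) G) = (VectorField.lieBracket ℝ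
      (chartInvariantField G η) (chartInvariantField G ξ) (chartOne V G) : V) := by
  have h0 : D V V (extChartAt 𝓘(ℝ, V) (1 : G)) 1 = ContinuousLinearMap.id ℝ V :=
    (hasD_chartAt_self (1 : G)).eq
  have h1 : (⁅η, ξ⁆ : GroupLieAlgebra 𝓘(ℝ, V) G) =
      ContinuousLinearMap.inverse (D V V (extChartAt 𝓘(ℝ, V) (1 : G)) 1)
      (VectorField.lieBracketWithin ℝ
      (chartInvariantField G η) (chartInvariantField G ξ) univ (chartOne V G)) := by
    rw [GroupLieAlgebra.bracket_def, VectorField.mlieBracket, VectorField.mlieBracketWithin_apply]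
    simp only [modelWithCornersSelf_coe, range_id, preimage_univ, univ_inter]
    rfl
  rw [h1, h0, ContinuousLinearMap.inverse_id, VectorField.lieBracketWithin_univ]
  rfl

variable (G) in
/-- The bracket of the Lie algebra of `G`, on the model space of `G`. -/
noncomputable def groupBracket (η ξ : GroupLieAlgebra 𝓘(ℝ, V) G) : V :=
  (⁅η, ξ⁆ : GroupLieAlgebra 𝓘(ℝ, V) G)

/-- Invariant fields are first derivatives of the multiplication, so their bracket is a difference
of two mixed second derivatives. -/
theorem bracket_eq_chartMul₂ (η ξ : V) :
    groupBracket G η ξ =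
      (chartMul₂ V G (η, 0) (0, ξ) - chartMul₂ V G (ξ, 0) (0, η) : V) := by
  refine (bracket_eq_lieBracket (G := G) η ξ).trans ?_
  rw [Filter.EventuallyEq.lieBracket_vectorField_eq
    (chartInvariantField_eventuallyEq η) (chartInvariantField_eventuallyEq ξ),
    VectorField.lieBracket, (hasFDerivAt_chartLeft (G := G) η).fderiv,
    (hasFDerivAt_chartLeft (G := G) ξ).fderiv, chartLeft_one]
  rfl

/-- The derivative of the adjoint representation is the Lie bracket. -/
theorem hasD_Ad_apply [CompleteSpace V] (ξ : V) :
    ∃ B : V →L[ℝ] V, HasD (fun g : G ↦ (Ad g ξ : V)) 1 B ∧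
      ∀ η : V, B η = groupBracket G η ξ := by
  set c := chartAt V (1 : G) with hc
  -- This is `Ad g ξ` in the chart, solved from `chartRight_Ad`; in this form it is visibly
  -- differentiable.
  set b : V → V := fun a ↦ (chartRight V G a).inverse (chartLeft V G a ξ) with hb
  have hinv : ContDiffAt ℝ ∞ ContinuousLinearMap.inverse (chartRight V G (chartOne V G)) := by
    rw [chartRight_one]
    exact contDiffAt_map_inverse (ContinuousLinearEquiv.refl ℝ V)
  have hbd : DifferentiableAt ℝ b (chartOne V G) :=
    ((hinv.differentiableAt (by simp)).comp _ hasFDerivAt_chartRight.differentiableAt).clm_apply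
      (hasFDerivAt_chartLeft ξ).differentiableAt
  have hunit : ∀ᶠ a in 𝓝 (chartOne V G),
      chartRight V G a ∈ range ((↑) : (V ≃L[ℝ] V) → V →L[ℝ] V) :=
    hasFDerivAt_chartRight.continuousAt.eventually (ContinuousLinearEquiv.isOpen.mem_nhds
      ⟨ContinuousLinearEquiv.refl ℝ V, by rw [chartRight_one]; rfl⟩)
  have hRb : (fun a ↦ chartRight V G a (b a)) =ᶠ[𝓝 (chartOne V G)]
      fun a ↦ chartLeft V G a ξ := by
    filter_upwards [hunit] with a ⟨L, hL⟩
    simp only [hb, ← hL, ContinuousLinearMap.inverse_equiv]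
    exact L.apply_symm_apply _
  have hAd : (fun g : G ↦ (Ad g ξ : V)) =ᶠ[𝓝 1] b ∘ c := by
    have h1 := (c.continuousAt (mem_chart_source V (1 : G))).eventually hunit
    filter_upwards [h1, c.open_source.mem_nhds (mem_chart_source V (1 : G))] with g ⟨L, hL⟩ hg
    have h2 := chartRight_Ad hg ξ
    simp only [hb, Function.comp_apply]
    rw [← hL] at h2
    rw [← hL, ContinuousLinearMap.inverse_equiv, ← h2]
    exact (L.symm_apply_apply _).symm
  have hb1 : b (chartOne V G) = ξ := by
    simp only [hb, chartRight_one, chartLeft_one, ContinuousLinearMap.inverse_id]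
    rfl
  refine ⟨fderiv ℝ b (chartOne V G), ?_, ?_⟩
  · have h1 := ((hasD_iff_hasFDerivAt.2 hbd.hasFDerivAt).comp (hasD_chartAt_self (1 : G)) rfl)
    exact h1.congr hAd
  · intro η
    -- Differentiate `chartRight a (b a) = chartLeft a ξ` at the identity. Symmetry of the second
    -- derivative turns the result into the formula for the bracket.
    have h1 := hasFDerivAt_chartRight.clm_apply hbd.hasFDerivAt
    have h2 := h1.unique ((hasFDerivAt_chartLeft ξ).congr_of_eventuallyEq hRb)
    have h3 := DFunLike.congr_fun h2 η
    rw [hb1, chartRight_one] at h3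
    have h4 : fderiv ℝ b (chartOne V G) η + chartMul₂ V G (0, η) (ξ, 0) =
      chartMul₂ V G (η, 0) (0, ξ) := h3
    rw [bracket_eq_chartMul₂, ← h4, chartMul₂_symm (0, η)]
    abel

end LieBracket


/-! ### Functions on connected manifolds; forms at a point -/

/-- A real function with vanishing derivative on a connected manifold is constant. -/
theorem eq_of_forall_hasD_zero {V : Type*} [NormedAddCommGroup V] [NormedSpace ℝ V]
    {P : Type*} [TopologicalSpace P] [ChartedSpace V P] [IsManifold 𝓘(ℝ, V) ∞ P]
    [PreconnectedSpace P] {φ : P → ℝ} (h : ∀ p, HasD φ p (0 : V →L[ℝ] ℝ)) (p q : P) : φ p = φ q := by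
  have h1 : IsLocallyConstant φ := by
    rw [IsLocallyConstant.iff_eventually_eq]
    intro p
    set c := chartAt V p
    obtain ⟨r, hr, hrc⟩ := Metric.isOpen_iff.1 c.open_target (c p) (c.map_source (mem_chart_source V p))
    have h2 : ∀ v ∈ Metric.ball (c p) r, HasFDerivAt (φ ∘ c.symm) (0 : V →L[ℝ] ℝ) v := by
      intro v hv
      have h3 := (h (c.symm v)).comp
        (hasD_of_contMDiffOn (chartAt_symm_contMDiffOn p) c.open_target (hrc hv)) rfl
      rw [ContinuousLinearMap.zero_comp] at h3
      exact hasD_iff_hasFDerivAt.1 h3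
    have h4 := (c.continuousAt (mem_chart_source V p)).eventually (Metric.ball_mem_nhds (c p) hr)
    filter_upwards [h4, c.open_source.mem_nhds (mem_chart_source V p)] with y hy hyc
    have h5 := (convex_ball (c p) r).is_const_of_fderivWithin_eq_zero (𝕜 := ℝ) (f := φ ∘ c.symm)
      (fun v hv ↦ (h2 v hv).differentiableAt.differentiableWithinAt)
      (fun v hv ↦ ((h2 v hv).hasFDerivWithinAt.fderivWithin
        (Metric.isOpen_ball.uniqueDiffWithinAt hv))) hy (Metric.mem_ball_self hr)
    simpa only [Function.comp_apply, c.left_inv hyc, c.left_inv (mem_chart_source V p)] using h5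
  exact h1.apply_eq_of_preconnectedSpace p q

section BilAt

variable {E : Type*} [NormedAddCommGroup E] [NormedSpace ℝ E]
  {M : Type*} [TopologicalSpace M] [ChartedSpace E M] (Ω : TwoForm E M)

/-- A two-form at a point, as a bilinear form on the model space. -/
noncomputable def bilAt (x : M) : E →ₗ[ℝ] E →ₗ[ℝ] ℝ := bil (E := E) (Ω x)

/-- The kernel of a two-form at a point, as a subspace of the model space. -/
noncomputable def kerAt (x : M) : Submodule ℝ E := LinearMap.ker (bilAt Ω x)

theorem bilAt_swap (x : M) (u w : E) : bilAt Ω x u w = -bilAt Ω x w u := bil_swap _ _ _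

theorem kerAt_eq (x : M) : kerAt Ω x = ker Ω x := by
  ext v
  exact mem_ker_iff.symm

theorem bilAt_pullback {E' : Type*} [NormedAddCommGroup E'] [NormedSpace ℝ E']
    {M' : Type*} [TopologicalSpace M'] [ChartedSpace E' M'] (f : M' → M) (x : M') (u w : E') :
    bilAt (pullback f Ω) x u w = bilAt Ω (f x) (D E' E f x u) (D E' E f x w) :=
  pullback_apply f Ω x u w

end BilAt

/-! ### Equivariance of the momentum map -/

section MomentumMap

variable {E : Type*} [NormedAddCommGroup E] [NormedSpace ℝ E]
  {M : Type*} [TopologicalSpace M] [ChartedSpace E M]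
  {V : Type*} [NormedAddCommGroup V] [NormedSpace ℝ V]
  {G : Type*} [TopologicalSpace G] [ChartedSpace V G] [Group G] [MulAction G M]
  {Ω : TwoForm E M} {J : M → LieDual V}

/-- The defining equation of J read as a formula for its derivative: the kernel of TJ is the
Ω-orthogonal of the tangent space of the orbit. -/
theorem D_momentumMap (hJ : IsPoissonianMomentumMap G Ω J) (x : M) (u : E) (ξ : V) :
    D E (LieDual V) J x u ξ = bilAt Ω x (orbitD E V G x ξ) u := by
  have h1 := hJ.hamiltonian ξ x u
  have h2 : HasD (fun φ : LieDual V ↦ φ ξ) (J x) (ContinuousLinearMap.apply ℝ ℝ ξ) :=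
    hasD_iff_hasFDerivAt.2 (ContinuousLinearMap.apply ℝ ℝ ξ).hasFDerivAt
  have h3 := h2.comp (hasD_of_contMDiffAt (hJ.smooth.contMDiffAt (x := x))) rfl
  have h4 : D E ℝ (fun y ↦ J y ξ) x u = D E (LieDual V) J x u ξ := by
    have h5 := h3.eq
    exact DFunLike.congr_fun h5 u
  rw [← h4]
  exact h1.symm

theorem momentumMap_bracket (hJ : IsPoissonianMomentumMap G Ω J) (x : M) (ξ η : V) :
    J x (groupBracket G ξ η) = bilAt Ω x (orbitD E V G x ξ) (orbitD E V G x η) :=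
  hJ.bracket ξ η x

variable [LieGroup 𝓘(ℝ, V) ∞ G] [ContMDiffSMul 𝓘(ℝ, V) 𝓘(ℝ, E) ∞ G M] [FiniteDimensional ℝ V]

/-- By the product rule the derivative along η is Ω(ξ̃, η̃) + J([η, ξ]). The bracket condition makes
the second term Ω(η̃, ξ̃), and the sum vanishes. -/
theorem hasD_momentumMap_smul (hJ : IsPoissonianMomentumMap G Ω J) (x : M) (ξ : V) :
    HasD (fun g : G ↦ J (g • x) (Ad g ξ)) 1 (0 : V →L[ℝ] ℝ) := by
  have hc : CompleteSpace V := FiniteDimensional.complete ℝ V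
  set c := chartAt V (1 : G)
  have h1c : c.symm (c 1) = 1 := c.left_inv (mem_chart_source V 1)
  obtain ⟨B, hB, hB'⟩ := hasD_Ad_apply (G := G) ξ
  have h1 := ((hasD_of_contMDiffAt (hJ.smooth.contMDiffAt (x := x))).comp
    (hasD_orbit E V x (1 : G)) (one_smul G x)).comp (hasD_chartAt_symm_self (1 : G)) h1c
  have h2 := hB.comp (hasD_chartAt_symm_self (1 : G)) h1c
  have h3 := (hasD_iff_hasFDerivAt.1 h1).clm_apply (hasD_iff_hasFDerivAt.1 h2)
  have h4 := (hasD_iff_hasFDerivAt.2 h3).comp (hasD_chartAt_self (1 : G)) rfl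
  have h6 : (fun g : G ↦ J (g • x) (Ad g ξ)) =ᶠ[𝓝 1] fun g ↦
      J (c.symm (c g) • x) (Ad (c.symm (c g)) ξ) := by
    filter_upwards [c.open_source.mem_nhds (mem_chart_source V (1 : G))] with g hg
    rw [c.left_inv hg]
  have h7 := h4.congr h6
  convert h7 using 1
  ext η
  have h5 : (0 : ℝ) = J (c.symm (c 1) • x) (B η) +
      D E (LieDual V) J x (orbitD E V G x η) (Ad (c.symm (c 1)) ξ) := by
    rw [h1c, one_smul, Ad_one, D_momentumMap hJ, hB', momentumMap_bracket hJ, bilAt_swap,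
      ContinuousLinearMap.id_apply, neg_add_cancel]
  exact h5

/-- Equivariance of the momentum map of a Poissonian action. -/
theorem momentumMap_smul_Ad [ConnectedSpace G] (hJ : IsPoissonianMomentumMap G Ω J) (g : G) (x : M)
    (ξ : V) : J (g • x) (Ad g ξ) = J x ξ := by
  have : IsManifold 𝓘(ℝ, V) ∞ G := inferInstance
  have h1 := eq_of_forall_hasD_zero (φ := fun g : G ↦ J (g • x) (Ad g ξ)) (V := V) (fun g ↦ by
    -- The derivative at `g` is the one at `1` for the point `g • x` and the vector `Ad g ξ`, after
    -- right translation.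
    have h2 := hasD_momentumMap_smul hJ (g • x) (Ad g ξ)
    have h3 := h2.comp (hasD_mul_right V g⁻¹ g) (mul_inv_cancel g)
    rw [ContinuousLinearMap.zero_comp] at h3
    refine h3.congr (Eventually.of_forall fun h ↦ ?_)
    have h4 : Ad h ξ = Ad (h * g⁻¹) (Ad g ξ : V) := by
      rw [← ContinuousLinearMap.comp_apply, ← Ad_mul, inv_mul_cancel_right]
    simp only [Function.comp_apply, ← mul_smul, inv_mul_cancel_right, h4]) g 1
  simpa only [one_smul, Ad_one, ContinuousLinearMap.id_apply] using h1

theorem momentumMap_smul [ConnectedSpace G] (hJ : IsPoissonianMomentumMap G Ω J) (g : G) (x : M) :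
    J (g • x) = (J x).comp (Ad g⁻¹ : V →L[ℝ] V) := by
  ext ξ
  have h := momentumMap_smul_Ad hJ g x (Ad g⁻¹ ξ)
  have h1 : (Ad g : V →L[ℝ] V) (Ad g⁻¹ ξ) = ξ := by
    rw [← ContinuousLinearMap.comp_apply, ← Ad_mul, mul_inv_cancel, Ad_one]
    rfl
  rwa [h1] at h

theorem momentumMap_smul_eq_iff [ConnectedSpace G] (hJ : IsPoissonianMomentumMap G Ω J)
    {μ : LieDual V} {x : M} (hx : J x = μ) (g : G) : J (g • x) = μ ↔ g ∈ isotropy G μ := by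
  rw [momentumMap_smul hJ, hx]
  exact DFunLike.ext_iff

end MomentumMap

/-! ### The level set and the kernel of the induced form -/

/-- The kernel of `Ω` is contained in the tangent spaces of the orbits. -/
theorem ker_le_range_orbitD {E : Type*} [NormedAddCommGroup E] [NormedSpace ℝ E]
    [FiniteDimensional ℝ E] {M : Type*} [TopologicalSpace M] [T2Space M] [ChartedSpace E M]
    [IsManifold 𝓘(ℝ, E) ∞ M] {V : Type*} [NormedAddCommGroup V] [NormedSpace ℝ V]
    {G : Type*} [TopologicalSpace G] [ChartedSpace V G] [Group G] [MulAction G M]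
    {Ω : TwoForm E M} (hΩ : IsPresymplectic Ω) (hker : KerGeneratedByAction V G Ω) {x : M} {v : E}
    (hv : v ∈ kerAt Ω x) : v ∈ LinearMap.range (orbitD E V G x : V →ₗ[ℝ] E) := by
  rw [kerAt_eq] at hv
  -- The hypothesis on the kernel concerns global fields, so the vector is first extended to one.
  obtain ⟨Z, hZ1, hZ2, hZ3⟩ := exists_smooth_section_ker hΩ x hv
  obtain ⟨n, f, ξ, -, h⟩ := hker Z hZ1 hZ2
  rw [← hZ3, h x]
  exact Submodule.sum_mem _ fun i _ ↦ Submodule.smul_mem _ _ ⟨ξ i, rfl⟩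

section LevelSet

variable {E : Type*} [NormedAddCommGroup E] [NormedSpace ℝ E]
  {M : Type*} [TopologicalSpace M] [ChartedSpace E M]
  {V : Type*} [NormedAddCommGroup V] [NormedSpace ℝ V]
  {J : M → LieDual V} {μ : LieDual V}
  {F : Type*} [NormedAddCommGroup F] [NormedSpace ℝ F] [ChartedSpace F (LevelSet J μ)]
  [IsManifold 𝓘(ℝ, F) ∞ (LevelSet J μ)]

theorem contMDiff_levelIncl (hμ : IsWeaklyRegularValue (E := E) J μ (F := F)) :
    ContMDiff 𝓘(ℝ, F) 𝓘(ℝ, E) ∞ (levelIncl J μ) := hμ.embedding.isImmersion.contMDiff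

theorem hasD_levelIncl (hμ : IsWeaklyRegularValue (E := E) J μ (F := F)) (x : LevelSet J μ) :
    HasD (levelIncl J μ) x (D F E (levelIncl J μ) x) :=
  hasD_of_contMDiffAt (contMDiff_levelIncl hμ).contMDiffAt

theorem exists_D_levelIncl_iff (hμ : IsWeaklyRegularValue (E := E) J μ (F := F))
    (x : LevelSet J μ) (v : E) :
    (∃ u : F, D F E (levelIncl J μ) x u = v) ↔ D E (LieDual V) J (levelIncl J μ x) v = 0 :=
  hμ.tangent x v

/-- A smooth map with values in the level set is smooth into the level set. -/
theorem contMDiff_of_levelIncl_comp (hμ : IsWeaklyRegularValue (E := E) J μ (F := F))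
    {W : Type*} [NormedAddCommGroup W] [NormedSpace ℝ W] {P : Type*} [TopologicalSpace P]
    [ChartedSpace W P] {f : P → LevelSet J μ}
    (hf : ContMDiff 𝓘(ℝ, W) 𝓘(ℝ, E) ∞ (levelIncl J μ ∘ f)) : ContMDiff 𝓘(ℝ, W) 𝓘(ℝ, F) ∞ f :=
  (ContMDiff.iff_comp_isImmersion hμ.embedding.isImmersion).2
    ⟨hμ.embedding.isEmbedding.continuous_iff.2 hf.continuous, hf⟩

variable [IsManifold 𝓘(ℝ, E) ∞ M]

theorem injective_D_levelIncl (hμ : IsWeaklyRegularValue (E := E) J μ (F := F))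
    (x : LevelSet J μ) : Function.Injective (D F E (levelIncl J μ) x) :=
  injective_of_isImmersionAt (hμ.embedding.isImmersion.isImmersionAt x)

variable {G : Type*} [TopologicalSpace G] [ChartedSpace V G] [Group G] [MulAction G M]
  {Ω : TwoForm E M} [FiniteDimensional ℝ E] [T2Space M]

/-- The kernel of the form induced on a level set consists of the tangent vectors to the orbits. -/
theorem mem_ker_pullback_levelIncl_iff (hΩ : IsPresymplectic Ω) (hker : KerGeneratedByAction V G Ω)
    (hJ : IsPoissonianMomentumMap G Ω J) (hμ : IsWeaklyRegularValue (E := E) J μ (F := F))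
    (x : LevelSet J μ) (u : F) : u ∈ kerAt (pullback (levelIncl J μ) Ω) x ↔
      D F E (levelIncl J μ) x u ∈ LinearMap.range (orbitD E V G (levelIncl J μ x) : V →ₗ[ℝ] E) := by
  set y := levelIncl J μ x
  set A : V →ₗ[ℝ] E := (orbitD E V G y : V →ₗ[ℝ] E)
  set d := D F E (levelIncl J μ) x
  have hd : ∀ w : E, (∃ u : F, d u = w) ↔ ∀ ξ : V, bilAt Ω y (A ξ) w = 0 := by
    intro w
    rw [exists_D_levelIncl_iff hμ, ContinuousLinearMap.ext_iff]
    exact forall_congr' fun ξ ↦ by rw [D_momentumMap hJ]; rfl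
  have hu : u ∈ kerAt (pullback (levelIncl J μ) Ω) x ↔ ∀ w : F, bilAt Ω y (d u) (d w) = 0 := by
    rw [kerAt, LinearMap.mem_ker, LinearMap.ext_iff]
    refine forall_congr' fun w ↦ ?_
    rw [bilAt_pullback]
    rfl
  rw [hu]
  constructor
  · intro h
    -- The vectors tangent to the level set form the coannihilator of `{i(ξ̃)Ω}`. In finite
    -- dimension a covector vanishing on it is itself some `i(ξ̃)Ω`.
    have h1 : bilAt Ω y (d u) ∈ ((LinearMap.range A).map (bilAt Ω y)).dualCoannihilator.dualAnnihilator := by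
      rw [Submodule.mem_dualAnnihilator]
      intro w hw
      rw [Submodule.mem_dualCoannihilator] at hw
      obtain ⟨u', rfl⟩ := (hd w).2 fun ξ ↦ hw _ ⟨A ξ, ⟨ξ, rfl⟩, rfl⟩
      exact h u'
    rw [Subspace.dualCoannihilator_dualAnnihilator_eq] at h1
    obtain ⟨-, ⟨ξ, rfl⟩, h2⟩ := h1
    have h3 : d u - A ξ ∈ kerAt Ω y := by
      rw [kerAt, LinearMap.mem_ker, map_sub, h2, sub_self]
    have h4 := ker_le_range_orbitD hΩ hker h3
    have h5 := Submodule.add_mem _ h4 (⟨ξ, rfl⟩ : A ξ ∈ LinearMap.range A)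
    rwa [sub_add_cancel] at h5
  · rintro ⟨ξ, hξ⟩ w
    rw [← hξ]
    exact (hd (d w)).1 ⟨w, rfl⟩ ξ

/-- Through the injective maps `u ↦ Tj u` and `ξ ↦ ξ̃`, the kernel at each point is identified with
that of `ξ ↦ μ([·, ξ])`, which involves only `μ`. -/
theorem finrank_ker_pullback_levelIncl [LieGroup 𝓘(ℝ, V) ∞ G]
    [FiniteDimensional ℝ V] [ContMDiffSMul 𝓘(ℝ, V) 𝓘(ℝ, E) ∞ G M]
    (hfree : ∀ (g : G) (x : M), g • x = x → g = 1)
    (hΩ : IsPresymplectic Ω) (hker : KerGeneratedByAction V G Ω)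
    (hJ : IsPoissonianMomentumMap G Ω J) (hμ : IsWeaklyRegularValue (E := E) J μ (F := F))
    (x y : LevelSet J μ) : Module.finrank ℝ (kerAt (E := F) (pullback (levelIncl J μ) Ω) x) =
      Module.finrank ℝ (kerAt (E := F) (pullback (levelIncl J μ) Ω) y) := by
  have h1 : ∀ z : LevelSet J μ, Module.finrank ℝ (kerAt (E := F) (pullback (levelIncl J μ) Ω) z) =
      Module.finrank ℝ (LinearMap.ker (((D E (LieDual V) J z).comp (orbitD E V G (z : M)) :
        V →L[ℝ] LieDual V) : V →ₗ[ℝ] LieDual V)) := by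
    intro z
    have h2 := LinearEquiv.finrank_eq (Submodule.equivMapOfInjective _
      (injective_D_levelIncl hμ z : Function.Injective (D F E (levelIncl J μ) z : F →ₗ[ℝ] E))
      (kerAt (pullback (levelIncl J μ) Ω) z))
    have h3 := LinearEquiv.finrank_eq (Submodule.equivMapOfInjective _
      (injective_orbitD (V := V) (E := E) hfree (z : M) : Function.Injective
        (orbitD E V G (z : M) : V →ₗ[ℝ] E)) (LinearMap.ker (((D E (LieDual V) J z).comp
          (orbitD E V G (z : M)) : V →L[ℝ] LieDual V) : V →ₗ[ℝ] LieDual V)))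
    refine h2.trans (Eq.trans ?_ h3.symm)
    refine congrArg (fun S : Submodule ℝ E ↦ Module.finrank ℝ S) ?_
    ext v
    constructor
    · rintro ⟨u, hu, rfl⟩
      obtain ⟨ξ, hξ⟩ := (mem_ker_pullback_levelIncl_iff hΩ hker hJ hμ z u).1 hu
      refine ⟨ξ, ?_, hξ⟩
      change D E (LieDual V) J z (orbitD E V G (z : M) ξ) = 0
      exact (exists_D_levelIncl_iff hμ z _).1 ⟨u, hξ.symm⟩
    · rintro ⟨ξ, hξ, rfl⟩
      obtain ⟨u, hu⟩ := (exists_D_levelIncl_iff hμ z _).2 hξ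
      exact ⟨u, (mem_ker_pullback_levelIncl_iff hΩ hker hJ hμ z u).2 ⟨ξ, hu.symm⟩, hu⟩
  have h2 : ∀ (z : LevelSet J μ) (ξ η : V),
      D E (LieDual V) J z (orbitD E V G (z : M) ξ) η = μ (groupBracket G η ξ) := by
    intro z ξ η
    rw [D_momentumMap hJ, ← momentumMap_bracket hJ, z.2]
  rw [h1, h1]
  refine congrArg (fun S : Submodule ℝ V ↦ Module.finrank ℝ S) ?_
  refine congrArg LinearMap.ker ?_
  ext ξ η
  exact (h2 x ξ η).trans (h2 y ξ η).symm

end LevelSet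


/-! ### The leaves are the orbits of the identity component of G_μ -/

section Leaves

variable {F : Type*} [NormedAddCommGroup F] [NormedSpace ℝ F]
  {N : Type*} [TopologicalSpace N] [ChartedSpace F N] {Θ : TwoForm F N}

/-- A smooth curve tangent to the distribution stays in a leaf. -/
theorem leafProj_eq_of_tangent {γ : ℝ → N} (hγ : ContMDiff 𝓘(ℝ, ℝ) 𝓘(ℝ, F) ∞ γ)
    (h : ∀ t, D ℝ F γ t 1 ∈ kerAt Θ (γ t)) (t : ℝ) :
    leafProj (ker Θ) (γ t) = leafProj (ker Θ) (γ 0) := by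
  -- The leaf relation uses curves ending at time 1, hence the rescaling of time by `t`; it also
  -- covers `t = 0`.
  refine (Quotient.sound (s := leafSetoid (ker Θ)) (.rel _ _ ⟨fun s ↦ γ (t * s), ?_, ?_, ?_, ?_⟩)).symm
  · exact hγ.comp (contDiff_const.mul contDiff_id).contMDiff
  · intro s
    have h1 : HasD (fun s : ℝ ↦ t * s) s (ContinuousLinearMap.toSpanSingleton ℝ t) :=
      hasD_iff_hasFDerivAt.2 (by
        have := ((hasDerivAt_id s).const_mul t).hasFDerivAt
        simpa using this)
    have h2 := (hasD_of_contMDiffAt (hγ.contMDiffAt (x := t * s))).comp h1 rfl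
    have h3 : D ℝ F (fun s ↦ γ (t * s)) s 1 = t • D ℝ F γ (t * s) 1 := by
      have h4 : D ℝ F (fun s ↦ γ (t * s)) s = _ := h2.eq
      rw [h4, ← map_smul]
      simp
    have h5 := Submodule.smul_mem _ t (h (t * s))
    rw [← h3, kerAt_eq] at h5
    exact h5
  · simp
  · simp

end Leaves

section Orbits

variable {E : Type*} [NormedAddCommGroup E] [NormedSpace ℝ E]
  {M : Type*} [TopologicalSpace M] [ChartedSpace E M]
  {V : Type*} [NormedAddCommGroup V] [NormedSpace ℝ V] [FiniteDimensional ℝ V]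
  {J : M → LieDual V} {μ : LieDual V}
  {G : Type*} [TopologicalSpace G] [ChartedSpace V G] [Group G] [LieGroup 𝓘(ℝ, V) ∞ G]
  [ConnectedSpace G] [MulAction G M] [ContMDiffSMul 𝓘(ℝ, V) 𝓘(ℝ, E) ∞ G M]
  {Ω : TwoForm E M}

/-- The momentum map has constant rank along the orbits. -/
theorem finrank_ker_D_momentumMap_orbit (hJ : IsPoissonianMomentumMap G Ω J) (x : M) (g : G) :
    Module.finrank ℝ (LinearMap.ker (D V (LieDual V) (fun g : G ↦ J (g • x)) g :
      V →ₗ[ℝ] LieDual V)) =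
    Module.finrank ℝ (LinearMap.ker (D V (LieDual V) (fun g : G ↦ J (g • x)) 1 :
      V →ₗ[ℝ] LieDual V)) := by
  have hs : ∀ a : G, ContMDiff 𝓘(ℝ, LieDual V) 𝓘(ℝ, LieDual V) ∞
      (fun φ : LieDual V ↦ φ.comp (Ad a : V →L[ℝ] V)) := fun a ↦
    (((ContinuousLinearMap.compL ℝ V V ℝ).flip (Ad a)).contDiff).contMDiff
  have hi : ∀ (a b : G), a * b = 1 → ∀ φ : LieDual V,
      (φ.comp (Ad a : V →L[ℝ] V)).comp (Ad b : V →L[ℝ] V) = φ := by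
    intro a b hab φ
    rw [ContinuousLinearMap.comp_assoc, ← Ad_mul, hab, Ad_one, ContinuousLinearMap.comp_id]
  obtain ⟨L, hL⟩ := exists_equiv_hasD_of_inverse (hs g⁻¹) (hs g) (hi _ _ (inv_mul_cancel g))
    (hi _ _ (mul_inv_cancel g)) (J ((1 : G) • x))
  exact finrank_ker_eq_of_equivariant (hJ.smooth.comp (contMDiff_orbit E V x)) g hL fun h ↦ by
    change J ((g * h) • x) = _
    rw [mul_smul, momentumMap_smul hJ]
    rfl

variable {F : Type*} [NormedAddCommGroup F] [NormedSpace ℝ F] [ChartedSpace F (LevelSet J μ)]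
  [IsManifold 𝓘(ℝ, F) ∞ (LevelSet J μ)] [IsManifold 𝓘(ℝ, E) ∞ M] [FiniteDimensional ℝ E]
  [T2Space M]

/-- Curves in a level set along the orbit of a point. -/
theorem exists_curves_in_level_orbit
    (hΩ : IsPresymplectic Ω) (hker : KerGeneratedByAction V G Ω)
    (hJ : IsPoissonianMomentumMap G Ω J) (hμ : IsWeaklyRegularValue (E := E) J μ (F := F))
    (x : LevelSet J μ) {K : Submodule ℝ V}
    (hK : K = LinearMap.ker (D V (LieDual V) (fun g : G ↦ J (g • (x : M))) 1 :
      V →ₗ[ℝ] LieDual V)) :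
    ∃ (r : ℝ) (ψ : K → G), 0 < r ∧ (∀ᶠ g in 𝓝 (1 : G), g ∈ isotropy G μ →
        ∃ k ∈ Metric.ball (0 : K) r, ψ k = g) ∧
      ∀ k ∈ Metric.ball (0 : K) r, ∃ γ : ℝ → LevelSet J μ, ContMDiff 𝓘(ℝ, ℝ) 𝓘(ℝ, F) ∞ γ ∧
        (∀ t, D ℝ F γ t 1 ∈ kerAt (pullback (levelIncl J μ) Ω) (γ t)) ∧ γ 0 = x ∧
        (γ 1 : M) = ψ k • (x : M) ∧ ∃ c : ℝ, c ≠ 0 ∧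
          D F E (levelIncl J μ) x (D ℝ F γ 0 1) = c • orbitD E V G (x : M) k := by
  have hf : ContMDiff 𝓘(ℝ, V) 𝓘(ℝ, LieDual V) ∞ (fun g : G ↦ J (g • (x : M))) :=
    hJ.smooth.comp (contMDiff_orbit E V (x : M))
  have hx1 : J ((1 : G) • (x : M)) = μ := by rw [one_smul]; exact x.2
  obtain ⟨r, ψ, hr, hψ, hψ0, hψd, hψf, hψs⟩ := exists_fibre_parametrization hf (1 : G)
    (finrank_ker_D_momentumMap_orbit hJ (x : M)) hK
  refine ⟨r, ψ, hr, ?_, fun k hk ↦ ?_⟩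
  · filter_upwards [hψs] with g hg hgμ
    exact hg (((momentumMap_smul_eq_iff hJ x.2 g).2 hgμ).trans hx1.symm)
  -- Curves in a leaf are defined on all of ℝ, while `ψ` is controlled only on a ball. The sine goes
  -- from 0 to 1 on [0, 1] without ever leaving [−1, 1], and its nonzero speed π/2 at 0 gives the
  -- constant `c`.
  set τ : ℝ → K := fun s ↦ Real.sin (Real.pi / 2 * s) • k
  have hτ : ContDiff ℝ ∞ τ :=
    (Real.contDiff_sin.comp (contDiff_const.mul contDiff_id)).smul contDiff_const
  have hτb : ∀ s, τ s ∈ Metric.ball (0 : K) r := by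
    intro s
    rw [mem_ball_zero_iff] at hk ⊢
    refine lt_of_le_of_lt ?_ hk
    rw [norm_smul]
    exact mul_le_of_le_one_left (norm_nonneg _) (Real.abs_sin_le_one _)
  have hg : ContMDiff 𝓘(ℝ, ℝ) 𝓘(ℝ, V) ∞ (ψ ∘ τ) := fun s ↦
    (hψ.contMDiffAt (Metric.isOpen_ball.mem_nhds (hτb s))).comp s hτ.contMDiff.contMDiffAt
  set γ : ℝ → LevelSet J μ := fun s ↦ ⟨ψ (τ s) • (x : M), (hψf _ (hτb s)).trans hx1⟩ with hγd
  have hγM : ContMDiff 𝓘(ℝ, ℝ) 𝓘(ℝ, E) ∞ (levelIncl J μ ∘ γ) :=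
    (contMDiff_orbit E V (x : M)).comp hg
  have hγ := contMDiff_of_levelIncl_comp hμ hγM
  have hτ0 : τ 0 = 0 := by simp [τ]
  have hγ0 : γ 0 = x := Subtype.ext (by simp [hγd, hτ0, hψ0])
  have hD : ∀ t, D F E (levelIncl J μ) (γ t) (D ℝ F γ t 1) =
      D V E (fun g : G ↦ g • (x : M)) (ψ (τ t)) (D ℝ V (ψ ∘ τ) t 1) := by
    intro t
    have h1 := (hasD_levelIncl hμ (γ t)).comp (hasD_of_contMDiffAt (hγ.contMDiffAt (x := t))) rfl
    have h2 := (hasD_orbit E V (x : M) (ψ (τ t))).comp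
      (hasD_of_contMDiffAt (hg.contMDiffAt (x := t))) rfl
    exact DFunLike.congr_fun (h1.unique h2) 1
  refine ⟨γ, hγ, fun t ↦ ?_, hγ0, ?_, Real.pi / 2, by positivity, ?_⟩
  · rw [mem_ker_pullback_levelIncl_iff hΩ hker hJ hμ, hD]
    have h1 := range_orbitD_smul (E := E) (V := V) (ψ (τ t)) (x : M)
    exact h1 ▸ (⟨_, rfl⟩ : D V E (fun g : G ↦ g • (x : M)) (ψ (τ t)) (D ℝ V (ψ ∘ τ) t 1) ∈
      LinearMap.range (D V E (fun g : G ↦ g • (x : M)) (ψ (τ t)) : V →ₗ[ℝ] E))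
  · simp [hγd, τ]
  · have h1 : HasD τ 0 (ContinuousLinearMap.toSpanSingleton ℝ ((Real.pi / 2) • k)) := by
      rw [hasD_iff_hasFDerivAt]
      have h2 : HasDerivAt (fun s : ℝ ↦ Real.pi / 2 * s) (Real.pi / 2) 0 := by
        simpa using (hasDerivAt_id (0 : ℝ)).const_mul (Real.pi / 2)
      have h3 := (h2.sin.smul_const k).hasFDerivAt
      simpa using h3
    have h2 := (hψd.comp h1 hτ0).eq
    have h3 := hD 0
    rw [hγ0, h2, hτ0, hψ0] at h3
    rw [h3]
    have h4 : (K.subtypeL.comp (ContinuousLinearMap.toSpanSingleton ℝ ((Real.pi / 2) • k))) 1 =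
      (Real.pi / 2) • (k : V) := by simp
    rw [h4, map_smul]
    rfl

/-- Points of a leaf of `ker Ω_μ` lie in the same orbit of the identity component of `G_μ`. -/
theorem exists_smul_eq_of_leafSetoid [ProperSMul G M]
    (hfree : ∀ (g : G) (x : M), g • x = x → g = 1)
    (hΩ : IsPresymplectic Ω) (hker : KerGeneratedByAction V G Ω)
    (hJ : IsPoissonianMomentumMap G Ω J) (hμ : IsWeaklyRegularValue (E := E) J μ (F := F))
    {x y : LevelSet J μ} (h : leafSetoid (ker (E := F) (pullback (levelIncl J μ) Ω)) x y) :
    ∃ g ∈ connectedComponent (1 : isotropy G μ), (g : G) • (x : M) = (y : M) := by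
  have hG : IsTopologicalGroup G := topologicalGroup_of_lieGroup 𝓘(ℝ, V) ∞
  induction h with
  | refl x => exact ⟨1, mem_connectedComponent, one_smul G _⟩
  | symm x y _ ih =>
    obtain ⟨g, hg, hxy⟩ := ih
    refine ⟨g⁻¹, (Subgroup.connectedComponentOfOne (isotropy G μ)).inv_mem hg, ?_⟩
    rw [← hxy]
    exact inv_smul_smul (g : G) _
  | trans x y z _ _ ih1 ih2 =>
    obtain ⟨g, hg, hxy⟩ := ih1
    obtain ⟨h, hh, hyz⟩ := ih2
    refine ⟨h * g, (Subgroup.connectedComponentOfOne (isotropy G μ)).mul_mem hh hg, ?_⟩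
    rw [← hyz, ← hxy]
    exact mul_smul (h : G) (g : G) _
  | rel x y hxy =>
    obtain ⟨γ, hγ, hγt, rfl, rfl⟩ := hxy
    set β : ℝ → M := levelIncl J μ ∘ γ
    have hβ : ContMDiff 𝓘(ℝ, ℝ) 𝓘(ℝ, E) ∞ β := (contMDiff_levelIncl hμ).comp hγ
    have hβt : ∀ t, D ℝ E β t 1 ∈ LinearMap.range (orbitD E V G (β t) : V →ₗ[ℝ] E) := by
      intro t
      have h1 := (hasD_levelIncl hμ (γ t)).comp (hasD_of_contMDiffAt (hγ.contMDiffAt (x := t))) rfl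
      rw [h1.eq]
      refine (mem_ker_pullback_levelIncl_iff hΩ hker hJ hμ (γ t) _).1 ?_
      rw [kerAt_eq]
      exact hγt t
    choose g hg using exists_smul_eq_of_tangent_orbits hfree hβ hβt 0
    -- No continuity is imposed on the choice of `g`; it follows because the orbit map is inducing.
    -- The path then keeps `g 1` in the component of `g 0 = 1`.
    have hgc : Continuous g := by
      rw [(isInducing_orbit hfree (β 0)).continuous_iff]
      exact hβ.continuous.congr hg
    have hgμ : ∀ t, g t ∈ isotropy G μ := fun t ↦
      (momentumMap_smul_eq_iff hJ (γ 0).2 (g t)).1 ((congrArg J (hg t)).symm.trans (γ t).2)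
    have hg0 : g 0 = 1 := hfree _ _ (hg 0).symm
    set k : ℝ → isotropy G μ := fun t ↦ ⟨g t, hgμ t⟩
    have hk0 : k 0 = 1 := Subtype.ext hg0
    have hk : Continuous k := hgc.subtype_mk _
    refine ⟨k 1, ?_, (hg 1).symm⟩
    rw [← hk0]
    exact (isPreconnected_range hk).subset_connectedComponent ⟨0, rfl⟩ ⟨1, rfl⟩

/-- The orbits of the identity component of `G_μ` are contained in the leaves of `ker Ω_μ`. -/
theorem leafProj_eq_of_smul_eq
    (hΩ : IsPresymplectic Ω) (hker : KerGeneratedByAction V G Ω)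
    (hJ : IsPoissonianMomentumMap G Ω J) (hμ : IsWeaklyRegularValue (E := E) J μ (F := F))
    {x y : LevelSet J μ} {g : isotropy G μ} (hg : g ∈ connectedComponent (1 : isotropy G μ))
    (hxy : (g : G) • (x : M) = (y : M)) :
    leafProj (ker (E := F) (pullback (levelIncl J μ) Ω)) x =
      leafProj (ker (E := F) (pullback (levelIncl J μ) Ω)) y := by
  have hG : IsTopologicalGroup G := topologicalGroup_of_lieGroup 𝓘(ℝ, V) ∞
  set π := leafProj (ker (E := F) (pullback (levelIncl J μ) Ω))
  set s : isotropy G μ → LevelSet J μ := fun g ↦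
    ⟨(g : G) • (x : M), (momentumMap_smul_eq_iff hJ x.2 (g : G)).2 g.2⟩
  -- For `b` near `a` in G_μ, the element `b a⁻¹` is a `ψ k` for the point `s a`, and the associated
  -- curve joins `s a` to `s b` in one leaf.
  have h1 : IsLocallyConstant (π ∘ s) := by
    rw [IsLocallyConstant.iff_eventually_eq]
    intro a
    obtain ⟨r, ψ, -, hψ, hγ⟩ := exists_curves_in_level_orbit hΩ hker hJ hμ (s a) rfl
    have h2 : Tendsto (fun b : isotropy G μ ↦ (b : G) * (a : G)⁻¹) (𝓝 a) (𝓝 1) := by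
      have h3 : Continuous (fun b : isotropy G μ ↦ (b : G) * (a : G)⁻¹) := by fun_prop
      exact h3.tendsto' _ _ (mul_inv_cancel _)
    filter_upwards [h2.eventually hψ] with b hb
    obtain ⟨k, hk, hkb⟩ := hb (mul_mem b.2 (inv_mem a.2))
    obtain ⟨γ, hγ1, hγ2, hγ3, hγ4, -⟩ := hγ k hk
    have h4 : γ 1 = s b := by
      refine Subtype.ext ?_
      rw [hγ4, hkb]
      change ((b : G) * (a : G)⁻¹) • ((a : G) • (x : M)) = (b : G) • (x : M)
      rw [← mul_smul, inv_mul_cancel_right]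
    have h5 := leafProj_eq_of_tangent hγ1 hγ2 1
    rw [h4, hγ3] at h5
    exact h5
  have h2 := h1.apply_eq_of_isPreconnected isPreconnected_connectedComponent
    mem_connectedComponent hg
  have h3 : s 1 = x := Subtype.ext (one_smul G _)
  have h4 : s g = y := Subtype.ext hxy
  simpa only [Function.comp_apply, h3, h4] using h2

theorem leafProj_eq_iff [ProperSMul G M] (hfree : ∀ (g : G) (x : M), g • x = x → g = 1)
    (hΩ : IsPresymplectic Ω) (hker : KerGeneratedByAction V G Ω)
    (hJ : IsPoissonianMomentumMap G Ω J) (hμ : IsWeaklyRegularValue (E := E) J μ (F := F))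
    (x y : LevelSet J μ) :
    leafProj (ker (E := F) (pullback (levelIncl J μ) Ω)) x =
      leafProj (ker (E := F) (pullback (levelIncl J μ) Ω)) y ↔
    ∃ g ∈ connectedComponent (1 : isotropy G μ), (g : G) • (x : M) = (y : M) :=
  ⟨fun h ↦ exists_smul_eq_of_leafSetoid hfree hΩ hker hJ hμ (Quotient.exact h),
    fun ⟨_, hg, hxy⟩ ↦ leafProj_eq_of_smul_eq hΩ hker hJ hμ hg hxy⟩

variable {Q : Type*} [NormedAddCommGroup Q] [NormedSpace ℝ Q]
  [ChartedSpace Q (LeafSpace (ker (E := F) (pullback (levelIncl J μ) Ω)))]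
  [IsManifold 𝓘(ℝ, Q) ∞ (LeafSpace (ker (E := F) (pullback (levelIncl J μ) Ω)))]

/-- The tangent spaces of the fibres of the projection to the leaf space. -/
theorem D_leafProj_eq_zero_iff [ProperSMul G M]
    (hfree : ∀ (g : G) (x : M), g • x = x → g = 1)
    (hΩ : IsPresymplectic Ω) (hker : KerGeneratedByAction V G Ω)
    (hJ : IsPoissonianMomentumMap G Ω J) (hμ : IsWeaklyRegularValue (E := E) J μ (F := F))
    (hsub : Manifold.IsSubmersion 𝓘(ℝ, F) 𝓘(ℝ, Q) ∞
      (leafProj (ker (E := F) (pullback (levelIncl J μ) Ω)))) (x : LevelSet J μ) (u : F) :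
    D F Q (leafProj (ker (E := F) (pullback (levelIncl J μ) Ω))) x u = 0 ↔
      u ∈ kerAt (pullback (levelIncl J μ) Ω) x := by
  rw [mem_ker_pullback_levelIncl_iff hΩ hker hJ hμ]
  constructor
  · intro hu
    obtain ⟨γ, hγ0, hγd, hγ⟩ := exists_curve_in_fibre (hsub.isSubmersionAt x) hu
    have h1 := (hasD_levelIncl hμ x).comp hγd hγ0
    have h2 : (D F E (levelIncl J μ) x).comp (ContinuousLinearMap.toSpanSingleton ℝ u) =
        ContinuousLinearMap.toSpanSingleton ℝ (D F E (levelIncl J μ) x u) := by ext; simp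
    rw [h2] at h1
    refine mem_range_orbitD_of_curve_in_orbit hfree h1 (congrArg (levelIncl J μ) hγ0) ?_
    filter_upwards [hγ] with t ht
    obtain ⟨g, -, hg⟩ := (leafProj_eq_iff hfree hΩ hker hJ hμ _ _).1 ht.symm
    exact ⟨g, hg.symm⟩
  · rintro ⟨ξ, hξ⟩
    obtain ⟨r, ψ, hr, -, hγ⟩ := exists_curves_in_level_orbit hΩ hker hJ hμ x rfl
    have hξK : ξ ∈ LinearMap.ker (D V (LieDual V) (fun g : G ↦ J (g • (x : M))) 1 :
        V →ₗ[ℝ] LieDual V) := by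
      have h1 := (hasD_of_contMDiffAt (hJ.smooth.contMDiffAt (x := (x : M)))).comp
        (hasD_orbit E V (x : M) (1 : G)) (one_smul G _)
      have h2 : D V (LieDual V) (fun g : G ↦ J (g • (x : M))) 1 = _ := h1.eq
      rw [LinearMap.mem_ker, ContinuousLinearMap.coe_coe, h2]
      exact (exists_D_levelIncl_iff hμ x _).1 ⟨u, hξ.symm⟩
    -- Curves are available only for vectors in the ball, so ξ is shrunk by a nonzero factor, which
    -- is divided out at the end.
    obtain ⟨a, ha, hab⟩ : ∃ a : ℝ, a ≠ 0 ∧ a • (⟨ξ, hξK⟩ : LinearMap.ker (D V (LieDual V)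
        (fun g : G ↦ J (g • (x : M))) 1 : V →ₗ[ℝ] LieDual V)) ∈ Metric.ball 0 r := by
      have h1 : Tendsto (fun a : ℝ ↦ a • (⟨ξ, hξK⟩ : LinearMap.ker (D V (LieDual V)
        (fun g : G ↦ J (g • (x : M))) 1 : V →ₗ[ℝ] LieDual V))) (𝓝[≠] 0) (𝓝 0) :=
        ((continuous_id.smul continuous_const).tendsto' 0 _ (zero_smul ℝ _)).mono_left
          nhdsWithin_le_nhds
      obtain ⟨a, ha1, ha2⟩ := ((h1.eventually (Metric.ball_mem_nhds 0 hr)).and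
        self_mem_nhdsWithin).exists
      exact ⟨a, ha2, ha1⟩
    obtain ⟨γ, hγ1, hγ2, hγ3, -, c, hc, hγ5⟩ := hγ _ hab
    have h1 : D ℝ F γ 0 1 = (c * a) • u := by
      refine injective_D_levelIncl hμ x (hγ5.trans ?_)
      rw [map_smul (D F E (levelIncl J μ) x), mul_smul, ← hξ]
      exact congrArg (c • ·) (map_smul (orbitD E V G (x : M)) a ξ)
    have h2 := (hasD_of_contMDiffAt (hsub.contMDiff.contMDiffAt (x := x))).comp
      (hasD_of_contMDiffAt (hγ1.contMDiffAt (x := 0))) hγ3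
    have h3 := h2.unique ((hasD_const (leafProj (ker (E := F)
      (pullback (levelIncl J μ) Ω)) (γ 0)) (0 : ℝ)).congr
        (Eventually.of_forall fun t ↦ leafProj_eq_of_tangent hγ1 hγ2 t))
    have h4 := DFunLike.congr_fun h3 1
    rw [ContinuousLinearMap.comp_apply, h1, map_smul] at h4
    exact (smul_eq_zero.1 h4).resolve_left (mul_ne_zero hc ha)

end Orbits


/-! ### Descent of forms and fields along a submersion -/

theorem ker_eq_bot_iff {E : Type*} [NormedAddCommGroup E] [NormedSpace ℝ E]
    {M : Type*} [TopologicalSpace M] [ChartedSpace E M] {Ω : TwoForm E M} {x : M} :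
    ker Ω x = ⊥ ↔ ∀ v : E, bilAt Ω x v = 0 → v = 0 := by
  rw [← kerAt_eq]
  exact LinearMap.ker_eq_bot'

theorem twoForm_ext {E : Type*} [NormedAddCommGroup E] [NormedSpace ℝ E]
    {M : Type*} [TopologicalSpace M] [ChartedSpace E M] {Ω Ω' : TwoForm E M} {x : M}
    (h : ∀ u w : E, bilAt Ω x u w = bilAt Ω' x u w) : Ω x = Ω' x :=
  form_ext (E := E) h

section Reduction

variable {F : Type*} [NormedAddCommGroup F] [NormedSpace ℝ F]
  {N : Type*} [TopologicalSpace N] [ChartedSpace F N]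
  {Q : Type*} [NormedAddCommGroup Q] [NormedSpace ℝ Q]
  {B : Type*} [TopologicalSpace B] [ChartedSpace Q B]
  {π : N → B} {Θ : TwoForm F N}

theorem hasD_submersion (hsub : Manifold.IsSubmersion 𝓘(ℝ, F) 𝓘(ℝ, Q) ∞ π) (x : N) :
    HasD π x (D F Q π x) := hasD_of_contMDiffAt hsub.contMDiff.contMDiffAt

theorem D_submersion_comp_section (hsub : Manifold.IsSubmersion 𝓘(ℝ, F) 𝓘(ℝ, Q) ∞ π)
    {σ : B → N} {U : Set B} (hU : IsOpen U) (hσ : ContMDiffOn 𝓘(ℝ, Q) 𝓘(ℝ, F) ∞ σ U)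
    (hπσ : ∀ z ∈ U, π (σ z) = z) {z : B} (hz : z ∈ U) (a : Q) :
    D F Q π (σ z) (D Q F σ z a) = a := by
  have h1 := (hasD_submersion hsub (σ z)).comp (hasD_of_contMDiffOn hσ hU hz) rfl
  have h2 := h1.unique ((hasD_id z).congr
    (by filter_upwards [hU.mem_nhds hz] with w hw; exact hπσ w hw))
  exact DFunLike.congr_fun h2 a

variable [IsManifold 𝓘(ℝ, F) ∞ N] [IsManifold 𝓘(ℝ, Q) ∞ B]

theorem surjective_D_submersion (hsub : Manifold.IsSubmersion 𝓘(ℝ, F) 𝓘(ℝ, Q) ∞ π) (x : N) :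
    Function.Surjective (D F Q π x) := by
  obtain ⟨U, σ, hU, hx, hσ, hσx, hπσ⟩ := exists_local_section (hsub.isSubmersionAt x)
  intro a
  have h1 := D_submersion_comp_section hsub hU hσ hπσ hx a
  rw [hσx] at h1
  exact ⟨_, h1⟩

/-- Pointwise descent of a form along a submersion. -/
theorem exists_form_descent (hsub : Manifold.IsSubmersion 𝓘(ℝ, F) 𝓘(ℝ, Q) ∞ π)
    (hk : ∀ (x : N) (u : F), D F Q π x u = 0 ↔ u ∈ kerAt Θ x) (x : N) :
    ∃ α : Q [⋀^Fin 2]→L[ℝ] ℝ, ∀ u w : F, bil α (D F Q π x u) (D F Q π x w) = bilAt Θ x u w := by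
  obtain ⟨U, σ, hU, hx, hσ, hσx, hπσ⟩ := exists_local_section (hsub.isSubmersionAt x)
  set s := D Q F σ (π x)
  have hs : ∀ a : Q, D F Q π x (s a) = a := by
    intro a
    have h1 := D_submersion_comp_section hsub hU hσ hπσ hx a
    rwa [hσx] at h1
  -- Lifting `Tπ u` by the section changes `u` by an element of ker Tπ, which is the kernel of the
  -- form.
  have hs' : ∀ u : F, bilAt Θ x (s (D F Q π x u)) = bilAt Θ x u := by
    intro u
    have h1 : s (D F Q π x u) - u ∈ kerAt Θ x := (hk x _).1 (by rw [map_sub, hs, sub_self])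
    rw [kerAt, LinearMap.mem_ker, map_sub, sub_eq_zero] at h1
    exact h1
  set θ : F [⋀^Fin 2]→L[ℝ] ℝ := Θ x
  refine ⟨θ.compContinuousLinearMap s, fun u w ↦ ?_⟩
  have h1 : bil (θ.compContinuousLinearMap s)
      (D F Q π x u) (D F Q π x w) = bilAt Θ x (s (D F Q π x u)) (s (D F Q π x w)) := by
    rw [bil_apply, compContinuousLinearMap_pair]
    rfl
  rw [h1, hs', bilAt_swap, hs', ← bilAt_swap]

/-- A presymplectic form descends to a symplectic form along a submersion whose fibres are tangent
to its kernel and are permuted transitively by local symmetries. -/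
theorem exists_reduced_form [FiniteDimensional ℝ F] [FiniteDimensional ℝ Q]
    (hsub : Manifold.IsSubmersion 𝓘(ℝ, F) 𝓘(ℝ, Q) ∞ π) (hsurj : Function.Surjective π)
    (hs : IsSmoothForm Θ) (hc : IsClosedForm Θ)
    (hk : ∀ (x : N) (u : F), D F Q π x u = 0 ↔ u ∈ kerAt Θ x)
    (hφ : ∀ x y, π x = π y → ∃ φ : N → N, ContMDiff 𝓘(ℝ, F) 𝓘(ℝ, F) ∞ φ ∧ φ x = y ∧
      (∀ z, π (φ z) = π z) ∧ pullback φ Θ = Θ) :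
    ∃ Ωhat : TwoForm Q B, IsSymplectic Ωhat ∧ pullback π Ωhat = Θ := by
  choose α hα using exists_form_descent hsub hk
  -- A symmetry carrying `x` to `y` over the identity of the base intertwines the two descended
  -- forms, and Tπ is onto.
  have hαe : ∀ x y, π x = π y → α x = α y := by
    intro x y hxy
    obtain ⟨φ, hφ1, rfl, hφ3, hφ4⟩ := hφ x y hxy
    have h1 := ((hasD_submersion hsub (φ x)).comp
      (hasD_of_contMDiffAt (hφ1.contMDiffAt (x := x))) rfl).unique
      ((hasD_submersion hsub x).congr (Eventually.of_forall hφ3))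
    refine form_ext fun a b ↦ ?_
    obtain ⟨u, rfl⟩ := surjective_D_submersion hsub x a
    obtain ⟨w, rfl⟩ := surjective_D_submersion hsub x b
    have h2 := hα (φ x) (D F F φ x u) (D F F φ x w)
    rw [← ContinuousLinearMap.comp_apply, ← ContinuousLinearMap.comp_apply, h1,
      ← bilAt_pullback, hφ4, ← hα x] at h2
    exact h2.symm
  set Ωhat : TwoForm Q B := fun q ↦ α (Function.surjInv hsurj q)
  have hΩ : ∀ (x : N) (u w : F), bilAt Ωhat (π x) (D F Q π x u) (D F Q π x w) =
      bilAt Θ x u w := by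
    intro x u w
    have h1 : Ωhat (π x) = α x := hαe _ _ (Function.surjInv_eq hsurj (π x))
    rw [bilAt, h1, hα]
  have hpull : pullback π Ωhat = Θ := by
    funext x
    exact twoForm_ext fun u w ↦ by rw [bilAt_pullback, hΩ]
  -- Over a local section σ the descended form is σ^*Θ.
  have hsc := smooth_closed_of_locally_pullback hs hc (Θ := Ωhat) (fun q ↦ by
    obtain ⟨x, rfl⟩ := hsurj q
    obtain ⟨U, σ, hU, hx, hσ, hσx, hπσ⟩ := exists_local_section (hsub.isSubmersionAt x)
    refine ⟨U, σ, hU, hx, hσ, fun z hz ↦ twoForm_ext fun a b ↦ ?_⟩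
    rw [bilAt_pullback, ← hΩ, D_submersion_comp_section hsub hU hσ hπσ hz,
      D_submersion_comp_section hsub hU hσ hπσ hz, hπσ z hz])
  refine ⟨Ωhat, ⟨hsc.1, hsc.2, fun q ↦ ?_⟩, hpull⟩
  obtain ⟨x, rfl⟩ := hsurj q
  rw [ker_eq_bot_iff]
  intro a ha
  obtain ⟨u, rfl⟩ := surjective_D_submersion hsub x a
  refine (hk x u).2 ?_
  rw [kerAt, LinearMap.mem_ker]
  ext w
  rw [← hΩ, ha]
  rfl

/-- Dynamical fields project along a submersion. -/
theorem exists_reduced_field (hsub : Manifold.IsSubmersion 𝓘(ℝ, F) 𝓘(ℝ, Q) ∞ π)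
    (hsurj : Function.Surjective π) {Ωhat : TwoForm Q B} (hΩ : IsSymplectic Ωhat)
    (hpull : pullback π Ωhat = Θ) {Hhat : B → ℝ} (hH : ContMDiff 𝓘(ℝ, Q) 𝓘(ℝ, ℝ) ∞ Hhat)
    {h : N → ℝ} (hh : Hhat ∘ π = h) (hex : ∃ X : VField F N, IsDynamics Θ h X) :
    ∃ Xhat : VField Q B, IsDynamics Ωhat Hhat Xhat ∧
      ∀ X : VField F N, IsDynamics Θ h X → IsRelated π X Xhat := by
  have key : ∀ (X : VField F N), IsDynamics Θ h X → ∀ (x : N) (a : Q),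
      bilAt Ωhat (π x) (D F Q π x (X x)) a = D Q ℝ Hhat (π x) a := by
    intro X hX x a
    obtain ⟨w, rfl⟩ := surjective_D_submersion hsub x a
    have h1 : bilAt Θ x (X x) w = D F ℝ h x w := hX.equation x w
    have h2 := (hasD_of_contMDiffAt (hH.contMDiffAt (x := π x))).comp (hasD_submersion hsub x) rfl
    rw [hh] at h2
    rw [h2.eq, ← hpull] at h1
    exact (bilAt_pullback (E' := F) Ωhat π x (X x) w).symm.trans h1
  have uniq : ∀ (q : B) (a b : Q), bilAt Ωhat q a = bilAt Ωhat q b → a = b := by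
    intro q a b hab
    rw [← sub_eq_zero]
    refine ker_eq_bot_iff.1 (hΩ.nondegenerate q) _ ?_
    rw [map_sub, hab, sub_self]
  obtain ⟨X₀, hX₀⟩ := hex
  -- Arbitrary preimages suffice: the Hamiltonian equation and nondegeneracy determine the projected
  -- vector. Smoothness follows from writing the field as `Tπ ∘ X₀ ∘ σ`.
  set Xhat : VField Q B := fun q ↦ D F Q π (Function.surjInv hsurj q) (X₀ (Function.surjInv hsurj q))
  have hXhat : ∀ (q : B) (a : Q), bilAt Ωhat q (Xhat q) a = D Q ℝ Hhat q a := by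
    intro q a
    have h1 := key X₀ hX₀ (Function.surjInv hsurj q)
    rw [Function.surjInv_eq hsurj] at h1
    exact h1 a
  have hrel : ∀ X : VField F N, IsDynamics Θ h X → IsRelated π X Xhat := by
    intro X hX x
    refine uniq (π x) _ _ (LinearMap.ext fun a ↦ ?_)
    rw [hXhat]
    exact key X hX x a
  refine ⟨Xhat, ⟨fun q ↦ ?_, hXhat⟩, hrel⟩
  obtain ⟨x, rfl⟩ := hsurj q
  obtain ⟨U, σ, hU, hx, hσ, hσx, hπσ⟩ := exists_local_section (hsub.isSubmersionAt x)
  have h1 : ContMDiffOn 𝓘(ℝ, Q) 𝓘(ℝ, F).tangent ∞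
      (fun z ↦ (⟨σ z, X₀ (σ z)⟩ : TangentBundle 𝓘(ℝ, F) N)) U := hX₀.smooth.comp_contMDiffOn hσ
  have h2 := contMDiffOn_tangentMap_comp isOpen_univ hsub.contMDiff.contMDiffOn h1
    (fun _ _ ↦ mem_univ _)
  refine (h2.contMDiffAt (hU.mem_nhds hx)).congr_of_eventuallyEq ?_
  filter_upwards [hU.mem_nhds hx] with z hz
  have h3 := hrel X₀ hX₀ (σ z)
  have h4 : ∀ w, w = z → (mfderiv 𝓘(ℝ, F) 𝓘(ℝ, Q) π (σ z) (X₀ (σ z)) : Q) = Xhat w →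
      (⟨z, Xhat z⟩ : TangentBundle 𝓘(ℝ, Q) B) =
        ⟨w, (mfderiv 𝓘(ℝ, F) 𝓘(ℝ, Q) π (σ z) (X₀ (σ z)) : Q)⟩ := by
    rintro w rfl h
    rw [h]
  exact h4 _ (hπσ z hz) h3

end Reduction

/-! ### Restriction of the dynamics to the level set -/

section Restriction

variable {E : Type*} [NormedAddCommGroup E] [NormedSpace ℝ E]
  {M : Type*} [TopologicalSpace M] [ChartedSpace E M] [IsManifold 𝓘(ℝ, E) ∞ M]
  {V : Type*} [NormedAddCommGroup V] [NormedSpace ℝ V]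
  {J : M → LieDual V} {μ : LieDual V}
  {F : Type*} [NormedAddCommGroup F] [NormedSpace ℝ F] [ChartedSpace F (LevelSet J μ)]
  [IsManifold 𝓘(ℝ, F) ∞ (LevelSet J μ)]
  {G : Type*} [TopologicalSpace G] [ChartedSpace V G] [Group G]
  [MulAction G M] [ContMDiffSMul 𝓘(ℝ, V) 𝓘(ℝ, E) ∞ G M] {Ω : TwoForm E M} {H : M → ℝ}

/-- A dynamical field with invariant Hamiltonian is tangent to the level sets of the momentum map. -/
theorem D_momentumMap_dynamics (hJ : IsPoissonianMomentumMap G Ω J)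
    (hH : ContMDiff 𝓘(ℝ, E) 𝓘(ℝ, ℝ) ∞ H) (hGH : ∀ (g : G) (x : M), H (g • x) = H x)
    {X : VField E M} (hX : IsDynamics Ω H X) (x : M) : D E (LieDual V) J x (X x) = 0 := by
  ext ξ
  have h1 : bilAt Ω x (X x) (orbitD E V G x ξ) = D E ℝ H x (orbitD E V G x ξ) :=
    hX.equation x (orbitD E V G x ξ)
  have h2 := ((hasD_of_contMDiffAt (hH.contMDiffAt (x := x))).comp (hasD_orbit E V x (1 : G))
    (one_smul G x)).unique ((hasD_const (H x) (1 : G)).congr (Eventually.of_forall fun g ↦ hGH g x))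
  have h3 : D E ℝ H x (orbitD E V G x ξ) = 0 := DFunLike.congr_fun h2 ξ
  refine (D_momentumMap hJ x (X x) ξ).trans ((bilAt_swap Ω x _ _).trans ?_)
  refine (congrArg Neg.neg (h1.trans h3)).trans neg_zero

theorem existsUnique_restriction (hJ : IsPoissonianMomentumMap G Ω J)
    (hμ : IsWeaklyRegularValue (E := E) J μ (F := F))
    (hH : ContMDiff 𝓘(ℝ, E) 𝓘(ℝ, ℝ) ∞ H) (hGH : ∀ (g : G) (x : M), H (g • x) = H x)
    {X : VField E M} (hX : IsDynamics Ω H X) :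
    ∃! Xμ : VField F (LevelSet J μ), IsDynamics (pullback (levelIncl J μ) Ω) (H ∘ levelIncl J μ) Xμ ∧
      IsRelated (levelIncl J μ) Xμ X := by
  have h0 : ∀ x : LevelSet J μ, ∃ u : F, D F E (levelIncl J μ) x u = X (levelIncl J μ x) := fun x ↦
    (exists_D_levelIncl_iff hμ x _).2 (D_momentumMap_dynamics hJ hH hGH hX _)
  choose Y hY using h0
  refine ⟨Y, ⟨⟨fun x ↦ ?_, fun x v ↦ ?_⟩, hY⟩, ?_⟩
  -- The restriction is chosen pointwise; near `x` it equals `Tr ∘ X ∘ j` for a smooth local left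
  -- inverse `r` of the inclusion, hence is smooth.
  · obtain ⟨U, r, hU, hx, hr, hri⟩ := exists_local_leftInverse (hμ.embedding.isImmersion.isImmersionAt x)
    have hi := contMDiff_levelIncl hμ
    set S : Set (LevelSet J μ) := levelIncl J μ ⁻¹' U
    have hS : S ∈ 𝓝 x := hi.continuous.continuousAt.preimage_mem_nhds (hU.mem_nhds hx)
    have h1 : ContMDiffOn 𝓘(ℝ, F) 𝓘(ℝ, E).tangent ∞ (fun y : LevelSet J μ ↦
        (⟨levelIncl J μ y, X (levelIncl J μ y)⟩ : TangentBundle 𝓘(ℝ, E) M)) S :=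
      (hX.smooth.comp hi).contMDiffOn
    have h2 := contMDiffOn_tangentMap_comp hU hr h1 (fun y hy ↦ hy)
    refine (h2.contMDiffAt hS).congr_of_eventuallyEq ?_
    filter_upwards [hri.eventually_nhds, hS] with y hy hyS
    have h3 := ((hasD_of_contMDiffOn hr hU hyS).comp (hasD_levelIncl hμ y) rfl).unique
      ((hasD_id y).congr hy)
    have h4 : D E F r (levelIncl J μ y) (X (levelIncl J μ y)) = Y y := by
      rw [← hY y]
      exact DFunLike.congr_fun h3 (Y y)
    have h5 : ∀ w, w = y → (⟨y, Y y⟩ : TangentBundle 𝓘(ℝ, F) (LevelSet J μ)) =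
        ⟨w, D E F r (levelIncl J μ y) (X (levelIncl J μ y))⟩ := by
      rintro w rfl
      rw [h4]
    exact h5 _ hy.self_of_nhds
  · have h1 : bilAt Ω (levelIncl J μ x) (X (levelIncl J μ x)) (D F E (levelIncl J μ) x v) =
      D E ℝ H (levelIncl J μ x) (D F E (levelIncl J μ) x v) := hX.equation _ _
    have h2 := (hasD_of_contMDiffAt (hH.contMDiffAt (x := levelIncl J μ x))).comp
      (hasD_levelIncl hμ x) rfl
    rw [← hY] at h1
    refine ((bilAt_pullback Ω (levelIncl J μ) x (Y x) v).trans h1).trans ?_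
    exact (DFunLike.congr_fun h2.eq v).symm
  · rintro Z ⟨-, hZ⟩
    funext x
    exact injective_D_levelIncl hμ x ((hZ x).trans (hY x).symm)

end Restriction


/-! ### The action of G_μ on the level set -/

section LevelSetSymmetry

variable {E : Type*} [NormedAddCommGroup E] [NormedSpace ℝ E]
  {M : Type*} [TopologicalSpace M] [ChartedSpace E M]
  {V : Type*} [NormedAddCommGroup V] [NormedSpace ℝ V] [FiniteDimensional ℝ V]
  {J : M → LieDual V} {μ : LieDual V}
  {F : Type*} [NormedAddCommGroup F] [NormedSpace ℝ F] [ChartedSpace F (LevelSet J μ)]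
  [IsManifold 𝓘(ℝ, F) ∞ (LevelSet J μ)]
  {G : Type*} [TopologicalSpace G] [ChartedSpace V G] [Group G] [LieGroup 𝓘(ℝ, V) ∞ G]
  [ConnectedSpace G] [MulAction G M] [ContMDiffSMul 𝓘(ℝ, V) 𝓘(ℝ, E) ∞ G M] {Ω : TwoForm E M}

/-- The action of `G_μ` on a level set of the momentum map. -/
def levelSmul (hJ : IsPoissonianMomentumMap G Ω J) (g : isotropy G μ) (x : LevelSet J μ) :
    LevelSet J μ :=
  ⟨(g : G) • (x : M), (momentumMap_smul_eq_iff hJ x.2 (g : G)).2 g.2⟩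

theorem contMDiff_levelSmul (hJ : IsPoissonianMomentumMap G Ω J)
    (hμ : IsWeaklyRegularValue (E := E) J μ (F := F)) (g : isotropy G μ) :
    ContMDiff 𝓘(ℝ, F) 𝓘(ℝ, F) ∞ (levelSmul hJ g) :=
  contMDiff_of_levelIncl_comp hμ ((contMDiff_smul_left E V (g : G)).comp (contMDiff_levelIncl hμ))

/-- The inclusion intertwines the two actions, so invariance of Ω passes to Ω_μ. These maps are the
symmetries required by `exists_reduced_form`. -/
theorem pullback_levelSmul (hJ : IsPoissonianMomentumMap G Ω J)
    (hμ : IsWeaklyRegularValue (E := E) J μ (F := F))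
    (hGΩ : ∀ g : G, pullback (fun x : M ↦ g • x) Ω = Ω) (g : isotropy G μ) :
    pullback (levelSmul hJ g) (pullback (levelIncl J μ) Ω : TwoForm F (LevelSet J μ)) =
      (pullback (levelIncl J μ) Ω : TwoForm F (LevelSet J μ)) := by
  funext x
  refine twoForm_ext fun u w ↦ ?_
  have h1 := ((hasD_levelIncl hμ (levelSmul hJ g x)).comp
    (hasD_of_contMDiffAt ((contMDiff_levelSmul hJ hμ g).contMDiffAt (x := x))) rfl).unique
    ((hasD_of_contMDiffAt ((contMDiff_smul_left E V (g : G)).contMDiffAt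
      (x := levelIncl J μ x))).comp (hasD_levelIncl hμ x) rfl)
  rw [bilAt_pullback, bilAt_pullback, bilAt_pullback, ← ContinuousLinearMap.comp_apply,
    ← ContinuousLinearMap.comp_apply, h1]
  have h2 := bilAt_pullback (E' := E) Ω (fun x : M ↦ (g : G) • x) (levelIncl J μ x)
    (D F E (levelIncl J μ) x u) (D F E (levelIncl J μ) x w)
  rw [hGΩ] at h2
  exact h2.symm

end LevelSetSymmetry

theorem isPresymplectic_pullback_levelIncl {E : Type*} [NormedAddCommGroup E] [NormedSpace ℝ E]
    [FiniteDimensional ℝ E] {M : Type*} [TopologicalSpace M] [T2Space M]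
    [ChartedSpace E M] [IsManifold 𝓘(ℝ, E) ∞ M]
    {V : Type*} [NormedAddCommGroup V] [NormedSpace ℝ V] [FiniteDimensional ℝ V]
    {G : Type*} [TopologicalSpace G] [ChartedSpace V G] [Group G] [LieGroup 𝓘(ℝ, V) ∞ G]
    [MulAction G M] [ContMDiffSMul 𝓘(ℝ, V) 𝓘(ℝ, E) ∞ G M]
    (hfree : ∀ (g : G) (x : M), g • x = x → g = 1) {Ω : TwoForm E M} (hΩ : IsPresymplectic Ω)
    (hker : KerGeneratedByAction V G Ω) {J : M → LieDual V} (hJ : IsPoissonianMomentumMap G Ω J)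
    {μ : LieDual V} {F : Type*} [NormedAddCommGroup F] [NormedSpace ℝ F] [FiniteDimensional ℝ F]
    [ChartedSpace F (LevelSet J μ)] [IsManifold 𝓘(ℝ, F) ∞ (LevelSet J μ)]
    (hμ : IsWeaklyRegularValue (E := E) J μ (F := F)) :
    IsPresymplectic (pullback (levelIncl J μ) Ω : TwoForm F (LevelSet J μ)) := by
  have h1 := smooth_closed_of_locally_pullback hΩ.smooth hΩ.closed
    (Θ := (pullback (levelIncl J μ) Ω : TwoForm F (LevelSet J μ)))
    (fun x ↦ ⟨univ, levelIncl J μ, isOpen_univ, mem_univ x,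
      (contMDiff_levelIncl hμ).contMDiffOn, fun _ _ ↦ rfl⟩)
  refine ⟨h1.1, h1.2, ?_⟩
  rcases isEmpty_or_nonempty (LevelSet J μ) with h | ⟨⟨y⟩⟩
  -- On an empty level set any rank will do.
  · exact ⟨0, fun x ↦ (h.false x).elim⟩
  · refine ⟨Module.finrank ℝ (kerAt (pullback (levelIncl J μ) Ω : TwoForm F (LevelSet J μ)) y),
      fun x ↦ ?_⟩
    rw [← kerAt_eq]
    exact finrank_ker_pullback_levelIncl hfree hΩ hker hJ hμ x y

end Presymplectic

/-! ### The reduction theorem -/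

theorem mainTheorem2
    -- the manifold `M` and the connected Lie group `G`
    {E : Type*} [NormedAddCommGroup E] [NormedSpace ℝ E] [FiniteDimensional ℝ E]
    {M : Type*} [TopologicalSpace M] [T2Space M] [SecondCountableTopology M]
    [ChartedSpace E M] [IsManifold 𝓘(ℝ, E) ∞ M]
    {V : Type*} [NormedAddCommGroup V] [NormedSpace ℝ V] [FiniteDimensional ℝ V]
    {G : Type*} [TopologicalSpace G] [T2Space G] [SecondCountableTopology G] [ConnectedSpace G]
    [ChartedSpace V G] [Group G] [LieGroup 𝓘(ℝ, V) ∞ G]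
    -- a smooth, proper and free action
    [MulAction G M] [ContMDiffSMul 𝓘(ℝ, V) 𝓘(ℝ, E) ∞ G M] [ProperSMul G M]
    (hfree : ∀ (g : G) (x : M), g • x = x → g = 1)
    -- the compatible presymplectic system `(M, Ω, H)`
    (Ω : Presymplectic.TwoForm E M) (hΩ : Presymplectic.IsPresymplectic Ω)
    (H : M → ℝ) (hH : ContMDiff 𝓘(ℝ, E) 𝓘(ℝ, ℝ) ∞ H)
    (hcompat : ∃ X : Presymplectic.VField E M, Presymplectic.IsDynamics Ω H X)
    -- `G` is a symmetry group of the system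
    (hGΩ : ∀ g : G, Presymplectic.pullback (fun x : M ↦ g • x) Ω = Ω)
    (hGH : ∀ (g : G) (x : M), H (g • x) = H x)
    (hker : Presymplectic.KerGeneratedByAction V G Ω)
    -- the action is Poissonian, with momentum map `J`
    (J : M → Presymplectic.LieDual V) (hJ : Presymplectic.IsPoissonianMomentumMap G Ω J)
    -- `μ` is a weakly regular value of `J`
    (μ : Presymplectic.LieDual V)
    {F : Type*} [NormedAddCommGroup F] [NormedSpace ℝ F] [FiniteDimensional ℝ F]
    [ChartedSpace F (Presymplectic.LevelSet J μ)]
    [IsManifold 𝓘(ℝ, F) ∞ (Presymplectic.LevelSet J μ)]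
    (hμ : Presymplectic.IsWeaklyRegularValue (E := E) J μ (F := F))
    -- the form and the function induced on `J⁻¹(μ)`
    (Ωμ : Presymplectic.TwoForm F (Presymplectic.LevelSet J μ))
    (hΩμ : Ωμ = Presymplectic.pullback (Presymplectic.levelIncl J μ) Ω)
    (Hμ : Presymplectic.LevelSet J μ → ℝ) (hHμ : Hμ = H ∘ Presymplectic.levelIncl J μ)
    -- the quotient manifold `J⁻¹(μ) / ker Ω_μ` and the canonical projection onto it
    {Q : Type*} [NormedAddCommGroup Q] [NormedSpace ℝ Q] [FiniteDimensional ℝ Q]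
    [ChartedSpace Q (Presymplectic.LeafSpace (Presymplectic.ker Ωμ))]
    [IsManifold 𝓘(ℝ, Q) ∞ (Presymplectic.LeafSpace (Presymplectic.ker Ωμ))]
    [T2Space (Presymplectic.LeafSpace (Presymplectic.ker Ωμ))]
    [SecondCountableTopology (Presymplectic.LeafSpace (Presymplectic.ker Ωμ))]
    (π : Presymplectic.LevelSet J μ → Presymplectic.LeafSpace (Presymplectic.ker Ωμ))
    (hπ : π = Presymplectic.leafProj (Presymplectic.ker Ωμ))
    (hsub : Manifold.IsSubmersion 𝓘(ℝ, F) 𝓘(ℝ, Q) ∞ π) :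
    -- `(J⁻¹(μ), Ω_μ)` is presymplectic and invariant under `G_μ`
    Presymplectic.IsPresymplectic Ωμ ∧
    (∀ g ∈ Presymplectic.isotropy G μ, ∀ x : M, J x = μ → J (g • x) = μ) ∧
    -- the leaves of `ker Ω_μ` are the orbits of the identity component of `G_μ`
    (∀ x y : Presymplectic.LevelSet J μ, π x = π y ↔
      ∃ g ∈ connectedComponent (1 : Presymplectic.isotropy G μ),
        (g : G) • (x : M) = (y : M)) ∧
    -- hence `J⁻¹(μ) / ker Ω_μ = J⁻¹(μ) / G_μ` if `G_μ` is connected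
    (IsConnected (Presymplectic.isotropy G μ : Set G) →
      ∀ x y : Presymplectic.LevelSet J μ, π x = π y ↔
        ∃ g ∈ Presymplectic.isotropy G μ, g • (x : M) = (y : M)) ∧
    -- the reduced symplectic Hamiltonian system
    ∃ (Ωhat : Presymplectic.TwoForm Q (Presymplectic.LeafSpace (Presymplectic.ker Ωμ)))
      (Hhat : Presymplectic.LeafSpace (Presymplectic.ker Ωμ) → ℝ)
      (Xhat : Presymplectic.VField Q (Presymplectic.LeafSpace (Presymplectic.ker Ωμ))),
      Presymplectic.IsSymplectic Ωhat ∧ Presymplectic.pullback π Ωhat = Ωμ ∧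
      ContMDiff 𝓘(ℝ, Q) 𝓘(ℝ, ℝ) ∞ Hhat ∧ Hhat ∘ π = Hμ ∧
      Presymplectic.IsDynamics Ωhat Hhat Xhat ∧
      -- every dynamical field `X` of `(M, Ω, H)` restricts to a field on `J⁻¹(μ)`
      (∀ X : Presymplectic.VField E M, Presymplectic.IsDynamics Ω H X →
        ∃! Xμ : Presymplectic.VField F (Presymplectic.LevelSet J μ),
          Presymplectic.IsDynamics Ωμ Hμ Xμ ∧
          Presymplectic.IsRelated (Presymplectic.levelIncl J μ) Xμ X) ∧
      -- and every such restriction, indeed every solution on `J⁻¹(μ)`, projects onto `Xhat`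
      (∀ Xμ : Presymplectic.VField F (Presymplectic.LevelSet J μ),
        Presymplectic.IsDynamics Ωμ Hμ Xμ → Presymplectic.IsRelated π Xμ Xhat) := by
  subst hΩμ hHμ hπ
  have hleaf := Presymplectic.leafProj_eq_iff hfree hΩ hker hJ hμ
  have hsurj : Function.Surjective (Presymplectic.leafProj (Presymplectic.ker
      (Presymplectic.pullback (Presymplectic.levelIncl J μ) Ω :
        Presymplectic.TwoForm F (Presymplectic.LevelSet J μ)))) := Quotient.mk_surjective
  have hpre := Presymplectic.isPresymplectic_pullback_levelIncl hfree hΩ hker hJ hμ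
  obtain ⟨Ωhat, hΩhat, hpull⟩ := Presymplectic.exists_reduced_form hsub hsurj hpre.smooth
    hpre.closed (Presymplectic.D_leafProj_eq_zero_iff hfree hΩ hker hJ hμ hsub) (by
      -- Two points of a leaf differ by an element of the identity component of G_μ, whose action
      -- preserves each leaf and Ω_μ.
      intro x y hxy
      obtain ⟨g, hg, hgxy⟩ := (hleaf x y).1 hxy
      exact ⟨Presymplectic.levelSmul hJ g, Presymplectic.contMDiff_levelSmul hJ hμ g,
        Subtype.ext hgxy, fun z ↦ ((hleaf _ _).2 ⟨g, hg, rfl⟩).symm,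
        Presymplectic.pullback_levelSmul hJ hμ hGΩ g⟩)
  have hHinv : ∀ x y : Presymplectic.LevelSet J μ,
      Presymplectic.leafSetoid (Presymplectic.ker (Presymplectic.pullback
        (Presymplectic.levelIncl J μ) Ω : Presymplectic.TwoForm F (Presymplectic.LevelSet J μ)))
        x y → (H ∘ Presymplectic.levelIncl J μ) x = (H ∘ Presymplectic.levelIncl J μ) y := by
    intro x y hxy
    obtain ⟨g, -, hg⟩ := (hleaf x y).1 (Quotient.sound hxy)
    exact (hGH g x).symm.trans (congrArg H hg)
  have hHhat : ContMDiff 𝓘(ℝ, Q) 𝓘(ℝ, ℝ) ∞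
      (Quotient.lift (H ∘ Presymplectic.levelIncl J μ) hHinv) :=
    Presymplectic.contMDiff_of_comp_submersion hsub hsurj
      (hH.comp (Presymplectic.contMDiff_levelIncl hμ))
  have hrestr := fun X hX ↦ Presymplectic.existsUnique_restriction hJ hμ hH hGH (X := X) hX
  -- A solution on M is needed to produce one on the level set, from which the reduced field is
  -- built.
  obtain ⟨X, hX⟩ := hcompat
  obtain ⟨Xμ, hXμ, -⟩ := (hrestr X hX).exists
  obtain ⟨Xhat, hXhat, hrel⟩ := Presymplectic.exists_reduced_field hsub hsurj hΩhat hpull hHhat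
    (h := H ∘ Presymplectic.levelIncl J μ) rfl ⟨Xμ, hXμ⟩
  refine ⟨hpre, fun g hg x hx ↦ (Presymplectic.momentumMap_smul_eq_iff hJ hx g).2 hg, hleaf, ?_,
    Ωhat, _, Xhat, hΩhat, hpull, hHhat, rfl, hXhat, hrestr, hrel⟩
  intro hconn x y
  have : ConnectedSpace (Presymplectic.isotropy G μ) := Subtype.connectedSpace hconn
  rw [hleaf x y, PreconnectedSpace.connectedComponent_eq_univ]
  exact ⟨fun ⟨g, _, hg⟩ ↦ ⟨g, g.2, hg⟩, fun ⟨g, hgμ, hg⟩ ↦ ⟨⟨g, hgμ⟩, Set.mem_univ _, hg⟩⟩
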